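/- Let $d\ge 1$ and let $V:\mathbb{R}^d\to\mathbb{R}$ be a real function that defines a tempered distribution, with Fourier transform $\hat V\in L^1(\mathbb{R}^d)+L^2(\mathbb{R}^d)$ if $d=1,2,3$, and $\hat V\in L^1(\mathbb{R}^d)+L^p(\mathbb{R}^d)$ for some $1<p<d/(d-2)$ if $d\ge 4$. Let $H=-\Delta+V$ on $L^2(\mathbb{R}^d)$, with domain the set of $u$ in the Sobolev space $H^2(\mathbb{R}^d)$ with $Vu\in L^2(\mathbb{R}^d)$. Let $\phi\in\mathscr{S}(\mathbb{R}^d;\mathbb{R})$ be any Schwartz function with $\int\phi\,dx=1$, put $\phi_h(x)=h^{-d}\phi(x/h)$ and $V_h=(\phi_h*V)|_{h\mathbb{Z}^d}$ for $h>0$, and let $H_h=T_h+V_h$ on $\ell^2(h\mathbb{Z}^d)$, where $T_hu(x)=-h^{-2}\sum_{|x-y|=h}(u(y)-u(x))$ and $\ell^2(h\mathbb{Z}^d)$ carries the norm $\|u\|^2=h^d\sum_{x\in h\mathbb{Z}^d}|u(x)|^2$. Then: (i) There is a family of linear isometries $I_h:\ell^2(h\mathbb{Z}^d)\to L^2(\mathbb{R}^d)$,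 $0<h<1$, such that for every $z\in\mathbb{C}\setminus\sigma(H)$ one has $z\notin\sigma(H_h)$ for all sufficiently small $h$, and $$\lim_{h\to0}\bigl\|I_h(H_h-z)^{-1}I_h^*-(H-z)^{-1}\bigr\|_{L^2\to L^2}=0 .$$ (ii) $\lim_{h\to 0}\sigma_d(H_h)=\sigma_d(H)$ in $\mathbb{C}\setminus\sigma_{\mathrm{ess}}(H)$, including multiplicities, where $\sigma_d$ is the set of isolated points of the spectrum that are eigenvalues of finite multiplicity and $\sigma_{\mathrm{ess}}=\sigma\setminus\sigma_d$. That is: for every $z\in\mathbb{C}\setminus\sigma_{\mathrm{ess}}(H)$ and every sufficiently small $\gamma>0$ there is $h_0>0$ such that for $0<h<h_0$ the spectrum of $H_h$ in $\{\zeta\in\mathbb{C}:|\zeta-z|<\gamma\}$ is discrete, consisting of finitely many points of $\sigma_d(H_h)$, and the number of these eigenvalues, counted with multiplicity, equals the multiplicity $\dim\ker(H-z)$ of $z$ as an eigenvalue of $H$ (which is $0$ if $z\notin\sigma(H)$). -/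

import Mathlib

open MeasureTheory SchwartzMap
open scoped ENNReal FourierTransform Laplacian

noncomputable section

namespace ContinuumLimit

/-! ### Spectral notions for unbounded operators -/

section Spectral

variable {X : Type*} [NormedAddCommGroup X] [NormedSpace ℂ X]

/-- `R` is a bounded two-sided inverse `(A - z)⁻¹` of `A - z : D(A) → X`. -/
def IsResolventAt (A : X →ₗ.[ℂ] X) (z : ℂ) (R : X →L[ℂ] X) : Prop :=
  (∀ y : X, ∃ hy : R y ∈ A.domain, A ⟨R y, hy⟩ - z • R y = y) ∧
    ∀ x : A.domain, R (A x - z • (x : X)) = x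

/-- The resolvent set `ρ(A)`. -/
def rho (A : X →ₗ.[ℂ] X) : Set ℂ := {z | ∃ R : X →L[ℂ] X, IsResolventAt A z R}

/-- The spectrum `σ(A) = ℂ \ ρ(A)`. -/
def sigma (A : X →ₗ.[ℂ] X) : Set ℂ := (rho A)ᶜ

open Classical in
/-- The resolvent `(A - z)⁻¹` for `z ∈ ρ(A)` (and `0` for `z ∈ σ(A)`). -/
def res (A : X →ₗ.[ℂ] X) (z : ℂ) : X →L[ℂ] X :=
  if hz : z ∈ rho A then Classical.choose hz else 0

/-- The eigenspace `ker (A - z)`. -/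
def eigenspace (A : X →ₗ.[ℂ] X) (z : ℂ) : Submodule ℂ X where
  carrier := {x | ∃ hx : x ∈ A.domain, A ⟨x, hx⟩ = z • x}
  zero_mem' := ⟨A.domain.zero_mem, by
    rw [smul_zero]; exact A.map_zero⟩
  add_mem' := by
    rintro x y ⟨hx, hx'⟩ ⟨hy, hy'⟩
    refine ⟨A.domain.add_mem hx hy, ?_⟩
    rw [smul_add, ← hx', ← hy']
    exact A.map_add ⟨x, hx⟩ ⟨y, hy⟩
  smul_mem' := by
    rintro c x ⟨hx, hx'⟩
    refine ⟨A.domain.smul_mem c hx, ?_⟩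
    rw [smul_comm, ← hx']
    exact A.map_smul c ⟨x, hx⟩

/-- The multiplicity `dim ker (A - z)`. For a self-adjoint operator (the only case considered)
the geometric and algebraic multiplicities of an isolated eigenvalue coincide. It is `0` on
`ρ(A)`. -/
def mult (A : X →ₗ.[ℂ] X) (z : ℂ) : ℕ := Module.finrank ℂ (eigenspace A z)

/-- The discrete spectrum of a self-adjoint operator: the isolated points of the spectrum that are
eigenvalues of finite multiplicity. -/
def sigmaDisc (A : X →ₗ.[ℂ] X) : Set ℂ :=
  {z | z ∈ sigma A ∧ (∃ ε > 0, ∀ w ∈ sigma A, dist w z < ε → w = z) ∧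
    eigenspace A z ≠ ⊥ ∧ FiniteDimensional ℂ (eigenspace A z)}

/-- The essential spectrum `σ(A) \ σ_d(A)`. -/
def sigmaEss (A : X →ₗ.[ℂ] X) : Set ℂ := sigma A \ sigmaDisc A

end Spectral

/-- The operator of multiplication by a real function `W` on `L²(μ)`, with its maximal domain
`{u ∈ L² | W u ∈ L²}`. -/
def mulOp {α : Type*} [MeasurableSpace α] (μ : Measure α) (W : α → ℝ) :
    Lp ℂ 2 μ →ₗ.[ℂ] Lp ℂ 2 μ where
  domain :=
    { carrier := {u | MemLp (fun x => (W x : ℂ) * u x) 2 μ}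
      zero_mem' := by
        refine MemLp.ae_eq (f := fun _ => 0) ?_ MemLp.zero
        filter_upwards [Lp.coeFn_zero ℂ 2 μ] with x hx
        rw [hx, Pi.zero_apply, mul_zero]
      add_mem' := by
        intro u v hu hv
        refine MemLp.ae_eq ?_ (MemLp.add hu hv)
        filter_upwards [Lp.coeFn_add u v] with x hx
        rw [hx, Pi.add_apply, Pi.add_apply, mul_add]
      smul_mem' := by
        intro c u hu
        refine MemLp.ae_eq ?_ (MemLp.const_smul hu c)
        filter_upwards [Lp.coeFn_smul c u] with x hx
        simp only [Pi.smul_apply, smul_eq_mul, hx]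
        ring }
  toFun :=
    { toFun := fun u => MemLp.toLp _ u.2
      map_add' := by
        intro u v
        rw [← MemLp.toLp_add, MemLp.toLp_eq_toLp_iff]
        filter_upwards [Lp.coeFn_add (u : Lp ℂ 2 μ) v] with x hx
        rw [Pi.add_apply, ← mul_add, ← Pi.add_apply (u : Lp ℂ 2 μ).1 (v : Lp ℂ 2 μ).1, ← hx]
        rfl
      map_smul' := by
        intro c u
        rw [RingHom.id_apply, ← MemLp.toLp_const_smul, MemLp.toLp_eq_toLp_iff]
        filter_upwards [Lp.coeFn_smul c (u : Lp ℂ 2 μ)] with x hx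
        simp only [Submodule.coe_smul, Pi.smul_apply, smul_eq_mul, hx]
        ring }

/-! ### The Schrödinger operator on `ℝ^d` -/

/-- `ℝ^d` with its Euclidean norm. -/
abbrev Space (d : ℕ) := EuclideanSpace ℝ (Fin d)

/-- `L²(ℝ^d)`. -/
abbrev L2 (d : ℕ) := Lp ℂ 2 (volume : Measure (Space d))

/-- The embedding `L²(ℝ^d) → 𝓢'(ℝ^d)`. -/
abbrev toDist (d : ℕ) : L2 d →L[ℂ] 𝓢'(Space d, ℂ) :=
  Lp.toTemperedDistributionCLM ℂ (volume : Measure (Space d)) 2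

theorem toDist_injective (d : ℕ) : Function.Injective (toDist d) :=
  LinearMap.ker_eq_bot.mp (Lp.ker_toTemperedDistributionCLM_eq_bot
    (F := ℂ) (μ := (volume : Measure (Space d))) (p := 2))

theorem exists_negLaplacian {d : ℕ} (u : L2 d)
    (hu : TemperedDistribution.MemSobolev 2 2 (toDist d u)) :
    ∃ f : L2 d, toDist d f = -Δ (toDist d u) := by
  have h := hu.laplacian
  rw [sub_self, TemperedDistribution.memSobolev_zero_iff] at h
  obtain ⟨f, hf⟩ := h
  refine ⟨-f, ?_⟩
  rw [map_neg, hf]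
  rfl

/-- `-Δ u` as an element of `L²(ℝ^d)`, for `u ∈ H²(ℝ^d)`. -/
def negLaplacian {d : ℕ} (u : L2 d) (hu : TemperedDistribution.MemSobolev 2 2 (toDist d u)) :
    L2 d := Classical.choose (exists_negLaplacian u hu)

theorem toDist_negLaplacian {d : ℕ} (u : L2 d)
    (hu : TemperedDistribution.MemSobolev 2 2 (toDist d u)) :
    toDist d (negLaplacian u hu) = -Δ (toDist d u) :=
  Classical.choose_spec (exists_negLaplacian u hu)

theorem negLaplacian_add {d : ℕ} (u v : L2 d)
    (hu : TemperedDistribution.MemSobolev 2 2 (toDist d u))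
    (hv : TemperedDistribution.MemSobolev 2 2 (toDist d v))
    (huv : TemperedDistribution.MemSobolev 2 2 (toDist d (u + v))) :
    negLaplacian (u + v) huv = negLaplacian u hu + negLaplacian v hv := by
  apply toDist_injective
  have h : Δ (toDist d u + toDist d v) = Δ (toDist d u) + Δ (toDist d v) :=
    by simp only [← TemperedDistribution.laplacianCLM_apply, map_add]
  rw [toDist_negLaplacian, map_add, map_add, toDist_negLaplacian, toDist_negLaplacian, h, neg_add]

theorem negLaplacian_smul {d : ℕ} (c : ℂ) (u : L2 d)
    (hu : TemperedDistribution.MemSobolev 2 2 (toDist d u))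
    (hcu : TemperedDistribution.MemSobolev 2 2 (toDist d (c • u))) :
    negLaplacian (c • u) hcu = c • negLaplacian u hu := by
  apply toDist_injective
  have h : Δ (c • toDist d u) = c • Δ (toDist d u) :=
    by simp only [← TemperedDistribution.laplacianCLM_apply, map_smul]
  rw [toDist_negLaplacian, map_smul, map_smul, toDist_negLaplacian, h, smul_neg]

/-- The Sobolev space `H²(ℝ^d)` as a subspace of `L²(ℝ^d)`. -/
def sobolevTwo (d : ℕ) : Submodule ℂ (L2 d) where
  carrier := {u | TemperedDistribution.MemSobolev 2 2 (toDist d u)}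
  zero_mem' := by
    rw [Set.mem_ofPred_eq, map_zero]
    exact TemperedDistribution.memSobolev_fun_zero _ _ _ _
  add_mem' := by
    intro u v hu hv
    rw [Set.mem_ofPred_eq, map_add]
    exact hu.add hv
  smul_mem' := by
    intro c u hu
    rw [Set.mem_ofPred_eq, map_smul]
    exact hu.smul c

/-- The operator `T = -Δ` on `L²(ℝ^d)` with domain `H²(ℝ^d)`. -/
def freeOp (d : ℕ) : L2 d →ₗ.[ℂ] L2 d where
  domain := sobolevTwo d
  toFun :=
    { toFun := fun u => negLaplacian u.1 u.2
      map_add' := fun u v => negLaplacian_add u.1 v.1 u.2 v.2 (u + v).2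
      map_smul' := fun c u => negLaplacian_smul c u.1 u.2 (c • u).2 }

/-- The Schrödinger operator `H = -Δ + V` on `L²(ℝ^d)`, with domain
`{u ∈ H²(ℝ^d) | V u ∈ L²(ℝ^d)}`. -/
def contOp {d : ℕ} (V : Space d → ℝ) : L2 d →ₗ.[ℂ] L2 d := freeOp d + mulOp volume V

/-- `V` is a tempered distribution whose Fourier transform belongs to `L¹(ℝ^d) + L^p(ℝ^d)`.
The normalization of the Fourier transform is immaterial, because these spaces are invariant under
scaling. -/
def FourierMemL1AddLp {d : ℕ} (V : Space d → ℝ) (p : ℝ) : Prop :=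
  (∀ ψ : 𝓢(Space d, ℂ), Integrable (fun x => (V x : ℂ) * ψ x)) ∧
    ∃ g₁ g₂ : Space d → ℂ, MemLp g₁ 1 ∧ MemLp g₂ (ENNReal.ofReal p) ∧
      ∀ ψ : 𝓢(Space d, ℂ),
        ∫ x, (V x : ℂ) * (𝓕 ψ) x = ∫ ξ, (g₁ ξ + g₂ ξ) * ψ ξ

/-! ### The discrete Schrödinger operator on `hℤ^d`

Functions on `hℤ^d` are written as functions of `n ∈ ℤ^d`, the value at `n` being the value at the
lattice point `h n`. -/

/-- The measure on `hℤ^d ≃ ℤ^d` that gives mass `h^d` to every point. -/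
def latMeasure (d : ℕ) (h : ℝ) : Measure (Fin d → ℤ) := ENNReal.ofReal (h ^ d) • Measure.count

/-- `ℓ²(hℤ^d)` with the norm `‖u‖² = h^d ∑ₙ |u (h n)|²`. -/
abbrev LatL2 (d : ℕ) (h : ℝ) := Lp ℂ 2 (latMeasure d h)

theorem measurePreserving_add (d : ℕ) (h : ℝ) (m : Fin d → ℤ) :
    MeasurePreserving (fun n => n + m) (latMeasure d h) (latMeasure d h) := by
  unfold latMeasure
  exact measurePreserving_add_right _ m

/-- The translation `(S_m u)(n) = u(n + m)` on `ℓ²(hℤ^d)`. -/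
def shift (d : ℕ) (h : ℝ) (m : Fin d → ℤ) : LatL2 d h →ₗ[ℂ] LatL2 d h :=
  (Lp.compMeasurePreservingₗᵢ ℂ (fun n => n + m) (measurePreserving_add d h m)).toLinearMap

/-- The discrete Laplacian `T_h u(x) = -h⁻² ∑_{|x - y| = h} (u(y) - u(x))` on `ℓ²(hℤ^d)`; the
neighbours of `x = h n` are the points `h (n ± e_j)`. -/
def latFreeOp (d : ℕ) (h : ℝ) : LatL2 d h →ₗ[ℂ] LatL2 d h :=
  -(((h : ℂ) ^ 2)⁻¹ • ∑ j : Fin d,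
    ((shift d h (Pi.single j 1) - LinearMap.id) + (shift d h (-Pi.single j 1) - LinearMap.id)))

/-- The lattice point `h n ∈ hℤ^d ⊆ ℝ^d`. -/
def latPoint {d : ℕ} (h : ℝ) (n : Fin d → ℤ) : Space d := WithLp.toLp 2 (fun j => h * (n j : ℝ))

/-- The scaled mollifier `φ_h(x) = h^{-d} φ(x/h)`. -/
def scaled {d : ℕ} (φ : 𝓢(Space d, ℝ)) (h : ℝ) (x : Space d) : ℝ := (h ^ d)⁻¹ * φ (h⁻¹ • x)

/-- The discretized potential `V_h(h n) = (φ_h * V)(h n)`. -/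
def latPotential {d : ℕ} (φ : 𝓢(Space d, ℝ)) (V : Space d → ℝ) (h : ℝ) (n : Fin d → ℤ) : ℝ :=
  ∫ y, scaled φ h (latPoint h n - y) * V y

/-- The discrete Schrödinger operator `H_h = T_h + V_h` on `ℓ²(hℤ^d)`, with domain
`{u ∈ ℓ² | V_h u ∈ ℓ²}` (which is all of `ℓ²` when `V_h` is bounded). -/
def latOp {d : ℕ} (φ : 𝓢(Space d, ℝ)) (V : Space d → ℝ) (h : ℝ) :
    LatL2 d h →ₗ.[ℂ] LatL2 d h :=
  (latFreeOp d h).toPMap ⊤ + mulOp (latMeasure d h) (latPotential φ V h)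

end ContinuumLimit

end

open ContinuumLimit

/-! Everything takes place on the Fourier side and at a single spectral point −s with s large.
Fourier series identify ℓ²(hℤ^d) with L² of the torus, the torus is unrolled onto a cell of side 1/h
in frequency space, and the inverse Fourier transform leads to L²(ℝ^d). The composite isometry
`latEmb` is band-limited interpolation. In this picture T_h is multiplication by a symbol that
differs from 4π²|ξ|² by O(h²|ξ|⁴), so the free resolvents differ by O(h²) in norm
(`norm_lift_latRes_sub_contRes_le`).

Write V̂ = g₁ + g₂ with g₁ in L¹ and g₂ in L^p. Then V_h(hn) = ∫ V̂(ζ) φ̂(hζ) e^{2πi hn·ζ} dζ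
(`latPotential_eq_latFun`), so multiplication by V_h is a superposition of torus translations by hζ.
If V̂ has compact support, these translations, applied after the free resolvent, converge in norm to
translations on ℝ^d: wrap-around on the torus only concerns high frequencies, where the free
resolvent is O(h²) (`exists_norm_lift_torusPot_sub_lt`).

General V̂ is reached by density. This needs the bound ‖V_h (s+T_h)⁻¹‖ ≤ C (s⁻¹‖g₁‖₁ + ‖g₂‖_p) with
C independent of h and s ≥ 1 (`exists_norm_torusPot_add_mul_latRes_le`). It comes from a Schur–Young
estimate (`lintegral_schur_le`) combined with an L^q bound on φ̂(hζ) times the periodic symbol of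
the lattice resolvent (`exists_lintegral_schwartz_mul_latSym_le`). The restriction on p enters as 2q
> d for the conjugate exponent, which makes (1+|ξ|²)^{-q} integrable. Hence V_h (s+T_h)⁻¹ has a norm
limit B, with ‖B‖ ≤ 1/2 for large s (`exists_limit_torusPot_mul_latRes`), and testing against
Schwartz functions shows that B is V(s−Δ)⁻¹ (`invF_limit_toLp`, `invF_eq_mul_of_dense`).

Since (H_h+s)⁻¹ = (s+T_h)⁻¹ (1 + V_h (s+T_h)⁻¹)⁻¹, and likewise for H, norm convergence of the
resolvents at −s follows (`exists_resolvent_tendsto`). The rest is abstract. The resolvent at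
another point z is a norm-continuous function of the resolvent at z₀ = −s, which gives (i). A
spectral projection belonging to an isolated part of the spectrum is a continuous function of the
resolvent, and projections at distance less than 1 have equal rank, which gives (ii)
(`IsResolventAt.exists_sigmaDisc_stable`). -/

namespace ContinuumLimit

/-! ### Reduction of an unbounded operator to its resolvent at one point. -/

section AbstractResolvent

variable {X : Type*} [NormedAddCommGroup X] [NormedSpace ℂ X]

theorem IsResolventAt.unique {A : X →ₗ.[ℂ] X} {z : ℂ} {R R' : X →L[ℂ] X}
    (h : IsResolventAt A z R) (h' : IsResolventAt A z R') : R = R' := by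
  ext y
  obtain ⟨hy, e⟩ := h.1 y
  have := h'.2 ⟨R y, hy⟩
  rw [e] at this
  exact this.symm

theorem IsResolventAt.mem_rho {A : X →ₗ.[ℂ] X} {z : ℂ} {R : X →L[ℂ] X}
    (h : IsResolventAt A z R) : z ∈ rho A := ⟨R, h⟩

theorem IsResolventAt.res_eq {A : X →ₗ.[ℂ] X} {z : ℂ} {R : X →L[ℂ] X}
    (h : IsResolventAt A z R) : res A z = R := by
  have hz : z ∈ rho A := h.mem_rho
  rw [res, dif_pos hz]
  exact (Classical.choose_spec hz).unique h

/-- On the domain, A − z = (1 − (z − z₀)R)(A − z₀). Inverting A − z is therefore a question about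
the bounded factor 1 − (z − z₀)R alone. -/
theorem IsResolventAt.of_inverse {A : X →ₗ.[ℂ] X} {z₀ z : ℂ} {R S : X →L[ℂ] X}
    (h : IsResolventAt A z₀ R) (h₁ : (1 - (z - z₀) • R) * S = 1)
    (h₂ : S * (1 - (z - z₀) • R) = 1) : IsResolventAt A z (R * S) := by
  constructor
  · intro y
    obtain ⟨hy, e⟩ := h.1 (S y)
    refine ⟨hy, ?_⟩
    have e₁ : S y - (z - z₀) • R (S y) = y := by
      simpa using congrArg (fun T : X →L[ℂ] X => T y) h₁
    change A ⟨R (S y), hy⟩ - z • R (S y) = y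
    rw [sub_eq_iff_eq_add.1 e]
    refine Eq.trans ?_ e₁
    module
  · intro x
    have e := h.2 x
    have e₁ : A x - z • (x : X) =
        (1 - (z - z₀) • R : X →L[ℂ] X) (A x - z₀ • (x : X)) := by
      simp only [sub_apply, one_apply_eq_self,
        smul_apply, e]
      module
    have e₂ := congrArg (fun T : X →L[ℂ] X => T (A x - z₀ • (x : X))) h₂
    simp only [mul_apply_eq_comp, one_apply_eq_self] at e₂
    rw [mul_apply_eq_comp, e₁, e₂, e]

theorem IsResolventAt.resolvent_identity {A : X →ₗ.[ℂ] X} {z z' : ℂ} {R R' : X →L[ℂ] X}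
    (h : IsResolventAt A z R) (h' : IsResolventAt A z' R') : R' = R + (z' - z) • (R * R') := by
  ext y
  obtain ⟨hy, e⟩ := h'.1 y
  have e₁ := h.2 ⟨R' y, hy⟩
  have e₂ : A ⟨R' y, hy⟩ - z • R' y = y + (z' - z) • R' y := by
    rw [sub_eq_iff_eq_add.1 e]
    module
  change R (A ⟨R' y, hy⟩ - z • R' y) = R' y at e₁
  rw [e₂, map_add, map_smul] at e₁
  exact e₁.symm

theorem IsResolventAt.mem_rho_iff {A : X →ₗ.[ℂ] X} {z₀ z : ℂ} {R : X →L[ℂ] X}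
    (h : IsResolventAt A z₀ R) : z ∈ rho A ↔ IsUnit (1 - (z - z₀) • R) := by
  constructor
  · rintro ⟨R', h'⟩
    have e := h.resolvent_identity h'
    have e' := h'.resolvent_identity h
    refine isUnit_iff_exists.2 ⟨1 + (z - z₀) • R', ?_, ?_⟩
    · have : (1 - (z - z₀) • R) * (1 + (z - z₀) • R')
        = 1 + (z - z₀) • (R' - (R + (z - z₀) • (R * R'))) := by
        simp only [sub_mul, mul_add, one_mul, mul_one, smul_mul_assoc, mul_smul_comm]
        module
      rw [this, ← e, sub_self, smul_zero, add_zero]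
    · have : (1 + (z - z₀) • R') * (1 - (z - z₀) • R)
        = 1 - (z - z₀) • (R - (R' + (z₀ - z) • (R' * R))) := by
        simp only [mul_sub, add_mul, one_mul, mul_one, smul_mul_assoc, mul_smul_comm]
        module
      rw [this, ← e', sub_self, smul_zero, sub_zero]
  · intro hu
    obtain ⟨S, h₁, h₂⟩ := isUnit_iff_exists.1 hu
    exact (h.of_inverse h₁ h₂).mem_rho

theorem IsResolventAt.res_eq_mul_inverse {A : X →ₗ.[ℂ] X} {z₀ z : ℂ} {R : X →L[ℂ] X}
    (h : IsResolventAt A z₀ R) (hu : IsUnit (1 - (z - z₀) • R)) :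
    res A z = R * Ring.inverse (1 - (z - z₀) • R) :=
  (h.of_inverse (Ring.mul_inverse_cancel _ hu) (Ring.inverse_mul_cancel _ hu)).res_eq

theorem isUnit_one_sub_smul_iff {R : X →L[ℂ] X} {c : ℂ} (hc : c ≠ 0) :
    IsUnit (1 - c • R) ↔ c⁻¹ ∉ spectrum ℂ R := by
  rw [spectrum.notMem_iff]
  have : 1 - c • R = (Units.mk0 c hc) • (algebraMap ℂ (X →L[ℂ] X) c⁻¹ - R) := by
    rw [smul_sub, Units.smul_mk0, Units.smul_mk0, Algebra.algebraMap_eq_smul_one,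
      smul_inv_smul₀ hc]
  rw [this, isUnit_smul_iff]

/-- Spectral mapping under w ↦ (w − z₀)⁻¹. The pole z₀ is in the resolvent set and needs its own
case, because `(0 : ℂ)⁻¹ = 0` may well lie in the spectrum of R. -/
theorem IsResolventAt.mem_sigma_iff {A : X →ₗ.[ℂ] X} {z₀ z : ℂ} {R : X →L[ℂ] X}
    (h : IsResolventAt A z₀ R) : z ∈ sigma A ↔ z ≠ z₀ ∧ (z - z₀)⁻¹ ∈ spectrum ℂ R := by
  by_cases hz : z = z₀
  · subst hz
    simp [sigma, h.mem_rho]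
  · rw [sigma, Set.mem_compl_iff, h.mem_rho_iff, isUnit_one_sub_smul_iff (sub_ne_zero.2 hz)]
    simp [hz]

theorem IsResolventAt.mem_eigenspace_iff {A : X →ₗ.[ℂ] X} {z₀ z : ℂ} {R : X →L[ℂ] X}
    (h : IsResolventAt A z₀ R) (hz : z ≠ z₀) (x : X) :
    x ∈ eigenspace A z ↔ R x = (z - z₀)⁻¹ • x := by
  have hc : z - z₀ ≠ 0 := sub_ne_zero.2 hz
  constructor
  · rintro ⟨hx, e⟩
    have e₁ := h.2 ⟨x, hx⟩
    rw [e, ← sub_smul, map_smul] at e₁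
    rw [eq_inv_smul_iff₀ hc]
    exact e₁
  · intro e
    have e' : x = R ((z - z₀) • x) := by rw [map_smul, e, smul_inv_smul₀ hc]
    obtain ⟨hy, e₁⟩ := h.1 ((z - z₀) • x)
    rw [sub_eq_iff_eq_add] at e₁
    have hx : x ∈ A.domain := by rw [e']; exact hy
    refine ⟨hx, ?_⟩
    have : A ⟨x, hx⟩ = A ⟨R ((z - z₀) • x), hy⟩ := by
      congr 2
    rw [this, e₁, ← e']
    module

theorem IsResolventAt.eigenspace_eq {A : X →ₗ.[ℂ] X} {z₀ z : ℂ} {R : X →L[ℂ] X}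
    (h : IsResolventAt A z₀ R) (hz : z ≠ z₀) :
    eigenspace A z = Module.End.eigenspace (R : X →ₗ[ℂ] X) (z - z₀)⁻¹ := by
  ext x
  rw [h.mem_eigenspace_iff hz, Module.End.mem_eigenspace_iff]
  rfl

end AbstractResolvent

/-! ### Transport of operators along an isometry, R ↦ I R I*. -/

section Compression

variable {X Y : Type*} [NormedAddCommGroup X] [InnerProductSpace ℂ X] [CompleteSpace X]
  [NormedAddCommGroup Y] [InnerProductSpace ℂ Y] [CompleteSpace Y]

/-- The operator `I R I*` on `X` induced by an operator `R` on `Y`. -/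
noncomputable def lift (I : Y →ₗᵢ[ℂ] X) (R : Y →L[ℂ] Y) : X →L[ℂ] X :=
  I.toContinuousLinearMap ∘L R ∘L ContinuousLinearMap.adjoint I.toContinuousLinearMap

variable (I : Y →ₗᵢ[ℂ] X)

theorem adjoint_apply_self (y : Y) :
    ContinuousLinearMap.adjoint I.toContinuousLinearMap (I y) = y := by
  refine ext_inner_right ℂ fun w => ?_
  rw [ContinuousLinearMap.adjoint_inner_left]
  exact I.inner_map_map y w

theorem lift_apply (R : Y →L[ℂ] Y) (x : X) :
    lift I R x = I (R (ContinuousLinearMap.adjoint I.toContinuousLinearMap x)) := rfl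

theorem lift_apply_map (R : Y →L[ℂ] Y) (y : Y) : lift I R (I y) = I (R y) := by
  rw [lift_apply, adjoint_apply_self]

theorem lift_mul (R S : Y →L[ℂ] Y) : lift I (R * S) = lift I R * lift I S := by
  ext x
  simp only [mul_apply_eq_comp, lift_apply, adjoint_apply_self]

theorem norm_adjoint_le (x : X) :
    ‖ContinuousLinearMap.adjoint I.toContinuousLinearMap x‖ ≤ ‖x‖ := by
  refine (ContinuousLinearMap.le_opNorm _ _).trans ?_
  rw [LinearIsometryEquiv.norm_map]
  exact mul_le_of_le_one_left (norm_nonneg _) I.norm_toContinuousLinearMap_le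

theorem norm_lift_le (R : Y →L[ℂ] Y) : ‖lift I R‖ ≤ ‖R‖ := by
  refine ContinuousLinearMap.opNorm_le_bound _ (norm_nonneg _) fun x => ?_
  rw [lift_apply, I.norm_map]
  refine (R.le_opNorm _).trans ?_
  exact mul_le_mul_of_nonneg_left (norm_adjoint_le I x) (norm_nonneg _)

theorem isSelfAdjoint_lift {R : Y →L[ℂ] Y} (hR : IsSelfAdjoint R) : IsSelfAdjoint (lift I R) := by
  rw [ContinuousLinearMap.isSelfAdjoint_iff'] at hR ⊢
  rw [lift, ContinuousLinearMap.adjoint_comp, ContinuousLinearMap.adjoint_comp,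
    ContinuousLinearMap.adjoint_adjoint, hR]
  rfl

theorem lift_add (R S : Y →L[ℂ] Y) : lift I (R + S) = lift I R + lift I S := by
  ext x
  simp [lift_apply]

theorem lift_sub (R S : Y →L[ℂ] Y) : lift I (R - S) = lift I R - lift I S := by
  ext x
  simp [lift_apply]

theorem lift_smul (c : ℂ) (R : Y →L[ℂ] Y) : lift I (c • R) = c • lift I R := by
  ext x
  simp [lift_apply]

/-- If `1 - lift R` has an inverse, then so has `1 - R`, and the two inverses are related. -/
theorem exists_inverse_of_lift {R : Y →L[ℂ] Y} {S : X →L[ℂ] X}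
    (h₁ : (1 - lift I R) * S = 1) (h₂ : S * (1 - lift I R) = 1) :
    ∃ S' : Y →L[ℂ] Y, (1 - R) * S' = 1 ∧ S' * (1 - R) = 1 ∧
      ∀ T : Y →L[ℂ] Y, lift I (T * S') = lift I T * S := by
  set J := ContinuousLinearMap.adjoint I.toContinuousLinearMap
  have hJ : ∀ x, J (lift I R x) = R (J x) := fun x => adjoint_apply_self I _
  have k₁ : ∀ x, S x - lift I R (S x) = x := fun x => by
    simpa using congrArg (fun T : X →L[ℂ] X => T x) h₁
  have k₂ : ∀ x, S (x - lift I R x) = x := fun x => by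
    simpa using congrArg (fun T : X →L[ℂ] X => T x) h₂
  refine ⟨J ∘L S ∘L I.toContinuousLinearMap, ?_, ?_, ?_⟩
  · ext y
    have := congrArg J (k₁ (I y))
    rw [map_sub, hJ, adjoint_apply_self] at this
    simpa using this
  · ext y
    have := congrArg J (k₂ (I y))
    rw [lift_apply_map, ← map_sub, adjoint_apply_self] at this
    simpa using this
  · intro T
    ext x
    -- `lift I R` vanishes on the orthogonal complement of the range of I, so S is the identity
    -- there. The component x − I(J x) is thus fixed by S and killed by J.
    have key : J (S (I (J x))) = J (S x) := by
      have e : (I (J x) : X) - lift I R (I (J x)) = I (J (x - lift I R x)) := by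
        rw [lift_apply_map, map_sub, hJ, map_sub]
      have e₁ := k₂ (I (J x))
      have e₂ := k₁ (I (J x))
      have e₃ : J (S (x - I (J x))) = 0 := by
        have hx : x - I (J x) = (x - I (J x)) - lift I R (x - I (J x)) := by
          have : J (x - I (J x)) = 0 := by rw [map_sub, adjoint_apply_self, sub_self]
          rw [lift_apply]
          change _ = _ - I (R (J (x - I (J x))))
          rw [this, map_zero, map_zero, sub_zero]
        rw [hx, k₂, map_sub, adjoint_apply_self, sub_self]
      rw [map_sub, map_sub, sub_eq_zero] at e₃
      exact e₃.symm
    change I (T (J (S (I (J x))))) = I (T (J (S x)))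
    rw [key]

theorem isUnit_of_isUnit_lift {R : Y →L[ℂ] Y} (h : IsUnit (1 - lift I R)) : IsUnit (1 - R) := by
  obtain ⟨S, h₁, h₂⟩ := isUnit_iff_exists.1 h
  obtain ⟨S', h₁', h₂', -⟩ := exists_inverse_of_lift I h₁ h₂
  exact isUnit_iff_exists.2 ⟨S', h₁', h₂'⟩

/-- If S inverts 1 − R, then S = 1 + RS. The operator 1 + `lift I (R * S)` acts as S on the range of
I and as the identity on its complement, so it is the inverse. -/
theorem isUnit_lift_of_isUnit {R : Y →L[ℂ] Y} (h : IsUnit (1 - R)) : IsUnit (1 - lift I R) := by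
  obtain ⟨S, h₁, h₂⟩ := isUnit_iff_exists.1 h
  have e₁ : S - R * S = 1 := by rw [← h₁]; noncomm_ring
  have e₂ : S - S * R = 1 := by rw [← h₂]; noncomm_ring
  refine isUnit_iff_exists.2 ⟨1 + lift I (R * S), ?_, ?_⟩
  · have : (1 - lift I R) * (1 + lift I (R * S)) = 1 + lift I (R * (S - R * S) - R) := by
      rw [lift_sub, mul_sub, lift_sub, lift_mul I R (R * S)]; noncomm_ring
    -- `lift I 0 = 0` is read off from `lift_smul` with the scalar 0.
    rw [this, e₁, mul_one, sub_self, ← zero_smul ℂ (0 : Y →L[ℂ] Y), lift_smul, zero_smul, add_zero]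
  · have hc : R * S = S * R := by
      have := e₁.trans e₂.symm
      exact sub_right_injective this
    have : (1 + lift I (R * S)) * (1 - lift I R) = 1 + lift I ((S - S * R) * R - R) := by
      rw [hc, lift_sub, sub_mul, lift_sub, lift_mul I (S * R) R]; noncomm_ring
    rw [this, e₂, one_mul, sub_self, ← zero_smul ℂ (0 : Y →L[ℂ] Y), lift_smul, zero_smul, add_zero]

/-- The value 0 has to be excluded: if I is not onto, `lift I R` has a kernel that R knows nothing
about. -/
theorem mem_spectrum_lift_iff {R : Y →L[ℂ] Y} {ν : ℂ} (hν : ν ≠ 0) :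
    ν ∈ spectrum ℂ (lift I R) ↔ ν ∈ spectrum ℂ R := by
  have h₁ := isUnit_one_sub_smul_iff (R := lift I R) (inv_ne_zero hν)
  have h₂ := isUnit_one_sub_smul_iff (R := R) (inv_ne_zero hν)
  rw [inv_inv] at h₁ h₂
  rw [← not_iff_not, ← h₁, ← h₂, ← lift_smul]
  exact ⟨isUnit_of_isUnit_lift I, isUnit_lift_of_isUnit I⟩

/-- For `ν ≠ 0`, the operators `R` and `I R I*` have isomorphic eigenspaces. -/
theorem map_eigenspace_lift (R : Y →L[ℂ] Y) {ν : ℂ} (hν : ν ≠ 0) :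
    (Module.End.eigenspace (R : Y →ₗ[ℂ] Y) ν).map I.toLinearMap =
      Module.End.eigenspace (lift I R : X →ₗ[ℂ] X) ν := by
  ext x
  rw [Submodule.mem_map, Module.End.mem_eigenspace_iff]
  constructor
  · rintro ⟨y, hy, rfl⟩
    rw [Module.End.mem_eigenspace_iff] at hy
    have hy' : R y = ν • y := hy
    change lift I R (I y) = ν • I y
    rw [lift_apply_map, hy', map_smul]
  · intro hx
    have hx' : lift I R x = ν • x := hx
    set J := ContinuousLinearMap.adjoint I.toContinuousLinearMap
    have e : I (J x) = x := by
      have : x = ν⁻¹ • I (R (J x)) := by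
        rw [eq_inv_smul_iff₀ hν, ← hx']; rfl
      rw [this, map_smul, map_smul]
      congr 2
      exact adjoint_apply_self I _
    refine ⟨J x, ?_, e⟩
    rw [Module.End.mem_eigenspace_iff]
    have := congrArg J hx'
    rw [map_smul] at this
    rw [← this]
    exact (adjoint_apply_self I _).symm

theorem finrank_eigenspace_lift (R : Y →L[ℂ] Y) {ν : ℂ} (hν : ν ≠ 0) :
    Module.finrank ℂ (Module.End.eigenspace (lift I R : X →ₗ[ℂ] X) ν) =
      Module.finrank ℂ (Module.End.eigenspace (R : Y →ₗ[ℂ] Y) ν) := by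
  rw [← map_eigenspace_lift I R hν]
  exact (Submodule.equivMapOfInjective I.toLinearMap I.injective _).finrank_eq.symm

end Compression

/-! ### From convergence at one point to convergence on the whole resolvent set. -/

section Stability

variable {X : Type*} [NormedAddCommGroup X] [InnerProductSpace ℂ X] [CompleteSpace X]

/-- Norm convergence of the resolvents at one point implies norm convergence at every other
point of the resolvent set. -/
theorem IsResolventAt.exists_norm_lift_res_sub_lt {A : X →ₗ.[ℂ] X} {z₀ z : ℂ} {R : X →L[ℂ] X}
    (h : IsResolventAt A z₀ R) (hz : z ∈ rho A) {ε : ℝ} (hε : 0 < ε) :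
    ∃ δ > 0, ∀ {Y : Type} [NormedAddCommGroup Y] [InnerProductSpace ℂ Y] [CompleteSpace Y]
      (I : Y →ₗᵢ[ℂ] X) (A' : Y →ₗ.[ℂ] Y) (R' : Y →L[ℂ] Y), IsResolventAt A' z₀ R' →
      ‖lift I R' - R‖ < δ → z ∈ rho A' ∧ ‖lift I (res A' z) - res A z‖ < ε := by
  set c := z - z₀ with hc
  have hu : IsUnit (1 - c • R) := h.mem_rho_iff.1 hz
  -- The resolvent of A at z is R(1 − cR)⁻¹, a norm-continuous function of R wherever the inverse
  -- exists. Units form an open set, so invertibility also persists nearby.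
  have hcont : ContinuousAt (fun T : X →L[ℂ] X => T * Ring.inverse (1 - c • T)) R := by
    refine continuousAt_id.mul ?_
    have h₁ : ContinuousAt (fun T : X →L[ℂ] X => 1 - c • T) R := by fun_prop
    obtain ⟨u, hu'⟩ := hu
    have h₂ := NormedRing.inverse_continuousAt u
    rw [hu'] at h₂
    exact ContinuousAt.comp (f := fun T : X →L[ℂ] X => 1 - c • T) h₂ h₁
  have hopen : ∀ᶠ T in nhds R, IsUnit (1 - c • T) := by
    have h₁ : ContinuousAt (fun T : X →L[ℂ] X => 1 - c • T) R := by fun_prop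
    exact h₁.eventually (Units.isOpen.mem_nhds hu)
  have hev := hopen.and (Metric.continuousAt_iff'.1 hcont ε hε)
  obtain ⟨δ, hδ, hball⟩ := Metric.eventually_nhds_iff.1 hev
  refine ⟨δ, hδ, fun {Y} _ _ _ I A' R' h' hlt => ?_⟩
  obtain ⟨hu', hd⟩ := hball (y := lift I R') (by rwa [dist_eq_norm])
  have hinv₁ := Ring.mul_inverse_cancel _ hu'
  have hinv₂ := Ring.inverse_mul_cancel _ hu'
  have hs : 1 - c • lift I R' = 1 - lift I (c • R') := by rw [lift_smul]
  obtain ⟨S', e₁, e₂, e₃⟩ := exists_inverse_of_lift I (R := c • R')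
    (S := Ring.inverse (1 - c • lift I R')) (by rwa [← hs]) (by rwa [← hs])
  have hr := h'.of_inverse e₁ e₂
  refine ⟨hr.mem_rho, ?_⟩
  rw [hr.res_eq, e₃, h.res_eq_mul_inverse hu, ← dist_eq_norm]
  exact hd

end Stability

/-! ### Eigenvalue counting through the continuous functional calculus. -/

section Counting

variable {X : Type*} [NormedAddCommGroup X] [InnerProductSpace ℂ X] [CompleteSpace X]

/-- Divide: f(t) − f(ν) = k(t)(t − ν) on the spectrum. Because f is constant near ν there, k is
continuous, and the functional calculus gives f(B) − f(ν) = k(B)(B − ν), which kills x. -/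
theorem cfc_apply_of_eigenvector {B : X →L[ℂ] X} (hB : IsStarNormal B) {f : ℂ → ℂ}
    (hf : ContinuousOn f (spectrum ℂ B)) {ν : ℂ}
    (hν : ∀ᶠ t in nhdsWithin ν (spectrum ℂ B), f t = f ν) {x : X} (hx : B x = ν • x) :
    cfc f B x = f ν • x := by
  set k : ℂ → ℂ := fun t => (f t - f ν) / (t - ν) with hk
  have hkc : ContinuousOn k (spectrum ℂ B) := by
    intro t ht
    by_cases htν : t = ν
    · subst htν
      refine ContinuousWithinAt.congr_of_eventuallyEq (f := fun _ => (0 : ℂ))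
        continuousWithinAt_const ?_ ?_
      · filter_upwards [hν] with w hw
        simp [hk, hw]
      · simp [hk]
    · exact ((hf t ht).sub continuousWithinAt_const).div
        (continuousWithinAt_id.sub continuousWithinAt_const) (sub_ne_zero.2 htν)
  have e₁ : cfc (fun t => k t * (t - ν)) B = cfc f B - algebraMap ℂ _ (f ν) := by
    rw [← cfc_const (f ν) B, ← cfc_sub f (fun _ => f ν) B]
    refine cfc_congr fun t ht => ?_
    by_cases htν : t = ν
    · simp [htν]
    · exact div_mul_cancel₀ _ (sub_ne_zero.2 htν)
  have e₂ : cfc (fun t => k t * (t - ν)) B = cfc k B * (B - algebraMap ℂ _ ν) := by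
    rw [cfc_mul k (fun t => t - ν) B, cfc_sub (fun t => t) (fun _ => ν) B, cfc_id' ℂ B,
      cfc_const ν B]
  have e₃ := congrArg (fun T : X →L[ℂ] X => T x) (e₁.symm.trans e₂)
  simp only [sub_apply, mul_apply_eq_comp, Algebra.algebraMap_eq_smul_one, smul_apply,
    one_apply_eq_self, hx, sub_self, map_zero] at e₃
  exact sub_eq_zero.1 e₃

/-- The spectral projection of a bounded self-adjoint operator, given as a continuous function of
the operator: if it has finite rank, the corresponding part of the spectrum consists of finitely
many eigenvalues, and the rank is the sum of their multiplicities. -/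
theorem finite_and_sum_finrank_eigenspace {B : X →L[ℂ] X} (hB : IsSelfAdjoint B) {f : ℂ → ℂ}
    (hf : ContinuousOn f (spectrum ℂ B)) (h01 : ∀ t ∈ spectrum ℂ B, f t = 0 ∨ f t = 1)
    [FiniteDimensional ℂ (LinearMap.range ((cfc f B : X →L[ℂ] X) : X →ₗ[ℂ] X))] :
    {ν ∈ spectrum ℂ B | f ν = 1}.Finite ∧
    (∀ ν ∈ spectrum ℂ B, f ν = 1 → Module.End.eigenspace (B : X →ₗ[ℂ] X) ν ≠ ⊥ ∧
      FiniteDimensional ℂ (Module.End.eigenspace (B : X →ₗ[ℂ] X) ν)) ∧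
    ∑ᶠ ν ∈ {ν ∈ spectrum ℂ B | f ν = 1},
      Module.finrank ℂ (Module.End.eigenspace (B : X →ₗ[ℂ] X) ν) =
        Module.finrank ℂ (LinearMap.range ((cfc f B : X →L[ℂ] X) : X →ₗ[ℂ] X)) := by
  have hn : IsStarNormal B := hB.isStarNormal
  set P : X →L[ℂ] X := cfc f B with hP
  have hloc : ∀ ν ∈ spectrum ℂ B, f ν = 1 → ∀ᶠ t in nhdsWithin ν (spectrum ℂ B), f t = f ν := by
    intro ν hν hfν
    have h₁ : ∀ᶠ t in nhdsWithin ν (spectrum ℂ B), f t ≠ 0 :=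
      (hf ν hν).eventually_ne (by rw [hfν]; exact one_ne_zero)
    filter_upwards [h₁, self_mem_nhdsWithin] with t ht ht'
    rw [hfν]
    exact (h01 t ht').resolve_left ht
  have hcomm : B * P = P * B := by
    have h₁ : cfc (fun t => t * f t) B = B * P := by
      rw [cfc_mul (fun t => t) f B, cfc_id' ℂ B]
    have h₂ : cfc (fun t => f t * t) B = P * B := by
      rw [cfc_mul f (fun t => t) B, cfc_id' ℂ B]
    rw [← h₁, ← h₂]
    simp only [mul_comm]
  have hidem : P * P = P := by
    rw [hP, ← cfc_mul f f B]
    refine cfc_congr fun t ht => ?_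
    rcases h01 t ht with h | h <;> simp [h]
  set W := LinearMap.range (P : X →ₗ[ℂ] X) with hW
  have hPW : ∀ x ∈ W, P x = x := by
    rintro _ ⟨x, rfl⟩
    exact congrArg (fun T : X →L[ℂ] X => T x) hidem
  have hinv : ∀ x ∈ W, (B : X →ₗ[ℂ] X) x ∈ W := by
    intro x hx
    refine ⟨B x, ?_⟩
    have := congrArg (fun T : X →L[ℂ] X => T x) hcomm
    simp only [mul_apply_eq_comp] at this
    change P (B x) = B x
    rw [← this, hPW x hx]
  set BW : Module.End ℂ W := (B : X →ₗ[ℂ] X).restrict hinv with hBW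
  have hsym : BW.IsSymmetric :=
    LinearMap.IsSymmetric.restrict_invariant hB.isSymmetric hinv
  -- eigenspaces
  have heig : ∀ ν, (Module.End.eigenspace BW ν).map W.subtype =
      Module.End.eigenspace (B : X →ₗ[ℂ] X) ν ⊓ W := by
    intro ν
    rw [Module.End.eigenspace, Module.End.eigenspace, Module.End.genEigenspace_restrict,
      Submodule.map_comap_subtype, inf_comm]
  have hle : ∀ ν ∈ spectrum ℂ B, f ν = 1 → Module.End.eigenspace (B : X →ₗ[ℂ] X) ν ≤ W := by
    intro ν hν hfν x hx
    rw [Module.End.mem_eigenspace_iff] at hx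
    refine ⟨x, ?_⟩
    have := cfc_apply_of_eigenvector hn hf (hloc ν hν hfν) hx
    rwa [hfν, one_smul] at this
  have hroot : ∀ ν ∈ spectrum ℂ B, f ν = 1 → BW.HasEigenvalue ν := by
    -- The minimal polynomial of B on the range of P annihilates B there, so m(B)f(B) = 0. Then m·f
    -- vanishes on the spectrum, and every spectral point with f = 1 is a root of m, hence an
    -- eigenvalue.
    have h0 : cfc (fun t => (minpoly ℂ BW).eval t * f t) B = 0 := by
      rw [cfc_mul (fun t => (minpoly ℂ BW).eval t) f B, cfc_polynomial _ B]
      ext x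
      have h₁ : ∀ (q : Polynomial ℂ) (w : W),
          (Polynomial.aeval B q) (w : X) = (Polynomial.aeval BW q w : W) := by
        intro q w
        induction q using Polynomial.induction_on' with
        | add p q hp hq => simp [hp, hq]
        | monomial n a =>
          have h₂ : ∀ n : ℕ, (B ^ n) (w : X) = ((BW ^ n) w : W) := by
            intro n
            induction n with
            | zero => simp
            | succ n ih =>
              rw [pow_succ', pow_succ', mul_apply_eq_comp, ih]
              rfl
          simp [Polynomial.aeval_monomial, Algebra.algebraMap_eq_smul_one, h₂]
      have := h₁ (minpoly ℂ BW) ⟨P x, x, rfl⟩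
      rw [minpoly.aeval] at this
      simpa using this
    intro ν hν hfν
    rw [Module.End.hasEigenvalue_iff_isRoot]
    rw [← cfc_zero ℂ B, cfc_eq_cfc_iff_eqOn] at h0
    have := h0 hν
    simpa [hfν, Polynomial.IsRoot] using this
  have hspec : ∀ ν, BW.HasEigenvalue ν → ν ∈ spectrum ℂ B ∧ f ν = 1 := by
    intro ν hν
    obtain ⟨w, hw⟩ := hν.exists_hasEigenvector
    have hw₁ : B (w : X) = ν • (w : X) := congrArg Subtype.val hw.apply_eq_smul
    have hw0 : (w : X) ≠ 0 := fun h => hw.2 (Subtype.ext h)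
    have hs : ν ∈ spectrum ℂ B := by
      intro hu
      obtain ⟨S, -, hS⟩ := isUnit_iff_exists.1 hu
      have := congrArg (fun T : X →L[ℂ] X => T w) hS
      simp only [mul_apply_eq_comp, sub_apply, Algebra.algebraMap_eq_smul_one, smul_apply,
        one_apply_eq_self, hw₁, sub_self, map_zero] at this
      exact hw0 this.symm
    refine ⟨hs, ?_⟩
    refine (h01 ν hs).resolve_left fun h0 => ?_
    have h₁ : ∀ᶠ t in nhdsWithin ν (spectrum ℂ B), f t = f ν := by
      have h₁ : ∀ᶠ t in nhdsWithin ν (spectrum ℂ B), f t ≠ 1 :=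
        (hf ν hs).eventually_ne (by rw [h0]; exact zero_ne_one)
      filter_upwards [h₁, self_mem_nhdsWithin] with t ht ht'
      rw [h0]
      exact (h01 t ht').resolve_right ht
    have := cfc_apply_of_eigenvector hn hf h₁ hw₁
    rw [h0, zero_smul, hPW _ w.2] at this
    exact hw0 this
  have hset : {ν ∈ spectrum ℂ B | f ν = 1} = {ν | BW.HasEigenvalue ν} :=
    Set.ext fun ν => ⟨fun h => hroot ν h.1 h.2, hspec ν⟩
  have hfin : {ν | BW.HasEigenvalue ν}.Finite := Module.End.finite_hasEigenvalue BW
  have hrank : ∀ ν ∈ spectrum ℂ B, f ν = 1 →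
      Module.finrank ℂ (Module.End.eigenspace (B : X →ₗ[ℂ] X) ν) =
        Module.finrank ℂ (Module.End.eigenspace BW ν) := by
    intro ν hν hfν
    have := heig ν
    rw [inf_eq_left.2 (hle ν hν hfν)] at this
    rw [← this]
    exact (Submodule.equivMapOfInjective W.subtype W.injective_subtype _).finrank_eq.symm
  refine ⟨hset ▸ hfin, ?_, ?_⟩
  · intro ν hν hfν
    have h₁ := heig ν
    rw [inf_eq_left.2 (hle ν hν hfν)] at h₁
    constructor
    · rw [← h₁]
      intro h₂
      exact (hroot ν hν hfν) ((Submodule.eq_bot_iff _).2 fun x hx =>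
        Subtype.ext ((Submodule.eq_bot_iff _).1 h₂ x ⟨x, hx, rfl⟩))
    · exact Submodule.finiteDimensional_of_le (hle ν hν hfν)
  · have hint := hsym.direct_sum_isInternal
    have : Fintype (Module.End.Eigenvalues BW) := inferInstance
    have e₁ := (LinearEquiv.ofBijective (DirectSum.coeLinearMap
      fun μ : BW.Eigenvalues => BW.eigenspace (μ : ℂ)) hint).finrank_eq
    rw [Module.finrank_directSum] at e₁
    rw [← e₁]
    have e₂ : ∑ᶠ ν ∈ {ν ∈ spectrum ℂ B | f ν = 1},
        Module.finrank ℂ (Module.End.eigenspace (B : X →ₗ[ℂ] X) ν) =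
        ∑ᶠ ν ∈ {ν | BW.HasEigenvalue ν}, Module.finrank ℂ (Module.End.eigenspace BW ν) := by
      rw [hset]
      refine finsum_mem_congr rfl fun ν hν => ?_
      obtain ⟨h₁, h₂⟩ := hspec ν hν
      exact hrank ν h₁ h₂
    rw [e₂]
    rw [← finsum_eq_sum_of_fintype]
    exact (finsum_set_coe_eq_finsum_mem _).symm

end Counting

/-! ### Stability of isolated eigenvalues and of their multiplicities. -/

section Discrete

variable {X : Type*} [NormedAddCommGroup X] [InnerProductSpace ℂ X] [CompleteSpace X]

-- P is injective on the range of Q: if Qy = y and Py = 0, then ‖y‖ = ‖(P − Q)y‖, which is less than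
-- ‖y‖ unless y = 0. Used in both directions, this gives equality of ranks.
omit [CompleteSpace X] in
theorem finiteDimensional_range_of_norm_sub_lt_one {P Q : X →L[ℂ] X} (hQ : Q * Q = Q)
    (h : ‖P - Q‖ < 1) [FiniteDimensional ℂ (LinearMap.range (P : X →ₗ[ℂ] X))] :
    FiniteDimensional ℂ (LinearMap.range (Q : X →ₗ[ℂ] X)) ∧
      Module.finrank ℂ (LinearMap.range (Q : X →ₗ[ℂ] X)) ≤
        Module.finrank ℂ (LinearMap.range (P : X →ₗ[ℂ] X)) := by
  set g : LinearMap.range (Q : X →ₗ[ℂ] X) →ₗ[ℂ] LinearMap.range (P : X →ₗ[ℂ] X) :=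
    (P : X →ₗ[ℂ] X).rangeRestrict ∘ₗ Submodule.subtype _ with hg
  have hinj : Function.Injective g := by
    rw [← LinearMap.ker_eq_bot, LinearMap.ker_eq_bot']
    rintro ⟨y, x, rfl⟩ hy
    have hy' : P (Q x) = 0 := congrArg Subtype.val hy
    have hQy : Q (Q x) = Q x := congrArg (fun T : X →L[ℂ] X => T x) hQ
    have : ‖Q x‖ ≤ ‖P - Q‖ * ‖Q x‖ := by
      have h₁ := (P - Q).le_opNorm (Q x)
      rwa [sub_apply, hy', hQy, zero_sub, norm_neg] at h₁
    have h0 : Q x = 0 := by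
      by_contra hne
      have := norm_pos_iff.2 hne
      nlinarith
    exact Subtype.ext h0
  exact ⟨Module.Finite.of_injective g hinj, LinearMap.finrank_le_finrank_of_injective hinj⟩

theorem norm_inv_sub_inv_sub {z₀ w z : ℂ} (hw : w ≠ z₀) (hz : z ≠ z₀) :
    ‖(w - z₀)⁻¹ - (z - z₀)⁻¹‖ = dist w z * ‖(z - z₀)⁻¹‖ * ‖(w - z₀)⁻¹‖ := by
  have h₁ := sub_ne_zero.2 hw
  have h₂ := sub_ne_zero.2 hz
  rw [dist_eq_norm, ← norm_mul, ← norm_mul, ← norm_neg]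
  congr 1
  field_simp
  ring

/-- The function (t − μ)f(t) vanishes on the spectrum, so R − μ annihilates the range of f(R).
Conversely f(R) fixes eigenvectors for μ. The point μ is not assumed to be in the spectrum; if it is
not, both sides are zero. -/
theorem range_cfc_eq_eigenspace {R : X →L[ℂ] X} (hR : IsStarNormal R) {f : ℂ → ℂ}
    (hf : Continuous f) {μ : ℂ} (h01 : ∀ t ∈ spectrum ℂ R, f t = 0 ∨ f t = 1)
    (h1 : ∀ t ∈ spectrum ℂ R, f t = 1 → t = μ) (hμ : f μ = 1) :
    LinearMap.range ((cfc f R : X →L[ℂ] X) : X →ₗ[ℂ] X) =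
      Module.End.eigenspace (R : X →ₗ[ℂ] X) μ := by
  have hzero : (R - algebraMap ℂ _ μ) * cfc f R = 0 := by
    have h₁ : cfc (fun t => (t - μ) * f t) R = (R - algebraMap ℂ _ μ) * cfc f R := by
      rw [cfc_mul (fun t => t - μ) f R (by fun_prop) hf.continuousOn,
        cfc_sub (fun t => t) (fun _ => μ) R, cfc_id' ℂ R, cfc_const μ R]
    rw [← h₁, ← cfc_zero ℂ R]
    refine cfc_congr fun t ht => ?_
    rcases h01 t ht with h' | h'
    · simp [h']
    · simp [h1 t ht h']
  ext x
  rw [Module.End.mem_eigenspace_iff]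
  constructor
  · rintro ⟨y, rfl⟩
    have := congrArg (fun T : X →L[ℂ] X => T y) hzero
    simp only [mul_apply_eq_comp, sub_apply, Algebra.algebraMap_eq_smul_one, smul_apply,
      one_apply_eq_self, zero_apply] at this
    exact sub_eq_zero.1 this
  · intro hx
    refine ⟨x, ?_⟩
    have hev : ∀ᶠ t in nhdsWithin μ (spectrum ℂ R), f t = f μ := by
      have h₁ : ∀ᶠ t in nhdsWithin μ (spectrum ℂ R), f t ≠ 0 :=
        hf.continuousWithinAt.eventually_ne (by rw [hμ]; exact one_ne_zero)
      filter_upwards [h₁, self_mem_nhdsWithin] with t ht ht'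
      rw [hμ]
      exact (h01 t ht').resolve_left ht
    have := cfc_apply_of_eigenvector hR hf.continuousOn hev (x := x) hx
    rwa [hμ, one_smul] at this

theorem cfc_mul_self_eq_self {R : X →L[ℂ] X} {f : ℂ → ℂ}
    (hf : Continuous f) (h01 : ∀ t ∈ spectrum ℂ R, f t = 0 ∨ f t = 1) :
    cfc f R * cfc f R = cfc f R := by
  rw [← cfc_mul f f R hf.continuousOn hf.continuousOn]
  refine cfc_congr fun t ht => ?_
  rcases h01 t ht with h' | h' <;> simp [h']

/-- Continuity of B ↦ f(B) holds along normal operators whose spectra stay in a fixed compact set. A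
ball of radius slightly larger than the norm of R serves, and self-adjointness supplies normality.
-/
theorem eventually_norm_cfc_sub_lt {R : X →L[ℂ] X} (hR : IsSelfAdjoint R) {f : ℂ → ℂ}
    (hfc : Continuous f) {ε : ℝ} (hε : 0 < ε) :
    ∀ᶠ B in nhdsWithin R {B | IsSelfAdjoint B}, ‖cfc f B - cfc f R‖ < ε := by
  have hRn : IsStarNormal R := hR.isStarNormal
  have ht : Filter.Tendsto (fun B : X →L[ℂ] X => cfc f B) (nhdsWithin R {B | IsSelfAdjoint B})
      (nhds (cfc f R)) := by
    refine Filter.Tendsto.cfc (p := IsStarNormal)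
      (isCompact_closedBall (0 : ℂ) ((‖R‖ + 1) * ‖(1 : X →L[ℂ] X)‖)) f
      (Filter.tendsto_id.mono_left nhdsWithin_le_nhds) ?_ ?_ ?_ hRn hfc.continuousOn
    · have h₁ : ∀ᶠ B in nhds R, ‖B‖ < ‖R‖ + 1 :=
        continuous_norm.continuousAt.eventually_lt_const (by linarith)
      filter_upwards [nhdsWithin_le_nhds h₁] with B hB
      refine (spectrum.subset_closedBall_norm_mul B).trans
        (Metric.closedBall_subset_closedBall ?_)
      gcongr
    · filter_upwards [self_mem_nhdsWithin] with B hB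
      exact IsSelfAdjoint.isStarNormal hB
    · refine (spectrum.subset_closedBall_norm_mul R).trans
        (Metric.closedBall_subset_closedBall ?_)
      gcongr
      linarith
  filter_upwards [Metric.tendsto_nhds.1 ht ε hε] with B hB
  rwa [dist_eq_norm] at hB

/-- Stability of the part of the discrete spectrum that lies near an isolated eigenvalue `z` (or
near a point `z` of the resolvent set) under norm resolvent perturbations. -/
theorem IsResolventAt.exists_sigmaDisc_stable {A : X →ₗ.[ℂ] X} {z₀ z : ℂ} {R : X →L[ℂ] X}
    (h : IsResolventAt A z₀ R) (hR : IsSelfAdjoint R) (hz : z ≠ z₀) {γ₀ γ : ℝ}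
    (hiso : ∀ w ∈ sigma A, dist w z < γ₀ → w = z) [hfd : FiniteDimensional ℂ (eigenspace A z)]
    (hγ : 0 < γ) (hγ₀ : γ < γ₀) :
    ∃ δ > 0, ∀ {Y : Type} [NormedAddCommGroup Y] [InnerProductSpace ℂ Y] [CompleteSpace Y]
      (I : Y →ₗᵢ[ℂ] X) (A' : Y →ₗ.[ℂ] Y) (R' : Y →L[ℂ] Y), IsResolventAt A' z₀ R' →
      IsSelfAdjoint R' → ‖lift I R' - R‖ < δ →
      sigma A' ∩ Metric.ball z γ ⊆ sigmaDisc A' ∧ (sigmaDisc A' ∩ Metric.ball z γ).Finite ∧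
      ∑ᶠ w ∈ sigmaDisc A' ∩ Metric.ball z γ, mult A' w = mult A z := by
  set μ : ℂ := (z - z₀)⁻¹ with hμ
  have hμ0 : μ ≠ 0 := inv_ne_zero (sub_ne_zero.2 hz)
  have hμpos : 0 < ‖μ‖ := norm_pos_iff.2 hμ0
  -- With t = (w − z₀)⁻¹ one has |t − μ| = |w − z| |μ| |t|, so for w ≠ z₀ the disc |w − z| < γ
  -- becomes the region ρ(t) < 0. This form needs no division and makes sense at t = 0 as well.
  set ρ : ℂ → ℝ := fun t => ‖t - μ‖ - γ * ‖μ‖ * ‖t‖ with hρ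
  have hρc : Continuous ρ := by fun_prop
  have hρw : ∀ w, w ≠ z₀ → ρ (w - z₀)⁻¹ = (dist w z - γ) * (‖μ‖ * ‖(w - z₀)⁻¹‖) := by
    intro w hw
    simp only [hρ]
    rw [norm_inv_sub_inv_sub hw hz, ← hμ]
    ring
  have hρμ : ρ μ = -(γ * ‖μ‖ ^ 2) := by simp only [hρ, sub_self, norm_zero]; ring
  have hρ0 : ∀ t ∈ spectrum ℂ R, 0 < |ρ t| ∧ (ρ t < 0 → t = μ) := by
    intro t ht
    by_cases ht0 : t = 0
    · have : ρ t = ‖μ‖ := by simp [hρ, ht0]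
      rw [this]
      exact ⟨abs_pos.2 hμpos.ne', fun h => absurd h (not_lt.2 hμpos.le)⟩
    · set w := z₀ + t⁻¹ with hw
      have hwt : (w - z₀)⁻¹ = t := by simp [hw]
      have hwz : w ≠ z₀ := by simp [hw, ht0]
      have hws : w ∈ sigma A := h.mem_sigma_iff.2 ⟨hwz, by rwa [hwt]⟩
      by_cases hwz' : w = z
      · have : t = μ := by rw [← hwt, hwz']
        rw [this, hρμ]
        refine ⟨abs_pos.2 (neg_ne_zero.2 (by positivity)), fun _ => rfl⟩
      · have hd : γ₀ ≤ dist w z := by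
          by_contra hlt
          exact hwz' (hiso w hws (not_le.1 hlt))
        have : 0 < ρ t := by
          rw [← hwt, hρw w hwz, hwt]
          have : 0 < ‖t‖ := norm_pos_iff.2 ht0
          have : 0 < dist w z - γ := by linarith
          positivity
        exact ⟨abs_pos.2 this.ne', fun h => absurd h (not_lt.2 this.le)⟩
  obtain ⟨δ₁, hδ₁, hδ₁'⟩ := (spectrum.isCompact (𝕜 := ℂ) R).exists_forall_le'
    (f := fun t => |ρ t|) (hρc.abs.continuousOn) (a := 0) fun t ht => (hρ0 t ht).1
  -- The first entry keeps δ₀ below the minimum of |ρ| on the spectrum, so f takes only the values 0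
  -- and 1 there. The second gives ρ(μ) ≤ −δ₀, hence f(μ) = 1 even if z lies in the resolvent set.
  set δ₀ := min (δ₁ / 2) (γ * ‖μ‖ ^ 2) with hδ₀
  have hδ₀pos : 0 < δ₀ := lt_min (by linarith) (by positivity)
  set f : ℂ → ℂ := fun t => ((max 0 (min 1 (1 / 2 - ρ t / (2 * δ₀))) : ℝ) : ℂ) with hf
  have hfc : Continuous f := by fun_prop
  have hf1 : ∀ t, ρ t ≤ -δ₀ → f t = 1 := by
    intro t ht
    have : 1 ≤ 1 / 2 - ρ t / (2 * δ₀) := by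
      have : ρ t / (2 * δ₀) ≤ - (1 / 2) := by
        rw [div_le_iff₀ (by positivity)]; linarith
      linarith
    simp only [hf]
    rw [min_eq_left this, max_eq_right zero_le_one, Complex.ofReal_one]
  have hf0 : ∀ t, δ₀ ≤ ρ t → f t = 0 := by
    intro t ht
    have : 1 / 2 - ρ t / (2 * δ₀) ≤ 0 := by
      have : 1 / 2 ≤ ρ t / (2 * δ₀) := by
        rw [le_div_iff₀ (by positivity)]; linarith
      linarith
    simp only [hf]
    rw [min_eq_right (this.trans zero_le_one), max_eq_left this, Complex.ofReal_zero]
  have hf01 : ∀ t, δ₀ < |ρ t| → (f t = 1 ↔ ρ t < 0) ∧ (f t = 0 ∨ f t = 1) := by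
    intro t ht
    rcases lt_abs.1 ht with h' | h'
    · have e := hf0 t h'.le
      refine ⟨⟨fun h₁ => ?_, fun h₁ => by linarith⟩, Or.inl e⟩
      rw [e] at h₁
      exact absurd h₁ zero_ne_one
    · have e := hf1 t (by linarith)
      exact ⟨⟨fun _ => by linarith, fun _ => e⟩, Or.inr e⟩
  have hU : IsOpen {t | δ₀ < |ρ t|} := isOpen_lt continuous_const hρc.abs
  have hspecU : spectrum ℂ R ⊆ {t | δ₀ < |ρ t|} := fun t ht =>
    lt_of_lt_of_le ((min_le_left _ _).trans_lt (by linarith)) (hδ₁' t ht)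
  have hRn : IsStarNormal R := hR.isStarNormal
  -- the projection of the unperturbed operator
  have hrange : LinearMap.range ((cfc f R : X →L[ℂ] X) : X →ₗ[ℂ] X) = eigenspace A z := by
    rw [h.eigenspace_eq hz, ← hμ]
    exact range_cfc_eq_eigenspace hRn hfc (fun t ht => (hf01 t (hspecU ht)).2)
      (fun t ht h₁ => (hρ0 t ht).2 ((hf01 t (hspecU ht)).1.1 h₁))
      (hf1 μ (by rw [hρμ]; exact neg_le_neg (min_le_right _ _)))
  have hidem : ∀ B : X →L[ℂ] X, IsSelfAdjoint B → spectrum ℂ B ⊆ {t | δ₀ < |ρ t|} →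
      cfc f B * cfc f B = cfc f B := by
    intro B hB hBs
    exact cfc_mul_self_eq_self hfc fun t ht => (hf01 t (hBs ht)).2
  have hfdR : FiniteDimensional ℂ (LinearMap.range ((cfc f R : X →L[ℂ] X) : X →ₗ[ℂ] X)) := by
    rw [hrange]; exact hfd
  -- perturbation
  have hev₁ : ∀ᶠ B in nhds R, spectrum ℂ B ⊆ {t | δ₀ < |ρ t|} := by
    have := (upperHemicontinuous_spectrum ℂ (X →L[ℂ] X)).forall_isOpen R _ hU hspecU
    exact this
  have hev₂ : ∀ᶠ B in nhdsWithin R {B | IsSelfAdjoint B}, ‖cfc f B - cfc f R‖ < 1 :=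
    eventually_norm_cfc_sub_lt hR hfc one_pos
  obtain ⟨δ, hδ, hball⟩ := Metric.eventually_nhds_iff.1
    (hev₁.and (eventually_nhdsWithin_iff.1 hev₂))
  refine ⟨δ, hδ, fun {Y} _ _ _ I A' R' h' hR' hlt => ?_⟩
  set B := lift I R' with hB
  have hBs : IsSelfAdjoint B := isSelfAdjoint_lift I hR'
  obtain ⟨hBU, hBn⟩ := hball (y := B) (by rwa [dist_eq_norm])
  have hlt1 := hBn hBs
  have h₁ := finiteDimensional_range_of_norm_sub_lt_one (P := cfc f R) (Q := cfc f B)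
    (hidem B hBs hBU) (by rwa [norm_sub_rev])
  have hfdB := h₁.1
  have h₂ := finiteDimensional_range_of_norm_sub_lt_one (P := cfc f B) (Q := cfc f R)
    (hidem R hR hspecU) hlt1
  have hrank := le_antisymm h₁.2 h₂.2
  obtain ⟨hSfin, hSeig, hSsum⟩ := finite_and_sum_finrank_eigenspace hBs hfc.continuousOn
    (fun t ht => (hf01 t (hBU ht)).2)
  -- The compression may create the spectral value 0, which comes from no finite point of the
  -- spectrum of `A'`. It is not counted, since ρ(0) = ‖μ‖ > 0 puts f(0) at most at 1/2.
  have hzero_notin : ∀ t, f t = 1 → t ≠ 0 := by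
    rintro t ht rfl
    have : ρ 0 = ‖μ‖ := by simp [hρ]
    have h₃ : δ₀ ≤ ρ 0 ∨ ρ 0 < δ₀ := le_or_gt _ _
    have hpos : 0 < ρ 0 := by rw [this]; exact hμpos
    have h₄ : 1 / 2 - ρ 0 / (2 * δ₀) < 1 / 2 := by
      have : 0 < ρ 0 / (2 * δ₀) := by positivity
      linarith
    simp only [hf] at ht
    have h₅ : max 0 (min 1 (1 / 2 - ρ 0 / (2 * δ₀))) = 1 := by exact_mod_cast ht
    have h₆ : max 0 (min 1 (1 / 2 - ρ 0 / (2 * δ₀))) ≤ 1 / 2 :=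
      max_le (by norm_num) ((min_le_right _ _).trans h₄.le)
    linarith
  have hmem : ∀ w, w ∈ sigma A' ∩ Metric.ball z γ ↔
      w ≠ z₀ ∧ (w - z₀)⁻¹ ∈ {ν ∈ spectrum ℂ B | f ν = 1} := by
    intro w
    rw [Set.mem_inter_iff, h'.mem_sigma_iff, Metric.mem_ball, and_assoc]
    refine and_congr_right fun hw => ?_
    have hne : (w - z₀)⁻¹ ≠ 0 := inv_ne_zero (sub_ne_zero.2 hw)
    rw [← mem_spectrum_lift_iff I hne]
    refine and_congr_right fun hs => ?_
    rw [(hf01 _ (hBU hs)).1, hρw w hw]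
    have : 0 < ‖μ‖ * ‖(w - z₀)⁻¹‖ := mul_pos hμpos (norm_pos_iff.2 hne)
    constructor
    · intro h'; exact mul_neg_of_neg_of_pos (by linarith) this
    · intro h'
      by_contra hge
      exact absurd h' (not_lt.2 (mul_nonneg (by linarith) this.le))
  have hbij : Set.BijOn (fun w => (w - z₀)⁻¹) (sigma A' ∩ Metric.ball z γ)
      {ν ∈ spectrum ℂ B | f ν = 1} := by
    refine ⟨fun w hw => ((hmem w).1 hw).2, fun w _ w' _ e => ?_, fun ν hν => ?_⟩
    · exact sub_left_injective (inv_injective e)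
    · have hν0 := hzero_notin ν hν.2
      refine ⟨z₀ + ν⁻¹, ?_, by simp⟩
      rw [hmem]
      exact ⟨by simp [hν0], by simpa using hν⟩
  have hfin' : (sigma A' ∩ Metric.ball z γ).Finite := hbij.finite_iff_finite.2 hSfin
  have hsub : sigma A' ∩ Metric.ball z γ ⊆ sigmaDisc A' := by
    intro w hw
    obtain ⟨hwz, hws⟩ := (hmem w).1 hw
    have hne : (w - z₀)⁻¹ ≠ 0 := inv_ne_zero (sub_ne_zero.2 hwz)
    refine ⟨hw.1, ?_, ?_⟩
    · have hopen : IsOpen (Metric.ball z γ \ ((sigma A' ∩ Metric.ball z γ) \ {w})) :=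
        Metric.isOpen_ball.sdiff (hfin'.subset Set.sdiff_subset).isClosed
      obtain ⟨ε, hε, hball⟩ := Metric.isOpen_iff.1 hopen w ⟨hw.2, fun h => h.2 rfl⟩
      refine ⟨ε, hε, fun w' hw' hd => ?_⟩
      have := hball (Metric.mem_ball.2 hd)
      by_contra hne'
      exact this.2 ⟨⟨hw', this.1⟩, hne'⟩
    · have hmap := map_eigenspace_lift I R' hne
      obtain ⟨k₁, k₂⟩ := hSeig _ hws.1 hws.2
      rw [h'.eigenspace_eq hwz]
      rw [← hB] at hmap
      constructor
      · intro hbot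
        rw [hbot, Submodule.map_bot] at hmap
        exact k₁ hmap.symm
      · rw [← hmap] at k₂
        exact (Submodule.equivMapOfInjective I.toLinearMap I.injective _).symm.finiteDimensional
  have hseteq : sigmaDisc A' ∩ Metric.ball z γ = sigma A' ∩ Metric.ball z γ :=
    Set.Subset.antisymm (fun w hw => ⟨hw.1.1, hw.2⟩) fun w hw => ⟨hsub hw, hw.2⟩
  refine ⟨hsub, hseteq ▸ hfin', ?_⟩
  rw [hseteq, mult, ← hrange, ← hrank, ← hSsum]
  refine finsum_mem_eq_of_bijOn _ hbij fun w hw => ?_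
  obtain ⟨hwz, hws⟩ := (hmem w).1 hw
  rw [mult, h'.eigenspace_eq hwz, hB,
    finrank_eigenspace_lift I R' (inv_ne_zero (sub_ne_zero.2 hwz))]

end Discrete

/-! ### Multiplication operators and weak superpositions. -/

section Tools

/-- Operators given as integrals over ζ are handled only through their matrix elements; this turns
bounds on those into norm bounds, so no operator-valued integral is needed. -/
theorem norm_le_of_norm_inner_le {X : Type*} [NormedAddCommGroup X] [InnerProductSpace ℂ X]
    (T : X →L[ℂ] X) {C : ℝ} (hC : 0 ≤ C) (h : ∀ k f : X, ‖inner ℂ k (T f)‖ ≤ C * ‖k‖ * ‖f‖) :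
    ‖T‖ ≤ C := by
  refine T.opNorm_le_bound hC fun f => ?_
  have h₁ := h (T f) f
  rw [inner_self_eq_norm_sq_to_K, norm_pow, RCLike.norm_ofReal, abs_norm] at h₁
  by_cases h0 : ‖T f‖ = 0
  · rw [h0]; positivity
  · have : 0 < ‖T f‖ := lt_of_le_of_ne (norm_nonneg _) (Ne.symm h0)
    nlinarith

variable {α : Type*} [MeasurableSpace α] {μ : Measure α}

theorem memLp_mul_of_top {m : α → ℂ} (hm : MemLp m ⊤ μ) (f : Lp ℂ 2 μ) :
    MemLp (fun x => m x * f x) 2 μ :=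
  MemLp.mul (p := ⊤) (q := 2) (r := 2) (Lp.memLp f) hm

open Classical in
/-- Multiplication by a bounded function on `L²(μ)` (and `0` if the function is not essentially
bounded). -/
noncomputable def mulCLM (μ : Measure α) (m : α → ℂ) : Lp ℂ 2 μ →L[ℂ] Lp ℂ 2 μ :=
  if hm : MemLp m ⊤ μ then
    LinearMap.mkContinuous
      { toFun := fun f => MemLp.toLp (fun x => m x * f x) (memLp_mul_of_top hm f)
        map_add' := by
          intro f g
          rw [← MemLp.toLp_add, MemLp.toLp_eq_toLp_iff]
          filter_upwards [Lp.coeFn_add f g] with x hx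
          simp only [Pi.add_apply, hx, mul_add]
        map_smul' := by
          intro c f
          rw [RingHom.id_apply, ← MemLp.toLp_const_smul, MemLp.toLp_eq_toLp_iff]
          filter_upwards [Lp.coeFn_smul c f] with x hx
          simp only [Pi.smul_apply, hx, smul_eq_mul]
          ring }
      (eLpNorm m ⊤ μ).toReal (by
        intro f
        refine Lp.norm_le_mul_norm_of_ae_le_mul ?_
        filter_upwards [MemLp.coeFn_toLp (memLp_mul_of_top hm f),
          ae_le_eLpNormEssSup (f := m) (μ := μ)] with x hx hx'
        change ‖(MemLp.toLp (fun x => m x * f x) (memLp_mul_of_top hm f) : Lp ℂ 2 μ) x‖ ≤ _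
        rw [hx, norm_mul]
        gcongr
        rw [← toReal_enorm, eLpNorm_exponent_top]
        refine ENNReal.toReal_mono ?_ hx'
        rw [← eLpNorm_exponent_top]
        exact hm.2.ne)
  else 0

theorem coeFn_mulCLM {m : α → ℂ} (hm : MemLp m ⊤ μ) (f : Lp ℂ 2 μ) :
    mulCLM μ m f =ᵐ[μ] fun x => m x * f x := by
  rw [mulCLM, dif_pos hm]
  exact MemLp.coeFn_toLp (memLp_mul_of_top hm f)

theorem norm_mulCLM_le {m : α → ℂ} (hm : AEStronglyMeasurable m μ) {C : ℝ} (hC : 0 ≤ C)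
    (h : ∀ x, ‖m x‖ ≤ C) : ‖mulCLM μ m‖ ≤ C := by
  refine ContinuousLinearMap.opNorm_le_bound _ hC fun f => ?_
  refine Lp.norm_le_mul_norm_of_ae_le_mul ?_
  filter_upwards [coeFn_mulCLM (memLp_top_of_bound hm C (ae_of_all _ h)) f] with x hx
  rw [hx, norm_mul]
  exact mul_le_mul_of_nonneg_right (h x) (norm_nonneg _)

theorem mulCLM_eq_of_ae {m : α → ℂ} (hm : MemLp m ⊤ μ) {f g : Lp ℂ 2 μ}
    (h : g =ᵐ[μ] fun x => m x * f x) : mulCLM μ m f = g :=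
  Lp.ext ((coeFn_mulCLM hm f).trans h.symm)

theorem mulCLM_mul {m m' : α → ℂ} (hm : MemLp m ⊤ μ) (hm' : MemLp m' ⊤ μ) :
    mulCLM μ m * mulCLM μ m' = mulCLM μ (fun x => m x * m' x) := by
  ext1 f
  symm
  refine mulCLM_eq_of_ae (hm'.mul' hm) ?_
  filter_upwards [coeFn_mulCLM hm (mulCLM μ m' f), coeFn_mulCLM hm' f] with x h₁ h₂
  rw [mul_apply_eq_comp, h₁, h₂, mul_assoc]

theorem mulCLM_add {m m' : α → ℂ} (hm : MemLp m ⊤ μ) (hm' : MemLp m' ⊤ μ) :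
    mulCLM μ (fun x => m x + m' x) = mulCLM μ m + mulCLM μ m' := by
  ext1 f
  refine mulCLM_eq_of_ae (m := fun x => m x + m' x) (hm.add hm') ?_
  filter_upwards [coeFn_mulCLM hm f, coeFn_mulCLM hm' f,
    Lp.coeFn_add (mulCLM μ m f) (mulCLM μ m' f)] with x h₁ h₂ h₃
  rw [add_apply, h₃, Pi.add_apply, h₁, h₂, add_mul]

theorem mulCLM_sub {m m' : α → ℂ} (hm : MemLp m ⊤ μ) (hm' : MemLp m' ⊤ μ) :
    mulCLM μ (fun x => m x - m' x) = mulCLM μ m - mulCLM μ m' := by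
  ext1 f
  refine mulCLM_eq_of_ae (m := fun x => m x - m' x) (hm.sub hm') ?_
  filter_upwards [coeFn_mulCLM hm f, coeFn_mulCLM hm' f,
    Lp.coeFn_sub (mulCLM μ m f) (mulCLM μ m' f)] with x h₁ h₂ h₃
  rw [sub_apply, h₃, Pi.sub_apply, h₁, h₂, sub_mul]

theorem mulCLM_smul {m : α → ℂ} (hm : MemLp m ⊤ μ) (c : ℂ) :
    mulCLM μ (fun x => c * m x) = c • mulCLM μ m := by
  ext1 f
  refine mulCLM_eq_of_ae (hm.const_mul c) ?_
  filter_upwards [coeFn_mulCLM hm f, Lp.coeFn_smul c (mulCLM μ m f)] with x h₁ h₂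
  rw [smul_apply, h₂, Pi.smul_apply, h₁, smul_eq_mul, mul_assoc]

theorem mulCLM_const_one : mulCLM μ (fun _ => 1) = 1 := by
  ext1 f
  refine mulCLM_eq_of_ae (memLp_top_const 1) ?_
  filter_upwards with x
  rw [one_mul, one_apply_eq_self]

theorem inner_mulCLM {m : α → ℂ} (hm : MemLp m ⊤ μ) (k f : Lp ℂ 2 μ) :
    inner ℂ k (mulCLM μ m f) = ∫ x, inner ℂ (k x) (f x) * m x ∂μ := by
  rw [L2.inner_def]
  refine integral_congr_ae ?_
  filter_upwards [coeFn_mulCLM hm f] with x hx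
  rw [hx]
  simp only [RCLike.inner_apply]
  ring

theorem isSelfAdjoint_mulCLM {m : α → ℝ} (hm : MemLp (fun x => (m x : ℂ)) ⊤ μ) :
    IsSelfAdjoint (mulCLM μ fun x => (m x : ℂ)) := by
  rw [ContinuousLinearMap.isSelfAdjoint_iff_isSymmetric]
  intro f k
  change inner ℂ (mulCLM μ _ f) k = inner ℂ f (mulCLM μ _ k)
  rw [inner_mulCLM hm, ← inner_conj_symm, inner_mulCLM hm, ← integral_conj]
  refine integral_congr_ae (ae_of_all _ fun x => ?_)
  simp only [map_mul, inner_conj_symm, Complex.conj_ofReal]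

section Superposition

variable {Z : Type*} [MeasurableSpace Z] {ν : Measure Z} [SFinite ν] [SFinite μ]

omit [SFinite ν] in
theorem norm_integral_mul_le {a : Z → ℂ} {e : Z → ℂ} {C : ℝ}
    (ha : Integrable a ν) (he1 : ∀ ζ, ‖e ζ‖ ≤ C) :
    ‖∫ ζ, a ζ * e ζ ∂ν‖ ≤ C * ∫ ζ, ‖a ζ‖ ∂ν := by
  rw [← integral_const_mul]
  refine norm_integral_le_of_norm_le (ha.norm.const_mul C) (ae_of_all _ fun ζ => ?_)
  rw [norm_mul, mul_comm]
  exact mul_le_mul_of_nonneg_right (he1 ζ) (norm_nonneg _)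

omit [SFinite μ] in
theorem memLp_top_superposition {a : Z → ℂ} (ha : Integrable a ν) {e : Z → α → ℂ}
    (he : Measurable (Function.uncurry e)) (he1 : ∀ ζ x, ‖e ζ x‖ ≤ 1) :
    MemLp (fun x => ∫ ζ, a ζ * e ζ x ∂ν) ⊤ μ := by
  refine memLp_top_of_bound ?_ (1 * ∫ ζ, ‖a ζ‖ ∂ν)
    (ae_of_all _ fun x => norm_integral_mul_le ha fun ζ => he1 ζ x)
  refine AEStronglyMeasurable.integral_prod_right' (f := fun z : α × Z => a z.2 * e z.2 z.1) ?_
  refine AEStronglyMeasurable.mul (ha.1.comp_snd) ?_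
  exact (he.comp measurable_swap).aestronglyMeasurable

/-- A superposition of bounded multiplication operators, in the weak sense. -/
theorem inner_mulCLM_superposition {a : Z → ℂ} (ha : Integrable a ν) {e : Z → α → ℂ}
    (he : Measurable (Function.uncurry e)) (he1 : ∀ ζ x, ‖e ζ x‖ ≤ 1) (k f : Lp ℂ 2 μ) :
    Integrable (fun ζ => a ζ * inner ℂ k (mulCLM μ (e ζ) f)) ν ∧
    inner ℂ k (mulCLM μ (fun x => ∫ ζ, a ζ * e ζ x ∂ν) f) =
      ∫ ζ, a ζ * inner ℂ k (mulCLM μ (e ζ) f) ∂ν := by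
  have hem : ∀ ζ, MemLp (e ζ) ⊤ μ := fun ζ =>
    memLp_top_of_bound (he.comp measurable_prodMk_left).aestronglyMeasurable 1
      (ae_of_all _ (he1 ζ))
  have hint : Integrable (fun z : Z × α => a z.1 * inner ℂ (k z.2) (f z.2) * e z.1 z.2)
      (ν.prod μ) := by
    have h₁ := ha.mul_prod (L2.integrable_inner (𝕜 := ℂ) k f)
    refine h₁.mul_bdd (c := 1) he.aestronglyMeasurable (ae_of_all _ fun z => he1 z.1 z.2)
  have heq : ∀ ζ, a ζ * inner ℂ k (mulCLM μ (e ζ) f) =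
      ∫ x, a ζ * inner ℂ (k x) (f x) * e ζ x ∂μ := by
    intro ζ
    rw [inner_mulCLM (hem ζ), ← integral_const_mul]
    simp only [mul_assoc]
  constructor
  · simp only [heq]
    exact hint.integral_prod_left
  · rw [inner_mulCLM (memLp_top_superposition ha he he1)]
    simp only [heq]
    rw [integral_integral_swap hint]
    refine integral_congr_ae (ae_of_all _ fun x => ?_)
    simp only
    rw [← integral_const_mul]
    refine integral_congr_ae (ae_of_all _ fun ζ => ?_)
    ring

end Superposition

/-! ### A Schur–Young inequality for averages of translates. -/

section Schur

variable {Z : Type*} [MeasurableSpace Z] {ν : Measure Z} [SFinite ν] [SFinite μ]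

/-- A Schur–Young estimate for a superposition of translates. -/
theorem lintegral_schur_le {T : Z → α → α} (hT : Measurable (Function.uncurry T))
    (hTp : ∀ ζ, MeasurePreserving (T ζ) μ μ) {g w : Z → ℝ≥0∞} (hg : AEMeasurable g ν)
    (hw : Measurable w) {m f k : α → ℝ≥0∞} (hm : Measurable m) (hf : Measurable f)
    (hk : Measurable k) {p q : ℝ} (hpq : p.HolderConjugate q) (hp2 : p ≤ 2) {S : ℝ≥0∞}
    (hS : ∀ x, ∫⁻ ζ, (w ζ * m (T ζ x)) ^ q ∂ν ≤ S) :
    ∫⁻ ζ, ∫⁻ x, g ζ * w ζ * (k x * (m (T ζ x) * f (T ζ x))) ∂μ ∂ν ≤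
      (∫⁻ ζ, g ζ ^ p ∂ν) ^ (1 / p) * S ^ (1 / q) *
        ((∫⁻ x, f x ^ (2 : ℝ) ∂μ) ^ (1 / 2 : ℝ) * (∫⁻ x, k x ^ (2 : ℝ) ∂μ) ^ (1 / 2 : ℝ)) := by
  have hp0 : 0 < p := hpq.pos
  have hq0 : 0 < q := hpq.symm.pos
  have hsum : 1 / p + 1 / q = 1 := by simpa using hpq.inv_add_inv_eq_one
  have hp' : (1 / 2 : ℝ) ≤ 1 / p := one_div_le_one_div_of_le hp0 hp2
  set G := ∫⁻ ζ, g ζ ^ p ∂ν with hG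
  set A : α → ℝ≥0∞ := fun x => ∫⁻ ζ, g ζ ^ p * f (T ζ x) ^ (2 : ℝ) ∂ν with hA
  have hTx : ∀ x, Measurable fun ζ => T ζ x := fun x => hT.comp measurable_prodMk_right
  have hTs : Measurable fun z : α × Z => T z.2 z.1 := hT.comp measurable_swap
  have hgs : AEMeasurable (fun z : Z × α => g z.1) (ν.prod μ) := hg.comp_fst
  have hgs' : AEMeasurable (fun z : α × Z => g z.2) (μ.prod ν) := hg.comp_snd
  have inner_le : ∀ x, ∫⁻ ζ, g ζ * w ζ * (m (T ζ x) * f (T ζ x)) ∂ν ≤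
      A x ^ (1 / 2 : ℝ) * (G ^ (1 / p - 1 / 2) * S ^ (1 / q)) := by
    intro x
    -- Hölder with three factors: g·w·m·f = (g^p f²)^{1/2} · (g^p)^{1/p−1/2} · ((wm)^q)^{1/q}. The
    -- exponents 1/2, 1/p − 1/2 and 1/q add up to 1, and p ≤ 2 makes the middle one nonnegative. The
    -- first factor is left for Cauchy–Schwarz against k in x.
    have key := ENNReal.lintegral_prod_norm_pow_le (μ := ν) (Finset.univ : Finset (Fin 3))
      (f := ![fun ζ => g ζ ^ p * f (T ζ x) ^ (2 : ℝ), fun ζ => g ζ ^ p,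
        fun ζ => (w ζ * m (T ζ x)) ^ q]) (p := ![1 / 2, 1 / p - 1 / 2, 1 / q]) ?_ ?_ ?_
    · simp only [Fin.prod_univ_three, Matrix.cons_val_zero, Matrix.cons_val_one,
        Matrix.cons_val] at key
      refine (le_of_eq (lintegral_congr fun ζ => ?_)).trans (key.trans ?_)
      · rw [ENNReal.mul_rpow_of_nonneg _ _ (by norm_num : (0 : ℝ) ≤ 1 / 2), ← ENNReal.rpow_mul,
          ← ENNReal.rpow_mul, ← ENNReal.rpow_mul, ← ENNReal.rpow_mul,
          mul_one_div_cancel (by norm_num : (2 : ℝ) ≠ 0), mul_one_div_cancel hq0.ne',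
          ENNReal.rpow_one, ENNReal.rpow_one]
        have hge : g ζ = g ζ ^ (p * (1 / 2)) * g ζ ^ (p * (1 / p - 1 / 2)) := by
          rw [← ENNReal.rpow_add_of_nonneg _ _ (by positivity)
            (mul_nonneg hp0.le (by linarith))]
          have : p * (1 / 2) + p * (1 / p - 1 / 2) = 1 := by field_simp; ring
          rw [this, ENNReal.rpow_one]
        nth_rw 1 [hge]
        ring
      · rw [mul_assoc]
        gcongr
        exact hS x
    · intro i _
      fin_cases i
      · exact (hg.pow_const p).mul (((hf.comp (hTx x)).pow_const _).aemeasurable)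
      · exact hg.pow_const p
      · exact ((hw.mul (hm.comp (hTx x))).pow_const q).aemeasurable
    · simp only [Fin.sum_univ_three, Matrix.cons_val_zero, Matrix.cons_val_one, Matrix.cons_val]
      linarith
    · intro i _
      fin_cases i
      · simp
      · simpa using hp'
      · simpa using hq0.le
  have hAm : AEMeasurable A μ := by
    refine AEMeasurable.lintegral_prod_right' (f := fun z : α × Z => g z.2 ^ p *
      f (T z.2 z.1) ^ (2 : ℝ)) ?_
    exact (hgs'.pow_const p).mul ((hf.comp hTs).pow_const _).aemeasurable
  have hAint : ∫⁻ x, A x ∂μ = G * ∫⁻ x, f x ^ (2 : ℝ) ∂μ := by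
    rw [hA, lintegral_lintegral_swap]
    · have : ∀ ζ, ∫⁻ x, g ζ ^ p * f (T ζ x) ^ (2 : ℝ) ∂μ =
          g ζ ^ p * ∫⁻ x, f x ^ (2 : ℝ) ∂μ := by
        intro ζ
        rw [lintegral_const_mul (g ζ ^ p) (f := fun x => f (T ζ x) ^ (2 : ℝ))
          ((hf.comp (hTp ζ).measurable).pow_const _)]
        congr 1
        exact (hTp ζ).lintegral_comp (hf.pow_const _)
      simp only [this]
      rw [lintegral_mul_const'' _ (hg.pow_const p)]
    · exact (hgs'.pow_const p).mul ((hf.comp hTs).pow_const _).aemeasurable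
  calc ∫⁻ ζ, ∫⁻ x, g ζ * w ζ * (k x * (m (T ζ x) * f (T ζ x))) ∂μ ∂ν
      = ∫⁻ x, ∫⁻ ζ, g ζ * w ζ * (k x * (m (T ζ x) * f (T ζ x))) ∂ν ∂μ := by
        refine lintegral_lintegral_swap ?_
        exact (hgs.mul (hw.comp measurable_fst).aemeasurable).mul
          (((hk.comp measurable_snd).mul ((hm.comp hT).mul (hf.comp hT))).aemeasurable)
    _ = ∫⁻ x, k x * ∫⁻ ζ, g ζ * w ζ * (m (T ζ x) * f (T ζ x)) ∂ν ∂μ := by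
        refine lintegral_congr fun x => ?_
        rw [← lintegral_const_mul'']
        · refine lintegral_congr fun ζ => ?_
          ring
        · exact (hg.mul hw.aemeasurable).mul
            ((hm.comp (hTx x)).mul (hf.comp (hTx x))).aemeasurable
    _ ≤ ∫⁻ x, (k x ^ (2 : ℝ)) ^ (1 / 2 : ℝ) * A x ^ (1 / 2 : ℝ) *
          (G ^ (1 / p - 1 / 2) * S ^ (1 / q)) ∂μ := by
        refine lintegral_mono fun x => ?_
        simp only
        rw [← ENNReal.rpow_mul, mul_one_div_cancel (by norm_num : (2 : ℝ) ≠ 0),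
          ENNReal.rpow_one, mul_assoc]
        gcongr
        exact inner_le x
    _ = (∫⁻ x, (k x ^ (2 : ℝ)) ^ (1 / 2 : ℝ) * A x ^ (1 / 2 : ℝ) ∂μ) *
          (G ^ (1 / p - 1 / 2) * S ^ (1 / q)) :=
        lintegral_mul_const'' _
          ((((hk.pow_const _).pow_const _).aemeasurable).mul (hAm.pow_const _))
    _ ≤ (∫⁻ x, k x ^ (2 : ℝ) ∂μ) ^ (1 / 2 : ℝ) * (∫⁻ x, A x ∂μ) ^ (1 / 2 : ℝ) *
          (G ^ (1 / p - 1 / 2) * S ^ (1 / q)) := by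
        gcongr
        exact ENNReal.lintegral_mul_norm_pow_le (hk.pow_const _).aemeasurable hAm
          (by norm_num) (by norm_num) (by norm_num)
    _ = _ := by
        rw [hAint, ENNReal.mul_rpow_of_nonneg _ _ (by norm_num : (0 : ℝ) ≤ 1 / 2)]
        have : G ^ (1 / p) = G ^ (1 / 2 : ℝ) * G ^ (1 / p - 1 / 2) := by
          rw [← ENNReal.rpow_add_of_nonneg _ _ (by norm_num) (by linarith)]
          congr 1
          ring
        rw [this]
        ring

end Schur

end Tools

/-! ### The torus as a fundamental cell in frequency space. -/

section TorusEmbedding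

/-- The torus `(ℝ/ℤ)^d`. -/
abbrev Torus (d : ℕ) := UnitAddTorus (Fin d)

/-- The Haar probability measure on the torus. -/
noncomputable abbrev torusMeasure (d : ℕ) : Measure (Torus d) :=
  Measure.pi fun _ => (AddCircle.haarAddCircle : Measure UnitAddCircle)

/-- `L²` of the torus. -/
noncomputable abbrev TorusL2 (d : ℕ) := Lp ℂ 2 (torusMeasure d)

variable {d : ℕ}

/-- The projection `ℝ^d → (ℝ/ℤ)^d`. -/
def toTorus (x : Space d) : Torus d := fun j => ((x j : ℝ) : UnitAddCircle)

/-- The unit cube `(-1/2, 1/2]^d`. -/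
def unitCube (d : ℕ) : Set (Space d) := {x | ∀ j, x j ∈ Set.Ioc (-1 / 2 : ℝ) (-1 / 2 + 1)}

/-- The representative in the unit cube of a point of the torus. -/
noncomputable def torusRep (θ : Torus d) : Space d :=
  WithLp.toLp 2 fun j => (AddCircle.equivIoc (1 : ℝ) (-1 / 2) (θ j)).1

theorem measurable_toTorus : Measurable (toTorus (d := d)) :=
  measurable_pi_lambda _ fun j => AddCircle.measurable_mk'.comp (by fun_prop)

theorem measurable_torusRep : Measurable (torusRep (d := d)) := by
  refine (WithLp.measurable_toLp 2 _).comp ?_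
  refine measurable_pi_lambda _ fun j => ?_
  exact (measurable_subtype_coe.comp
    (AddCircle.measurableEquivIoc (1 : ℝ) (-1 / 2)).measurable).comp (measurable_pi_apply j)

theorem measurableSet_unitCube : MeasurableSet (unitCube d) := by
  have : unitCube d = ⋂ j, (fun x : Space d => x j) ⁻¹' Set.Ioc (-1 / 2 : ℝ) (-1 / 2 + 1) := by
    ext x; simp [unitCube]
  rw [this]
  exact MeasurableSet.iInter fun j => (by fun_prop : Measurable fun x : Space d => x j)
    measurableSet_Ioc

theorem toTorus_torusRep (θ : Torus d) : toTorus (torusRep θ) = θ := by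
  funext j
  exact (AddCircle.equivIoc (1 : ℝ) (-1 / 2)).symm_apply_apply (θ j)

theorem torusRep_toTorus {x : Space d} (hx : x ∈ unitCube d) : torusRep (toTorus x) = x := by
  ext j
  have := (AddCircle.equivIoc (1 : ℝ) (-1 / 2)).apply_symm_apply ⟨x j, hx j⟩
  exact congrArg Subtype.val this

theorem toTorus_add (x y : Space d) : toTorus (x + y) = toTorus x + toTorus y := by
  funext j
  simp [toTorus]

theorem lintegral_torus (f : Torus d → ℝ≥0∞) :
    ∫⁻ θ, f θ ∂(torusMeasure d) = ∫⁻ x in unitCube d, f (toTorus x) := by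
  have h₁ := UnitAddTorus.lintegral_preimage f (fun _ : Fin d => (-1 / 2 : ℝ))
  refine h₁.trans ?_
  have h₂ := (PiLp.volume_preserving_toLp (Fin d)).setLIntegral_comp_emb
    (MeasurableEquiv.toLp 2 (Fin d → ℝ)).measurableEmbedding (fun x => f (toTorus x))
    {x | ∀ i : Fin d, x i ∈ Set.Ioc (-1 / 2 : ℝ) (-1 / 2 + 1)}
  refine Eq.trans ?_ (h₂.trans ?_)
  · rfl
  · congr 2
    ext x
    constructor
    · rintro ⟨y, hy, rfl⟩
      exact hy
    · intro hx
      exact ⟨WithLp.ofLp x, hx, rfl⟩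

/-- The map `ξ ↦ -hξ mod 1`. -/
noncomputable def latTorus (h : ℝ) (ξ : Space d) : Torus d := toTorus ((-h) • ξ)

/-- The fundamental cell `{ξ | -hξ ∈ (-1/2, 1/2]^d}` of the dual lattice. -/
def cell (d : ℕ) (h : ℝ) : Set (Space d) := {ξ | (-h) • ξ ∈ unitCube d}

/-- The representative in the cell of a point of the torus. -/
noncomputable def cellRep (h : ℝ) (θ : Torus d) : Space d := (-h)⁻¹ • torusRep θ

variable {h : ℝ}

theorem measurable_latTorus : Measurable (latTorus (d := d) h) :=
  measurable_toTorus.comp (by fun_prop)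

theorem measurable_cellRep : Measurable (cellRep (d := d) h) :=
  measurable_torusRep.const_smul (-h)⁻¹

theorem measurableSet_cell : MeasurableSet (cell d h) :=
  (by fun_prop : Measurable fun ξ : Space d => (-h) • ξ) measurableSet_unitCube

theorem latTorus_cellRep (hh : 0 < h) (θ : Torus d) : latTorus h (cellRep h θ) = θ := by
  rw [latTorus, cellRep, smul_inv_smul₀ (neg_ne_zero.2 hh.ne'), toTorus_torusRep]

theorem cellRep_latTorus (hh : 0 < h) {ξ : Space d} (hξ : ξ ∈ cell d h) :
    cellRep h (latTorus h ξ) = ξ := by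
  rw [latTorus, cellRep, torusRep_toTorus hξ, inv_smul_smul₀ (neg_ne_zero.2 hh.ne')]

/-- This is the purpose of the minus sign in `latTorus`. Modulation by a character shifts a Fourier
series by +hζ, since the series carries e^{+2πi n·θ}, but shifts the Fourier transform by −ζ. The
reflection makes the two agree. -/
theorem latTorus_sub (ξ ζ : Space d) :
    latTorus h (ξ - ζ) = latTorus h ξ + toTorus (h • ζ) := by
  rw [latTorus, latTorus, ← toTorus_add]
  congr 1
  module

/-- The Jacobian h^{-d} found here is what the factor √(h^d) in `cellFun` compensates. -/
theorem setLIntegral_cell (hh : 0 < h) (f : Torus d → ℝ≥0∞) (hf : Measurable f) :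
    ∫⁻ ξ in cell d h, f (latTorus h ξ) =
      ENNReal.ofReal ((h ^ d)⁻¹) * ∫⁻ θ, f θ ∂(torusMeasure d) := by
  rw [lintegral_torus]
  have h₁ := Measure.map_addHaar_smul (volume : Measure (Space d)) (neg_ne_zero.2 hh.ne')
  rw [finrank_euclideanSpace_fin, abs_inv, abs_pow, abs_neg, abs_of_pos hh] at h₁
  have hm : Measurable fun x : Space d => f (toTorus x) := hf.comp measurable_toTorus
  have hs : Measurable fun ξ : Space d => (-h) • ξ := by fun_prop
  rw [← lintegral_indicator measurableSet_unitCube, ← smul_eq_mul, ← lintegral_smul_measure, ← h₁,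
    lintegral_map (hm.indicator measurableSet_unitCube) hs,
    ← lintegral_indicator measurableSet_cell]
  rfl

theorem map_latTorus (hh : 0 < h) :
    Measure.map (latTorus h) (volume.restrict (cell d h)) =
      ENNReal.ofReal ((h ^ d)⁻¹) • torusMeasure d := by
  ext s hs
  rw [Measure.map_apply measurable_latTorus hs, Measure.smul_apply, smul_eq_mul,
    ← lintegral_indicator_one hs, ← setLIntegral_cell hh _ (measurable_one.indicator hs),
    ← lintegral_indicator_one (measurable_latTorus hs)]
  rfl

theorem ae_of_ae_torus (hh : 0 < h) {P : Torus d → Prop} (hP : ∀ᵐ θ ∂(torusMeasure d), P θ) :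
    ∀ᵐ ξ : Space d, ξ ∈ cell d h → P (latTorus h ξ) := by
  rw [← ae_restrict_iff' measurableSet_cell]
  refine ae_of_ae_map measurable_latTorus.aemeasurable ?_
  rw [map_latTorus hh]
  exact Measure.ae_smul_measure hP _

/-- The function on `ℝ^d`, supported in the cell, which corresponds to a function on the torus. -/
noncomputable def cellFun (h : ℝ) (F : Torus d → ℂ) : Space d → ℂ :=
  (cell d h).indicator fun ξ => (Real.sqrt (h ^ d) : ℂ) * F (latTorus h ξ)

theorem cellFun_apply_of_mem {F : Torus d → ℂ} {ξ : Space d} (hξ : ξ ∈ cell d h) :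
    cellFun h F ξ = (Real.sqrt (h ^ d) : ℂ) * F (latTorus h ξ) := Set.indicator_of_mem hξ _

theorem cellFun_apply_of_notMem {F : Torus d → ℂ} {ξ : Space d} (hξ : ξ ∉ cell d h) :
    cellFun h F ξ = 0 := Set.indicator_of_notMem hξ _

theorem cellFun_congr_ae (hh : 0 < h) {F G : Torus d → ℂ} (hFG : F =ᵐ[torusMeasure d] G) :
    cellFun h F =ᵐ[volume] cellFun h G := by
  filter_upwards [ae_of_ae_torus hh hFG] with ξ hξ
  by_cases hc : ξ ∈ cell d h
  · rw [cellFun_apply_of_mem hc, cellFun_apply_of_mem hc, hξ hc]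
  · rw [cellFun_apply_of_notMem hc, cellFun_apply_of_notMem hc]

theorem aestronglyMeasurable_cellFun (hh : 0 < h) {F : Torus d → ℂ}
    (hF : AEStronglyMeasurable F (torusMeasure d)) : AEStronglyMeasurable (cellFun h F) := by
  have h₁ : AEStronglyMeasurable F (Measure.map (latTorus h) (volume.restrict (cell d h))) := by
    rw [map_latTorus hh]
    exact hF.smul_measure _
  refine (aestronglyMeasurable_indicator_iff measurableSet_cell).2 ?_
  exact (h₁.comp_measurable measurable_latTorus).const_mul _

theorem eLpNorm_cellFun (hh : 0 < h) {F : Torus d → ℂ}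
    (hF : AEStronglyMeasurable F (torusMeasure d)) :
    eLpNorm (cellFun h F) 2 volume = eLpNorm F 2 (torusMeasure d) := by
  have h₁ : AEStronglyMeasurable F (Measure.map (latTorus h) (volume.restrict (cell d h))) := by
    rw [map_latTorus hh]
    exact hF.smul_measure _
  have hp : 0 < h ^ d := pow_pos hh d
  rw [cellFun, eLpNorm_indicator_eq_eLpNorm_restrict measurableSet_cell]
  have h₂ : (fun ξ : Space d => (Real.sqrt (h ^ d) : ℂ) * F (latTorus h ξ)) =
      (Real.sqrt (h ^ d) : ℂ) • (F ∘ latTorus h) := rfl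
  rw [h₂, eLpNorm_const_smul, ← eLpNorm_map_measure h₁ measurable_latTorus.aemeasurable,
    map_latTorus hh, eLpNorm_smul_measure_of_ne_zero (by simpa using hp), smul_eq_mul, ← mul_assoc]
  have h₃ : ‖(Real.sqrt (h ^ d) : ℂ)‖ₑ = ENNReal.ofReal (h ^ d) ^ (1 / 2 : ℝ) := by
    rw [← ofReal_norm, Complex.norm_real, Real.norm_of_nonneg (Real.sqrt_nonneg _),
      Real.sqrt_eq_rpow, ENNReal.ofReal_rpow_of_nonneg hp.le (by norm_num)]
  have h₄ : (1 / (2 : ℝ≥0∞)).toReal = 1 / 2 := by simp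
  rw [h₃, h₄, ← ENNReal.mul_rpow_of_nonneg _ _ (by norm_num), ← ENNReal.ofReal_mul hp.le,
    mul_inv_cancel₀ hp.ne', ENNReal.ofReal_one, ENNReal.one_rpow, one_mul]

theorem memLp_cellFun (hh : 0 < h) {F : Torus d → ℂ} (hF : MemLp F 2 (torusMeasure d)) :
    MemLp (cellFun h F) 2 volume :=
  ⟨aestronglyMeasurable_cellFun hh hF.1, by rw [eLpNorm_cellFun hh hF.1]; exact hF.2⟩

/-- The isometric embedding of `L²` of the torus into `L²(ℝ^d)`. -/
noncomputable def cellEmb (h : ℝ) (hh : 0 < h) : TorusL2 d →ₗᵢ[ℂ] L2 d where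
  toFun F := (memLp_cellFun hh (Lp.memLp F)).toLp
  map_add' F G := by
    rw [← MemLp.toLp_add, MemLp.toLp_eq_toLp_iff]
    filter_upwards [cellFun_congr_ae hh (Lp.coeFn_add F G)] with ξ hξ
    rw [hξ, Pi.add_apply]
    by_cases hc : ξ ∈ cell d h
    · simp only [cellFun_apply_of_mem hc, Pi.add_apply, mul_add]
    · simp only [cellFun_apply_of_notMem hc, add_zero]
  map_smul' c F := by
    rw [RingHom.id_apply, ← MemLp.toLp_const_smul, MemLp.toLp_eq_toLp_iff]
    filter_upwards [cellFun_congr_ae hh (Lp.coeFn_smul c F)] with ξ hξ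
    rw [hξ, Pi.smul_apply]
    by_cases hc : ξ ∈ cell d h
    · simp only [cellFun_apply_of_mem hc, Pi.smul_apply, smul_eq_mul]
      ring
    · simp only [cellFun_apply_of_notMem hc, smul_zero]
  norm_map' F := by
    change ‖(memLp_cellFun hh (Lp.memLp F)).toLp‖ = ‖F‖
    rw [Lp.norm_toLp, eLpNorm_cellFun hh (Lp.memLp F).1, Lp.norm_def]

theorem coeFn_cellEmb (hh : 0 < h) (F : TorusL2 d) : cellEmb h hh F =ᵐ[volume] cellFun h F :=
  MemLp.coeFn_toLp (memLp_cellFun hh (Lp.memLp F))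

theorem exists_cellEmb_eq (hh : 0 < h) {w : Space d → ℂ} (hw : StronglyMeasurable w)
    (hw₂ : MemLp w 2 volume) : ∃ F : TorusL2 d,
      F =ᵐ[torusMeasure d] (fun θ => (Real.sqrt (h ^ d) : ℂ)⁻¹ * w (cellRep h θ)) ∧
      cellEmb h hh F =ᵐ[volume] (cell d h).indicator w := by
  set F₀ : Torus d → ℂ := fun θ => (Real.sqrt (h ^ d) : ℂ)⁻¹ * w (cellRep h θ) with hF₀
  have hsm : AEStronglyMeasurable F₀ (torusMeasure d) :=
    ((hw.comp_measurable measurable_cellRep).const_mul _).aestronglyMeasurable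
  have hne : (Real.sqrt (h ^ d) : ℂ) ≠ 0 := by
    rw [Complex.ofReal_ne_zero]
    exact (Real.sqrt_pos.2 (pow_pos hh d)).ne'
  have hcf : cellFun h F₀ = (cell d h).indicator w := by
    funext ξ
    by_cases hc : ξ ∈ cell d h
    · rw [cellFun_apply_of_mem hc, Set.indicator_of_mem hc]
      simp only [hF₀]
      rw [cellRep_latTorus hh hc, mul_inv_cancel_left₀ hne]
    · rw [cellFun_apply_of_notMem hc, Set.indicator_of_notMem hc]
  have hmem : MemLp F₀ 2 (torusMeasure d) := by
    refine ⟨hsm, ?_⟩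
    rw [← eLpNorm_cellFun hh hsm, hcf]
    exact (hw₂.indicator measurableSet_cell).2
  refine ⟨hmem.toLp, hmem.coeFn_toLp, ?_⟩
  rw [← hcf]
  exact (coeFn_cellEmb hh _).trans (cellFun_congr_ae hh hmem.coeFn_toLp)

theorem adjoint_cellEmb_eq_zero (hh : 0 < h) {w : L2 d}
    (hw : ∀ᵐ ξ, ξ ∈ cell d h → w ξ = 0) :
    ContinuousLinearMap.adjoint (cellEmb h hh).toContinuousLinearMap w = 0 := by
  refine ext_inner_right ℂ fun F => ?_
  rw [ContinuousLinearMap.adjoint_inner_left, inner_zero_left, L2.inner_def]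
  refine integral_eq_zero_of_ae ?_
  filter_upwards [hw, coeFn_cellEmb hh F] with ξ h₁ h₂
  change inner ℂ (w ξ) ((cellEmb h hh F : L2 d) ξ) = 0
  rw [h₂]
  by_cases hc : ξ ∈ cell d h
  · rw [h₁ hc, inner_zero_left]
  · rw [cellFun_apply_of_notMem hc, inner_zero_right]

/-- A function in `L²(ℝ^d)` splits into a part coming from the torus and a part which the adjoint
of the embedding annihilates. -/
theorem exists_adjoint_cellEmb (hh : 0 < h) (w : L2 d) : ∃ F : TorusL2 d,
    F =ᵐ[torusMeasure d] (fun θ => (Real.sqrt (h ^ d) : ℂ)⁻¹ * w (cellRep h θ)) ∧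
    cellEmb h hh F =ᵐ[volume] (cell d h).indicator w ∧
    ContinuousLinearMap.adjoint (cellEmb h hh).toContinuousLinearMap w = F := by
  obtain ⟨F, hF, hF'⟩ := exists_cellEmb_eq hh (Lp.stronglyMeasurable w) (Lp.memLp w)
  refine ⟨F, hF, hF', ?_⟩
  have h₁ := adjoint_cellEmb_eq_zero hh (w := w - cellEmb h hh F) (by
    filter_upwards [hF', Lp.coeFn_sub w (cellEmb h hh F)] with ξ h₁ h₂ hc
    rw [h₂, Pi.sub_apply, h₁, Set.indicator_of_mem hc, sub_self])
  rw [map_sub, adjoint_apply_self, sub_eq_zero] at h₁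
  exact h₁

theorem lift_cellEmb_mulCLM (hh : 0 < h) {m : Torus d → ℂ} (hm : Measurable m) {C : ℝ}
    (hC : ∀ θ, ‖m θ‖ ≤ C) :
    lift (cellEmb h hh) (mulCLM (torusMeasure d) m) =
      mulCLM volume ((cell d h).indicator fun ξ => m (latTorus h ξ)) := by
  ext1 w
  obtain ⟨F, -, hF', hJ⟩ := exists_adjoint_cellEmb hh w
  have hmt : MemLp m ⊤ (torusMeasure d) :=
    memLp_top_of_bound hm.aestronglyMeasurable C (ae_of_all _ hC)
  have hms : MemLp ((cell d h).indicator fun ξ => m (latTorus h ξ)) ⊤ volume :=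
    (memLp_top_of_bound (hm.comp measurable_latTorus).aestronglyMeasurable C
      (ae_of_all _ fun ξ => hC _)).indicator measurableSet_cell
  symm
  refine mulCLM_eq_of_ae hms ?_
  rw [lift_apply, hJ]
  filter_upwards [coeFn_cellEmb hh (mulCLM (torusMeasure d) m F),
    cellFun_congr_ae hh (coeFn_mulCLM hmt F), coeFn_cellEmb hh F, hF'] with ξ h₁ h₂ h₃ h₄
  rw [h₁, h₂]
  by_cases hc : ξ ∈ cell d h
  · rw [cellFun_apply_of_mem hc] at h₃ ⊢
    rw [Set.indicator_of_mem hc] at h₄ ⊢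
    rw [← h₄, h₃]
    ring
  · rw [cellFun_apply_of_notMem hc, Set.indicator_of_notMem hc, zero_mul]

/-- Translation on `L²` of the torus. -/
noncomputable def torusShift (ω : Torus d) : TorusL2 d →L[ℂ] TorusL2 d :=
  (Lp.compMeasurePreservingₗᵢ ℂ (fun θ => θ + ω)
    (measurePreserving_add_right (torusMeasure d) ω)).toContinuousLinearMap

theorem coeFn_torusShift (ω : Torus d) (F : TorusL2 d) :
    torusShift ω F =ᵐ[torusMeasure d] fun θ => F (θ + ω) :=
  Lp.coeFn_compMeasurePreserving F _

/-- Translation on `L²(ℝ^d)`. -/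
noncomputable def spaceShift (ζ : Space d) : L2 d →L[ℂ] L2 d :=
  (Lp.compMeasurePreservingₗᵢ ℂ (fun ξ => ξ - ζ)
    (measurePreserving_sub_right volume ζ)).toContinuousLinearMap

theorem coeFn_spaceShift (ζ : Space d) (f : L2 d) :
    spaceShift ζ f =ᵐ[volume] fun ξ => f (ξ - ζ) :=
  Lp.coeFn_compMeasurePreserving f _

theorem norm_torusShift_le (ω : Torus d) : ‖torusShift ω‖ ≤ 1 :=
  LinearIsometry.norm_toContinuousLinearMap_le _

theorem norm_spaceShift_le (ζ : Space d) : ‖spaceShift ζ‖ ≤ 1 :=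
  LinearIsometry.norm_toContinuousLinearMap_le _

/-- The cube `|ξ_j| < 1/(4h)`. -/
def smallCube (d : ℕ) (h : ℝ) : Set (Space d) := {ξ | ∀ j, |h * ξ j| < 1 / 4}

theorem smallCube_subset_cell : smallCube d h ⊆ cell d h := by
  intro ξ hξ j
  have := abs_lt.1 (hξ j)
  simp only [PiLp.smul_apply, smul_eq_mul, neg_mul, Set.mem_Ioc]
  constructor <;> linarith

theorem measurableSet_smallCube : MeasurableSet (smallCube d h) := by
  have : smallCube d h = ⋂ j, {ξ : Space d | |h * ξ j| < 1 / 4} := by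
    ext x; simp [smallCube]
  rw [this]
  exact MeasurableSet.iInter fun j => measurableSet_lt (by fun_prop) measurable_const

/-- The small cube has half the side of the cell and hζ is at most a quarter in each coordinate, so
the translated support stays inside the cell and nothing wraps around. -/
theorem lift_cellEmb_torusShift_eq (hh : 0 < h) {ζ : Space d} (hζ : ∀ j, |h * ζ j| ≤ 1 / 4)
    {w : L2 d} (hw : ∀ᵐ ξ, ξ ∉ smallCube d h → w ξ = 0) :
    lift (cellEmb h hh) (torusShift (toTorus (h • ζ))) w = spaceShift ζ w := by
  -- a representative of `w` that vanishes off the small cube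
  set w' : Space d → ℂ := (smallCube d h).indicator w with hw'
  have hww' : w =ᵐ[volume] w' := by
    filter_upwards [hw] with ξ hξ
    by_cases hc : ξ ∈ smallCube d h
    · rw [hw', Set.indicator_of_mem hc]
    · rw [hw', Set.indicator_of_notMem hc, hξ hc]
  have hsm : StronglyMeasurable w' := (Lp.stronglyMeasurable w).indicator measurableSet_smallCube
  obtain ⟨F, hF, hF'⟩ := exists_cellEmb_eq hh hsm
    ((memLp_congr_ae hww').1 (Lp.memLp w))
  have hwF : cellEmb h hh F = w := by
    refine Lp.ext (hF'.trans (Filter.EventuallyEq.trans ?_ hww'.symm))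
    filter_upwards with ξ
    by_cases hc : ξ ∈ cell d h
    · rw [Set.indicator_of_mem hc]
    · rw [Set.indicator_of_notMem hc, hw', Set.indicator_of_notMem]
      exact fun hs => hc (smallCube_subset_cell hs)
  rw [← hwF, lift_apply_map, hwF]
  refine Lp.ext ?_
  have hFs : ∀ᵐ θ ∂(torusMeasure d), F (θ + toTorus (h • ζ)) =
      (Real.sqrt (h ^ d) : ℂ)⁻¹ * w' (cellRep h (θ + toTorus (h • ζ))) :=
    (measurePreserving_add_right (torusMeasure d) (toTorus (h • ζ))).quasiMeasurePreserving.ae hF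
  have hws : ∀ᵐ ξ : Space d, w (ξ - ζ) = w' (ξ - ζ) :=
    (measurePreserving_sub_right volume ζ).quasiMeasurePreserving.ae hww'
  have hne : (Real.sqrt (h ^ d) : ℂ) ≠ 0 := by
    rw [Complex.ofReal_ne_zero]
    exact (Real.sqrt_pos.2 (pow_pos hh d)).ne'
  filter_upwards [coeFn_cellEmb hh (torusShift (toTorus (h • ζ)) F),
    cellFun_congr_ae hh (coeFn_torusShift (toTorus (h • ζ)) F), ae_of_ae_torus hh hFs,
    coeFn_spaceShift ζ w, hws] with ξ h₁ h₂ h₃ h₄ h₅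
  rw [h₁, h₂, h₄, h₅]
  by_cases hs : ξ - ζ ∈ smallCube d h
  · have hξ : ξ ∈ cell d h := by
      intro j
      have e₁ := abs_lt.1 (hs j)
      have e₂ := abs_le.1 (hζ j)
      simp only [PiLp.sub_apply, mul_sub] at e₁
      simp only [PiLp.smul_apply, smul_eq_mul, neg_mul, Set.mem_Ioc]
      constructor <;> linarith
    rw [cellFun_apply_of_mem hξ, h₃ hξ, ← latTorus_sub,
      cellRep_latTorus hh (smallCube_subset_cell hs), mul_inv_cancel_left₀ hne]
  · have hr : w' (ξ - ζ) = 0 := by rw [hw', Set.indicator_of_notMem hs]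
    rw [hr]
    by_cases hξ : ξ ∈ cell d h
    · rw [cellFun_apply_of_mem hξ, h₃ hξ, ← latTorus_sub, mul_inv_cancel_left₀ hne]
      set η := cellRep h (latTorus h (ξ - ζ)) with hη
      rw [hw', Set.indicator_of_notMem]
      intro hηs
      apply hs
      have hT : latTorus h η = latTorus h (ξ - ζ) := latTorus_cellRep hh _
      -- In each coordinate h(ξ − ζ) and hη differ by an integer n. The bounds 1/2 from the cell,
      -- 1/4 from ζ and strictly less than 1/4 from the small cube give |n| < 1, so n = 0.
      have : ξ - ζ = η := by
        ext j
        have e := congrFun hT j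
        simp only [latTorus, toTorus, PiLp.smul_apply, smul_eq_mul] at e
        rw [QuotientAddGroup.eq_iff_sub_mem] at e
        obtain ⟨n, hn⟩ := AddSubgroup.mem_zmultiples_iff.1 e
        have e₁ := abs_lt.1 (hηs j)
        have e₂ := abs_le.1 (hζ j)
        have e₃ := hξ j
        simp only [PiLp.smul_apply, smul_eq_mul, neg_mul, Set.mem_Ioc] at e₃
        simp only [PiLp.sub_apply, zsmul_eq_mul, mul_one] at hn
        have hn1 : (n : ℝ) < 1 := by rw [hn]; linarith
        have hn2 : (-1 : ℝ) < n := by rw [hn]; linarith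
        have hn0 : n = 0 := by
          have : n < 1 := by exact_mod_cast hn1
          have : -1 < n := by exact_mod_cast hn2
          omega
        rw [hn0, Int.cast_zero] at hn
        have : h * ((ξ - ζ) j - η j) = 0 := by simp only [PiLp.sub_apply]; linarith
        rcases mul_eq_zero.1 this with h' | h'
        · exact absurd h' hh.ne'
        · linarith
      rw [this]
      exact hηs
    · rw [cellFun_apply_of_notMem hξ]

end TorusEmbedding

/-! ### Fourier series between the lattice and the torus. -/

section LatticeTorus

variable {d : ℕ} {h : ℝ}

theorem latMeasure_singleton (n : Fin d → ℤ) :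
    latMeasure d h {n} = ENNReal.ofReal (h ^ d) := by
  rw [latMeasure, Measure.smul_apply, Measure.count_singleton, smul_eq_mul, mul_one]

theorem forall_of_ae_latMeasure (hh : 0 < h) {P : (Fin d → ℤ) → Prop}
    (hP : ∀ᵐ n ∂(latMeasure d h), P n) (n : Fin d → ℤ) : P n := by
  by_contra hn
  have h₁ : latMeasure d h {n} ≤ 0 := by
    rw [← ae_iff.1 hP]
    exact measure_mono (by simpa using hn)
  rw [latMeasure_singleton] at h₁
  exact absurd h₁ (not_le.2 (ENNReal.ofReal_pos.2 (pow_pos hh d)))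

theorem inner_latL2 (hh : 0 < h) (u v : LatL2 d h) :
    inner ℂ u v = ∑' n, (h ^ d : ℝ) • inner ℂ (u n) (v n) := by
  rw [L2.inner_def, integral_countable (L2.integrable_inner u v)]
  refine tsum_congr fun n => ?_
  rw [measureReal_def, latMeasure_singleton, ENNReal.toReal_ofReal (pow_pos hh d).le]

theorem memℓp_of_memLp_latMeasure (hh : 0 < h) {u : (Fin d → ℤ) → ℂ}
    (hu : MemLp u 2 (latMeasure d h)) : Memℓp u 2 := by
  rw [memℓp_gen_iff (by simp)]
  have h₁ := (memLp_two_iff_integrable_sq_norm hu.1).1 hu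
  rw [latMeasure, integrable_smul_measure (by simpa using pow_pos hh d) ENNReal.ofReal_ne_top,
    integrable_count_iff] at h₁
  simpa using h₁

theorem memLp_latMeasure_of_memℓp {u : (Fin d → ℤ) → ℂ} (hu : Memℓp u 2) :
    MemLp u 2 (latMeasure d h) := by
  rw [memℓp_gen_iff (by simp)] at hu
  have hm : AEStronglyMeasurable u (latMeasure d h) :=
    (Measurable.of_discrete).aestronglyMeasurable
  rw [memLp_two_iff_integrable_sq_norm hm, latMeasure]
  refine Integrable.smul_measure ?_ ENNReal.ofReal_ne_top
  rw [integrable_count_iff]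
  simpa using hu

/-- The isometry `ℓ²(hℤ^d) → ℓ²(ℤ^d)`, `u ↦ h^{d/2} u`. -/
noncomputable def latToLp (d : ℕ) (h : ℝ) (hh : 0 < h) :
    LatL2 d h →ₗᵢ[ℂ] lp (fun _ : Fin d → ℤ => ℂ) 2 :=
  LinearMap.isometryOfInner
    { toFun := fun u => ⟨fun n => (Real.sqrt (h ^ d) : ℂ) * u n,
        (memℓp_of_memLp_latMeasure hh (Lp.memLp u)).const_mul _⟩
      map_add' := by
        intro u v
        ext n
        have := forall_of_ae_latMeasure hh (Lp.coeFn_add u v) n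
        change (Real.sqrt (h ^ d) : ℂ) * (u + v : LatL2 d h) n =
          (Real.sqrt (h ^ d) : ℂ) * u n + (Real.sqrt (h ^ d) : ℂ) * v n
        rw [this, Pi.add_apply, mul_add]
      map_smul' := by
        intro c u
        ext n
        have := forall_of_ae_latMeasure hh (Lp.coeFn_smul c u) n
        change (Real.sqrt (h ^ d) : ℂ) * (c • u : LatL2 d h) n =
          c * ((Real.sqrt (h ^ d) : ℂ) * u n)
        rw [this, Pi.smul_apply, smul_eq_mul, mul_left_comm] }
    (by
      intro u v
      rw [lp.inner_eq_tsum, inner_latL2 hh]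
      refine tsum_congr fun n => ?_
      simp only [LinearMap.coe_mk, AddHom.coe_mk, RCLike.inner_apply, map_mul, Complex.conj_ofReal,
        Complex.real_smul]
      have : (Real.sqrt (h ^ d) : ℂ) * (Real.sqrt (h ^ d) : ℂ) = ((h ^ d : ℝ) : ℂ) := by
        rw [← Complex.ofReal_mul, Real.mul_self_sqrt (pow_pos hh d).le]
      linear_combination (v n * (starRingEnd ℂ) (u n)) * this)

theorem latToLp_apply (hh : 0 < h) (u : LatL2 d h) (n : Fin d → ℤ) :
    latToLp d h hh u n = (Real.sqrt (h ^ d) : ℂ) * u n := rfl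

theorem latToLp_surjective (hh : 0 < h) : Function.Surjective (latToLp d h hh) := by
  intro a
  have hne : (Real.sqrt (h ^ d) : ℂ) ≠ 0 := by
    rw [Complex.ofReal_ne_zero]
    exact (Real.sqrt_pos.2 (pow_pos hh d)).ne'
  have hm := memLp_latMeasure_of_memℓp (h := h) ((lp.memℓp a).const_mul (Real.sqrt (h ^ d) : ℂ)⁻¹)
  refine ⟨hm.toLp, ?_⟩
  ext n
  rw [latToLp_apply, forall_of_ae_latMeasure hh hm.coeFn_toLp n]
  simp [hne]

/-- The Fourier basis of `L²` of the torus. -/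
noncomputable def torusBasis (d : ℕ) : HilbertBasis (Fin d → ℤ) ℂ (TorusL2 d) :=
  UnitAddTorus.mFourierBasis

/-- The Fourier series as an isometry `ℓ²(hℤ^d) → L²((ℝ/ℤ)^d)`. -/
noncomputable def latToTorus (d : ℕ) (h : ℝ) (hh : 0 < h) : LatL2 d h ≃ₗᵢ[ℂ] TorusL2 d :=
  (LinearIsometryEquiv.ofSurjective (latToLp d h hh) (latToLp_surjective hh)).trans
    (torusBasis d).repr.symm

theorem repr_latToTorus (hh : 0 < h) (u : LatL2 d h) (n : Fin d → ℤ) :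
    (torusBasis d).repr (latToTorus d h hh u) n = (Real.sqrt (h ^ d) : ℂ) * u n := by
  rw [← latToLp_apply hh u n]
  simp [latToTorus]

theorem repr_torusBasis (F : TorusL2 d) (n : Fin d → ℤ) :
    (torusBasis d).repr F n = ∫ θ, UnitAddTorus.mFourier (-n) θ * F θ ∂(torusMeasure d) :=
  UnitAddTorus.mFourierBasis_repr F n

theorem torusBasis_ext {F G : TorusL2 d}
    (hFG : ∀ n, (torusBasis d).repr F n = (torusBasis d).repr G n) : F = G :=
  (torusBasis d).repr.injective (by ext n; exact hFG n)

theorem mFourier_add_apply (n : Fin d → ℤ) (θ ω : Torus d) :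
    UnitAddTorus.mFourier n (θ + ω) = UnitAddTorus.mFourier n θ * UnitAddTorus.mFourier n ω := by
  simp only [UnitAddTorus.mFourier, ContinuousMap.coe_mk, Pi.add_apply, ← Finset.prod_mul_distrib]
  refine Finset.prod_congr rfl fun j _ => ?_
  rw [fourier_apply, fourier_apply, fourier_apply, smul_add, AddCircle.toCircle_add,
    Circle.coe_mul]

theorem norm_mFourier_apply (n : Fin d → ℤ) (θ : Torus d) :
    ‖UnitAddTorus.mFourier n θ‖ = 1 := by
  simp only [UnitAddTorus.mFourier, ContinuousMap.coe_mk, norm_prod, fourier_apply,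
    Circle.norm_coe, Finset.prod_const_one]

theorem repr_torusShift (ω : Torus d) (F : TorusL2 d) (n : Fin d → ℤ) :
    (torusBasis d).repr (torusShift ω F) n =
      UnitAddTorus.mFourier n ω * (torusBasis d).repr F n := by
  rw [repr_torusBasis, repr_torusBasis, ← integral_const_mul]
  have h₁ : ∫ θ, UnitAddTorus.mFourier (-n) θ * torusShift ω F θ ∂(torusMeasure d) =
      ∫ θ, (fun θ' => UnitAddTorus.mFourier n ω * (UnitAddTorus.mFourier (-n) θ' * F θ'))
        (θ + ω) ∂(torusMeasure d) := by
    refine integral_congr_ae ?_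
    filter_upwards [coeFn_torusShift ω F] with θ hθ
    rw [hθ, mFourier_add_apply]
    have : UnitAddTorus.mFourier n ω * UnitAddTorus.mFourier (-n) ω = 1 := by
      rw [← UnitAddTorus.mFourier_add, add_neg_cancel, UnitAddTorus.mFourier_zero]
      rfl
    linear_combination (-UnitAddTorus.mFourier (-n) θ * F (θ + ω)) * this
  rw [h₁]
  exact integral_add_right_eq_self (μ := torusMeasure d)
    (fun θ' => UnitAddTorus.mFourier n ω * (UnitAddTorus.mFourier (-n) θ' * F θ')) ω

theorem memLp_top_mFourier (m : Fin d → ℤ) :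
    MemLp (fun θ => UnitAddTorus.mFourier m θ) ⊤ (torusMeasure d) :=
  memLp_top_of_bound (UnitAddTorus.mFourier m).continuous.aestronglyMeasurable 1
    (ae_of_all _ fun θ => (norm_mFourier_apply m θ).le)

theorem repr_mulCLM_mFourier (m : Fin d → ℤ) (F : TorusL2 d) (n : Fin d → ℤ) :
    (torusBasis d).repr (mulCLM (torusMeasure d) (fun θ => UnitAddTorus.mFourier m θ) F) n =
      (torusBasis d).repr F (n - m) := by
  rw [repr_torusBasis, repr_torusBasis]
  refine integral_congr_ae ?_
  filter_upwards [coeFn_mulCLM (memLp_top_mFourier m) F] with θ hθ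
  rw [hθ, ← mul_assoc, ← UnitAddTorus.mFourier_add, neg_sub, neg_add_eq_sub]

/-- Multiplication by a character of the lattice becomes a translation of the torus. Integrated over
ζ, this represents the potential as an average of translations. -/
theorem latToTorus_mulCLM (hh : 0 < h) (ω : Torus d) (u : LatL2 d h) :
    latToTorus d h hh (mulCLM (latMeasure d h) (fun n => UnitAddTorus.mFourier n ω) u) =
      torusShift ω (latToTorus d h hh u) := by
  refine torusBasis_ext fun n => ?_
  have hm : MemLp (fun n : Fin d → ℤ => UnitAddTorus.mFourier n ω) ⊤ (latMeasure d h) :=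
    memLp_top_of_bound (Measurable.of_discrete).aestronglyMeasurable 1
      (ae_of_all _ fun n => (norm_mFourier_apply n ω).le)
  rw [repr_torusShift, repr_latToTorus, repr_latToTorus,
    forall_of_ae_latMeasure hh (coeFn_mulCLM hm u) n]
  ring

theorem latToTorus_shift (hh : 0 < h) (m : Fin d → ℤ) (u : LatL2 d h) :
    latToTorus d h hh (shift d h m u) =
      mulCLM (torusMeasure d) (fun θ => UnitAddTorus.mFourier (-m) θ) (latToTorus d h hh u) := by
  refine torusBasis_ext fun n => ?_
  have h₁ : ∀ n, (shift d h m u) n = u (n + m) := forall_of_ae_latMeasure hh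
    (Lp.coeFn_compMeasurePreserving u (measurePreserving_add d h m))
  rw [repr_mulCLM_mFourier, repr_latToTorus, repr_latToTorus, h₁, sub_neg_eq_add]

/-- The symbol `∑_j (2 - 2 cos 2πθ_j)` of the discrete Laplacian. -/
noncomputable def latSymbol (θ : Torus d) : ℝ := ∑ j, (2 - 2 * (fourier 1 (θ j)).re)

theorem continuous_latSymbol : Continuous (latSymbol (d := d)) := by
  unfold latSymbol
  fun_prop

theorem re_fourier_le_one (θ : UnitAddCircle) : (fourier 1 θ).re ≤ 1 := by
  refine (Complex.re_le_norm _).trans ?_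
  rw [fourier_apply, Circle.norm_coe]

theorem latSymbol_nonneg (θ : Torus d) : 0 ≤ latSymbol θ :=
  Finset.sum_nonneg fun j _ => by linarith [re_fourier_le_one (θ j)]

theorem latSymbol_eq (θ : Torus d) : (latSymbol θ : ℂ) =
    ∑ j, (2 - UnitAddTorus.mFourier (-Pi.single j 1) θ -
      UnitAddTorus.mFourier (-(-Pi.single j 1)) θ) := by
  rw [latSymbol, Complex.ofReal_sum]
  refine Finset.sum_congr rfl fun j _ => ?_
  rw [neg_neg, UnitAddTorus.mFourier_neg, UnitAddTorus.mFourier_single, sub_sub, add_comm,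
    Complex.add_conj]
  push_cast
  ring

theorem memLp_top_latSymbol (f : ℝ → ℝ) (hf : Continuous f) :
    MemLp (fun θ : Torus d => (f (latSymbol θ) : ℂ)) ⊤ (torusMeasure d) := by
  have hc : Continuous fun θ : Torus d => (f (latSymbol θ) : ℂ) :=
    Complex.continuous_ofReal.comp (hf.comp continuous_latSymbol)
  exact memLp_top_of_bound hc.aestronglyMeasurable ‖ContinuousMap.mk _ hc‖
    (ae_of_all _ fun θ => (ContinuousMap.mk _ hc).norm_coe_le_norm θ)

theorem latToTorus_latFreeOp (hh : 0 < h) (u : LatL2 d h) :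
    latToTorus d h hh (latFreeOp d h u) =
      mulCLM (torusMeasure d) (fun θ => (((h ^ 2)⁻¹ * latSymbol θ : ℝ) : ℂ))
        (latToTorus d h hh u) := by
  set U := latToTorus d h hh u with hU
  have hm : MemLp (fun θ : Torus d => (((h ^ 2)⁻¹ * latSymbol θ : ℝ) : ℂ)) ⊤ (torusMeasure d) :=
    memLp_top_latSymbol (fun t => (h ^ 2)⁻¹ * t) (by fun_prop)
  symm
  refine mulCLM_eq_of_ae hm ?_
  have h₁ : latToTorus d h hh (latFreeOp d h u) = -(((h : ℂ) ^ 2)⁻¹ • ∑ j : Fin d,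
      ((mulCLM (torusMeasure d) (fun θ => UnitAddTorus.mFourier (-Pi.single j 1) θ) U - U) +
       (mulCLM (torusMeasure d) (fun θ => UnitAddTorus.mFourier (-(-Pi.single j 1)) θ) U - U))) := by
    simp only [latFreeOp, LinearMap.neg_apply, LinearMap.smul_apply, LinearMap.sum_apply,
      LinearMap.add_apply, LinearMap.sub_apply, LinearMap.id_apply, map_neg, map_smul, map_sum,
      map_add, map_sub, latToTorus_shift, ← hU]
  rw [h₁]
  have h₂ : ∀ᵐ θ ∂(torusMeasure d), ∀ j : Fin d,
      mulCLM (torusMeasure d) (fun θ => UnitAddTorus.mFourier (-Pi.single j 1) θ) U θ =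
        UnitAddTorus.mFourier (-Pi.single j 1) θ * U θ ∧
      mulCLM (torusMeasure d) (fun θ => UnitAddTorus.mFourier (-(-Pi.single j 1)) θ) U θ =
        UnitAddTorus.mFourier (-(-Pi.single j 1)) θ * U θ := by
    rw [ae_all_iff]
    intro j
    filter_upwards [coeFn_mulCLM (memLp_top_mFourier (-Pi.single j 1)) U,
      coeFn_mulCLM (memLp_top_mFourier (-(-Pi.single j 1))) U] with θ a b
    exact ⟨a, b⟩
  have h₃ : ∀ᵐ θ ∂(torusMeasure d), ∀ j : Fin d,
      ((mulCLM (torusMeasure d) (fun θ => UnitAddTorus.mFourier (-Pi.single j 1) θ) U - U) +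
       (mulCLM (torusMeasure d) (fun θ => UnitAddTorus.mFourier (-(-Pi.single j 1)) θ) U - U) :
        TorusL2 d) θ =
      -((2 - UnitAddTorus.mFourier (-Pi.single j 1) θ -
        UnitAddTorus.mFourier (-(-Pi.single j 1)) θ) * U θ) := by
    rw [ae_all_iff]
    intro j
    filter_upwards [h₂, Lp.coeFn_add
      (mulCLM (torusMeasure d) (fun θ => UnitAddTorus.mFourier (-Pi.single j 1) θ) U - U)
      (mulCLM (torusMeasure d) (fun θ => UnitAddTorus.mFourier (-(-Pi.single j 1)) θ) U - U),
      Lp.coeFn_sub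
        (mulCLM (torusMeasure d) (fun θ => UnitAddTorus.mFourier (-Pi.single j 1) θ) U) U,
      Lp.coeFn_sub
        (mulCLM (torusMeasure d) (fun θ => UnitAddTorus.mFourier (-(-Pi.single j 1)) θ) U) U]
      with θ a b c e
    rw [b, Pi.add_apply, c, e, Pi.sub_apply, Pi.sub_apply, (a j).1, (a j).2]
    ring
  set G : Fin d → TorusL2 d := fun j =>
      ((mulCLM (torusMeasure d) (fun θ => UnitAddTorus.mFourier (-Pi.single j 1) θ) U - U) +
       (mulCLM (torusMeasure d) (fun θ => UnitAddTorus.mFourier (-(-Pi.single j 1)) θ) U - U))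
    with hG
  filter_upwards [h₃, Lp.coeFn_neg (((h : ℂ) ^ 2)⁻¹ • ∑ j : Fin d, G j),
    Lp.coeFn_smul ((h : ℂ) ^ 2)⁻¹ (∑ j : Fin d, G j),
    Lp.coeFn_finsetSum Finset.univ G] with θ e₃ e₄ e₅ e₆
  rw [e₄, Pi.neg_apply, e₅, Pi.smul_apply, e₆, Finset.sum_apply, Finset.sum_congr rfl
    (fun j _ => e₃ j), Finset.sum_neg_distrib, ← Finset.sum_mul, ← latSymbol_eq, smul_eq_mul]
  push_cast
  ring

end LatticeTorus

/-! ### Comparison of the free resolvents with rate h². -/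

section Symbols

variable {d : ℕ} {h s : ℝ}

theorem latSymbol_toTorus (x : Space d) :
    latSymbol (toTorus x) = ∑ j, (2 - 2 * Real.cos (2 * Real.pi * x j)) := by
  refine Finset.sum_congr rfl fun j _ => ?_
  have h₁ : fourier 1 ((x j : ℝ) : UnitAddCircle) =
      Complex.exp ((2 * Real.pi * x j : ℝ) * Complex.I) := by
    rw [fourier_coe_apply]
    congr 1
    push_cast
    ring
  rw [toTorus, h₁, Complex.exp_ofReal_mul_I_re]

theorem latSymbol_toTorus_le (x : Space d) : latSymbol (toTorus x) ≤ 4 * Real.pi ^ 2 * ‖x‖ ^ 2 := by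
  rw [latSymbol_toTorus, EuclideanSpace.real_norm_sq_eq, Finset.mul_sum]
  refine Finset.sum_le_sum fun j _ => ?_
  have := Real.one_sub_sq_div_two_le_cos (x := 2 * Real.pi * x j)
  nlinarith

/-- From cos y ≤ 1 − 2y²/π² for |y| ≤ π, with y = 2πx_j. The restriction to the unit cube is what
makes the discrete symbol coercive. -/
theorem le_latSymbol_toTorus {x : Space d} (hx : ∀ j, |x j| ≤ 1 / 2) :
    16 * ‖x‖ ^ 2 ≤ latSymbol (toTorus x) := by
  rw [latSymbol_toTorus, EuclideanSpace.real_norm_sq_eq, Finset.mul_sum]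
  refine Finset.sum_le_sum fun j _ => ?_
  have h₁ : |2 * Real.pi * x j| ≤ Real.pi := by
    rw [abs_mul, abs_of_pos Real.two_pi_pos]
    nlinarith [hx j, Real.pi_pos]
  have h₂ := Real.cos_le_one_sub_mul_cos_sq h₁
  have h₃ : 2 / Real.pi ^ 2 * (2 * Real.pi * x j) ^ 2 = 8 * x j ^ 2 := by
    field_simp
    ring
  rw [h₃] at h₂
  linarith

/-- Coordinatewise, with t = 2πx_j, the claim is t² − 2 + 2 cos t ≤ t⁴: Taylor's bound for |t| ≤ 1,
and t² ≤ t⁴ otherwise. The sum of fourth powers is then at most ‖x‖⁴. -/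
theorem sub_latSymbol_toTorus_le (x : Space d) :
    4 * Real.pi ^ 2 * ‖x‖ ^ 2 - latSymbol (toTorus x) ≤ 16 * Real.pi ^ 4 * ‖x‖ ^ 4 := by
  have h₁ : ∑ j, x j ^ 4 ≤ ‖x‖ ^ 4 := by
    have : ‖x‖ ^ 4 = (∑ j, x j ^ 2) ^ 2 := by
      rw [← EuclideanSpace.real_norm_sq_eq]; ring
    rw [this]
    have h₂ := Finset.sum_sq_le_sq_sum_of_nonneg (s := Finset.univ) (f := fun j => x j ^ 2)
      (fun j _ => sq_nonneg _)
    refine le_trans (le_of_eq (Finset.sum_congr rfl fun j _ => by ring)) h₂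
  refine le_trans ?_ (mul_le_mul_of_nonneg_left h₁ (by positivity))
  rw [latSymbol_toTorus, EuclideanSpace.real_norm_sq_eq, Finset.mul_sum, Finset.mul_sum,
    ← Finset.sum_sub_distrib]
  refine Finset.sum_le_sum fun j _ => ?_
  set t := 2 * Real.pi * x j with ht
  have h₃ : 4 * Real.pi ^ 2 * x j ^ 2 = t ^ 2 := by rw [ht]; ring
  have h₄ : 16 * Real.pi ^ 4 * x j ^ 4 = t ^ 4 := by rw [ht]; ring
  rw [h₃, h₄]
  by_cases h1 : |t| ≤ 1
  · have h₅ := (abs_le.1 (Real.cos_bound h1)).2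
    have h₆ : |t| ^ 4 = t ^ 4 := by rw [pow_abs, abs_of_nonneg (by positivity)]
    rw [h₆] at h₅
    nlinarith [sq_nonneg (t ^ 2)]
  · have h₅ : 1 ≤ t ^ 2 := by
      rw [← sq_abs]
      nlinarith [not_le.1 h1]
    nlinarith [Real.cos_le_one t]

/-- The symbol of `(s - Δ)⁻¹`. -/
noncomputable def contSym (s : ℝ) (ξ : Space d) : ℝ := (s + 4 * Real.pi ^ 2 * ‖ξ‖ ^ 2)⁻¹

/-- The symbol of `(s + T_h)⁻¹`. -/
noncomputable def latSym (h s : ℝ) (θ : Torus d) : ℝ := (s + (h ^ 2)⁻¹ * latSymbol θ)⁻¹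

theorem contSym_denom_pos (hs : 0 < s) (ξ : Space d) : 0 < s + 4 * Real.pi ^ 2 * ‖ξ‖ ^ 2 := by
  positivity

theorem latSym_denom_pos (hs : 0 < s) (θ : Torus d) : 0 < s + (h ^ 2)⁻¹ * latSymbol θ := by
  have := latSymbol_nonneg θ
  positivity

theorem contSym_nonneg (hs : 0 < s) (ξ : Space d) : 0 ≤ contSym s ξ :=
  (inv_pos.2 (contSym_denom_pos hs ξ)).le

theorem latSym_nonneg (hs : 0 < s) (θ : Torus d) : 0 ≤ latSym h s θ :=
  (inv_pos.2 (latSym_denom_pos hs θ)).le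

theorem contSym_le (hs : 0 < s) (ξ : Space d) : contSym s ξ ≤ s⁻¹ :=
  inv_anti₀ hs (le_add_of_nonneg_right (by positivity))

theorem latSym_le (hs : 0 < s) (θ : Torus d) : latSym h s θ ≤ s⁻¹ := by
  have := latSymbol_nonneg θ
  exact inv_anti₀ hs (le_add_of_nonneg_right (by positivity))

theorem continuous_contSym (hs : 0 < s) : Continuous (contSym (d := d) s) := by
  unfold contSym
  exact Continuous.inv₀ (by fun_prop) fun ξ => (contSym_denom_pos hs ξ).ne'

theorem continuous_latSym (hs : 0 < s) : Continuous (latSym (d := d) h s) := by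
  have := continuous_latSymbol (d := d)
  unfold latSym
  exact Continuous.inv₀ (by fun_prop) fun ξ => (latSym_denom_pos hs ξ).ne'

theorem abs_le_half_of_mem_cell {ξ : Space d} (hξ : ξ ∈ cell d h) (j : Fin d) :
    |((-h) • ξ) j| ≤ 1 / 2 := by
  have := hξ j
  rw [abs_le]
  constructor
  · linarith [this.1]
  · linarith [this.2]

theorem le_latSymbol_latTorus (hh : 0 < h) {ξ : Space d} (hξ : ξ ∈ cell d h) :
    16 * ‖ξ‖ ^ 2 ≤ (h ^ 2)⁻¹ * latSymbol (latTorus h ξ) := by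
  have h₁ := le_latSymbol_toTorus (abs_le_half_of_mem_cell hξ)
  rw [norm_smul, norm_neg, Real.norm_of_nonneg hh.le, mul_pow] at h₁
  rw [inv_mul_eq_div, le_div_iff₀ (by positivity)]
  refine le_trans (le_of_eq ?_) h₁
  ring

theorem latSymbol_latTorus_le (hh : 0 < h) (ξ : Space d) :
    (h ^ 2)⁻¹ * latSymbol (latTorus h ξ) ≤ 4 * Real.pi ^ 2 * ‖ξ‖ ^ 2 := by
  have h₁ := latSymbol_toTorus_le ((-h) • ξ)
  rw [norm_smul, norm_neg, Real.norm_of_nonneg hh.le, mul_pow] at h₁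
  rw [inv_mul_eq_div, div_le_iff₀ (by positivity)]
  refine le_trans h₁ (le_of_eq ?_)
  ring

theorem sub_latSymbol_latTorus_le (hh : 0 < h) (ξ : Space d) :
    4 * Real.pi ^ 2 * ‖ξ‖ ^ 2 - (h ^ 2)⁻¹ * latSymbol (latTorus h ξ) ≤
      h ^ 2 * (16 * Real.pi ^ 4 * ‖ξ‖ ^ 4) := by
  have h₁ := sub_latSymbol_toTorus_le ((-h) • ξ)
  rw [norm_smul, norm_neg, Real.norm_of_nonneg hh.le, mul_pow, mul_pow] at h₁
  have h₂ : 0 < h ^ 2 := by positivity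
  have h₃ := mul_le_mul_of_nonneg_left h₁ (inv_pos.2 h₂).le
  refine le_trans (le_of_eq ?_) (h₃.trans (le_of_eq ?_))
  · rw [latTorus]
    field_simp
  · field_simp

/-- The difference of the symbols is at most 16π⁴h²|ξ|⁴ and the product of the denominators at least
16|ξ|²·4π²|ξ|². The quotient is π²h²/4, and π² ≤ 12 gives the constant 3. -/
theorem abs_latSym_sub_contSym_le (hh : 0 < h) (hs : 0 < s) {ξ : Space d} (hξ : ξ ∈ cell d h) :
    |latSym h s (latTorus h ξ) - contSym s ξ| ≤ 3 * h ^ 2 := by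
  have h₁ := le_latSymbol_latTorus hh hξ
  have h₂ := latSymbol_latTorus_le hh ξ
  have h₃ := sub_latSymbol_latTorus_le hh ξ
  set a := (h ^ 2)⁻¹ * latSymbol (latTorus h ξ) with ha
  have ha0 : 0 < s + a := by nlinarith [sq_nonneg ‖ξ‖]
  have hb0 := contSym_denom_pos hs ξ
  have hsub : latSym h s (latTorus h ξ) - contSym s ξ =
      (4 * Real.pi ^ 2 * ‖ξ‖ ^ 2 - a) / ((s + a) * (s + 4 * Real.pi ^ 2 * ‖ξ‖ ^ 2)) := by
    rw [latSym, contSym, ← ha, inv_sub_inv ha0.ne' hb0.ne']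
    congr 1
    ring
  rw [hsub, abs_of_nonneg (div_nonneg (by linarith) (by positivity)), div_le_iff₀ (by positivity)]
  refine h₃.trans ?_
  have h₄ : 16 * ‖ξ‖ ^ 2 * (4 * Real.pi ^ 2 * ‖ξ‖ ^ 2) ≤
      (s + a) * (s + 4 * Real.pi ^ 2 * ‖ξ‖ ^ 2) :=
    mul_le_mul (by linarith) (by linarith) (by positivity) ha0.le
  have h₅ : Real.pi ^ 2 ≤ 12 := by nlinarith [Real.pi_lt_d2, Real.pi_gt_three]
  have h₆ : h ^ 2 * (16 * Real.pi ^ 4 * ‖ξ‖ ^ 4) ≤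
      3 * h ^ 2 * (16 * ‖ξ‖ ^ 2 * (4 * Real.pi ^ 2 * ‖ξ‖ ^ 2)) := by
    have : 0 ≤ h ^ 2 * ‖ξ‖ ^ 4 * Real.pi ^ 2 := by positivity
    nlinarith [mul_le_mul_of_nonneg_left h₅ this]
  exact h₆.trans (mul_le_mul_of_nonneg_left h₄ (by positivity))

/-- Off the small cube some |ξ_j| ≥ 1/(4h), so 4π²|ξ|² ≥ π²/(4h²) ≥ h⁻². -/
theorem contSym_le_of_notMem (hs : 0 < s) {ξ : Space d} (hξ : ξ ∉ smallCube d h) :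
    contSym s ξ ≤ h ^ 2 := by
  simp only [smallCube, Set.mem_ofPred_eq, not_forall, not_lt] at hξ
  obtain ⟨j, hj⟩ := hξ
  have h₁ : (ξ j) ^ 2 ≤ ‖ξ‖ ^ 2 := by
    rw [EuclideanSpace.real_norm_sq_eq]
    exact Finset.single_le_sum (f := fun j => ξ j ^ 2) (fun _ _ => sq_nonneg _) (Finset.mem_univ j)
  have h₂ : (1 / 4 : ℝ) ^ 2 ≤ (h * ξ j) ^ 2 := by
    rw [← sq_abs (h * ξ j)]
    exact pow_le_pow_left₀ (by norm_num) hj 2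
  have h₃ : (9 : ℝ) ≤ Real.pi ^ 2 := by nlinarith [Real.pi_gt_three]
  have h₄ : 1 ≤ h ^ 2 * (s + 4 * Real.pi ^ 2 * ‖ξ‖ ^ 2) := by
    have e₁ : 1 / 16 ≤ h ^ 2 * ‖ξ‖ ^ 2 := by nlinarith [sq_nonneg h]
    nlinarith [sq_nonneg h, mul_nonneg (sq_nonneg h) hs.le]
  rw [contSym, inv_le_iff_one_le_mul₀ (contSym_denom_pos hs ξ)]
  exact h₄

/-- The free resolvent `(s - Δ)⁻¹` in the Fourier representation. -/
noncomputable def contRes (d : ℕ) (s : ℝ) : L2 d →L[ℂ] L2 d :=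
  mulCLM volume fun ξ => (contSym s ξ : ℂ)

/-- The free resolvent `(s + T_h)⁻¹` in the Fourier representation. -/
noncomputable def latRes (d : ℕ) (h s : ℝ) : TorusL2 d →L[ℂ] TorusL2 d :=
  mulCLM (torusMeasure d) fun θ => (latSym h s θ : ℂ)

theorem norm_ofReal_contSym_le (hs : 0 < s) (ξ : Space d) : ‖(contSym s ξ : ℂ)‖ ≤ s⁻¹ := by
  rw [Complex.norm_real, Real.norm_of_nonneg (contSym_nonneg hs ξ)]
  exact contSym_le hs ξ

theorem norm_ofReal_latSym_le (hs : 0 < s) (θ : Torus d) : ‖(latSym h s θ : ℂ)‖ ≤ s⁻¹ := by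
  rw [Complex.norm_real, Real.norm_of_nonneg (latSym_nonneg hs θ)]
  exact latSym_le hs θ

theorem continuous_ofReal_contSym (hs : 0 < s) :
    Continuous fun ξ : Space d => (contSym s ξ : ℂ) :=
  Complex.continuous_ofReal.comp (continuous_contSym hs)

theorem continuous_ofReal_latSym (hs : 0 < s) :
    Continuous fun θ : Torus d => (latSym h s θ : ℂ) :=
  Complex.continuous_ofReal.comp (continuous_latSym hs)

theorem memLp_top_contSym (hs : 0 < s) :
    MemLp (fun ξ : Space d => (contSym s ξ : ℂ)) ⊤ volume :=
  memLp_top_of_bound (continuous_ofReal_contSym hs).aestronglyMeasurable s⁻¹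
    (ae_of_all _ (norm_ofReal_contSym_le hs))

theorem memLp_top_latSym (hs : 0 < s) :
    MemLp (fun θ : Torus d => (latSym h s θ : ℂ)) ⊤ (torusMeasure d) :=
  memLp_top_of_bound (continuous_ofReal_latSym hs).aestronglyMeasurable s⁻¹
    (ae_of_all _ (norm_ofReal_latSym_le hs))

theorem norm_contRes_le (hs : 0 < s) : ‖contRes d s‖ ≤ s⁻¹ :=
  norm_mulCLM_le (continuous_ofReal_contSym hs).aestronglyMeasurable (inv_pos.2 hs).le
    (norm_ofReal_contSym_le hs)

theorem norm_latRes_le (hs : 0 < s) : ‖latRes d h s‖ ≤ s⁻¹ :=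
  norm_mulCLM_le (continuous_ofReal_latSym hs).aestronglyMeasurable (inv_pos.2 hs).le
    (norm_ofReal_latSym_le hs)

theorem norm_lift_latRes_sub_contRes_le (hh : 0 < h) (hs : 0 < s) :
    ‖lift (cellEmb h hh) (latRes d h s) - contRes d s‖ ≤ 3 * h ^ 2 := by
  have hm : MemLp ((cell d h).indicator fun ξ => (latSym h s (latTorus h ξ) : ℂ)) ⊤ volume :=
    (memLp_top_of_bound ((continuous_ofReal_latSym hs).measurable.comp
      measurable_latTorus).aestronglyMeasurable s⁻¹
      (ae_of_all _ fun ξ => norm_ofReal_latSym_le hs _)).indicator measurableSet_cell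
  rw [latRes, lift_cellEmb_mulCLM hh (continuous_ofReal_latSym hs).measurable
    (norm_ofReal_latSym_le hs), contRes, ← mulCLM_sub hm (memLp_top_contSym hs)]
  refine norm_mulCLM_le (hm.1.sub (memLp_top_contSym hs).1) (by positivity) fun ξ => ?_
  rw [Pi.sub_apply]
  by_cases hc : ξ ∈ cell d h
  · rw [Set.indicator_of_mem hc, ← Complex.ofReal_sub, Complex.norm_real]
    exact abs_latSym_sub_contSym_le hh hs hc
  · rw [Set.indicator_of_notMem hc, zero_sub, norm_neg, Complex.norm_real,
      Real.norm_of_nonneg (contSym_nonneg hs ξ)]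
    refine (contSym_le_of_notMem hs fun h' => hc (smallCube_subset_cell h')).trans ?_
    nlinarith [sq_nonneg h]

/-- Split the free resolvent by frequency. On the small cube the two translations agree exactly; off
it the symbol is at most h², and the difference of two contractions has norm at most 2. -/
theorem norm_lift_torusShift_sub_mul_contRes_le (hh : 0 < h) (hs : 0 < s) {ζ : Space d}
    (hζ : ∀ j, |h * ζ j| ≤ 1 / 4) :
    ‖(lift (cellEmb h hh) (torusShift (toTorus (h • ζ))) - spaceShift ζ) * contRes d s‖ ≤
      2 * h ^ 2 := by
  set D := lift (cellEmb h hh) (torusShift (toTorus (h • ζ))) - spaceShift ζ with hD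
  have hm := memLp_top_contSym (d := d) hs
  have h₁ := hm.indicator (measurableSet_smallCube (d := d) (h := h))
  have h₂ := hm.indicator (measurableSet_smallCube (d := d) (h := h)).compl
  have hsplit : contRes d s =
      mulCLM volume ((smallCube d h).indicator fun ξ => (contSym s ξ : ℂ)) +
      mulCLM volume ((smallCube d h)ᶜ.indicator fun ξ => (contSym s ξ : ℂ)) := by
    rw [← mulCLM_add h₁ h₂, contRes]
    congr 1
    funext ξ
    exact (congrFun (Set.indicator_self_add_compl (smallCube d h)
      fun ξ => (contSym s ξ : ℂ)) ξ).symm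
  have h₃ : D * mulCLM volume ((smallCube d h).indicator fun ξ => (contSym s ξ : ℂ)) = 0 := by
    ext1 w
    rw [mul_apply_eq_comp, hD, sub_apply, zero_apply, sub_eq_zero]
    refine lift_cellEmb_torusShift_eq hh hζ ?_
    filter_upwards [coeFn_mulCLM h₁ w] with ξ hξ hc
    rw [hξ, Set.indicator_of_notMem hc, zero_mul]
  have h₄ : ‖mulCLM volume ((smallCube d h)ᶜ.indicator fun ξ => (contSym s ξ : ℂ))‖ ≤ h ^ 2 := by
    refine norm_mulCLM_le h₂.1 (by positivity) fun ξ => ?_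
    by_cases hc : ξ ∈ smallCube d h
    · rw [Set.indicator_of_notMem (Set.notMem_compl_iff.2 hc), norm_zero]
      positivity
    · rw [Set.indicator_of_mem hc, Complex.norm_real, Real.norm_of_nonneg (contSym_nonneg hs ξ)]
      exact contSym_le_of_notMem hs hc
  have h₅ : ‖D‖ ≤ 2 := by
    refine (norm_sub_le _ _).trans ?_
    have e₁ := (norm_lift_le (cellEmb (d := d) h hh) (torusShift (toTorus (h • ζ)))).trans
      (norm_torusShift_le _)
    linarith [norm_spaceShift_le ζ]
  rw [hsplit, mul_add, h₃, zero_add]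
  exact (norm_mul_le _ _).trans (mul_le_mul h₅ h₄ (norm_nonneg _) (by norm_num))

theorem norm_lift_torusShift_mul_latRes_sub_le (hh : 0 < h) (hs : 0 < s) {ζ : Space d}
    (hζ : ∀ j, |h * ζ j| ≤ 1 / 4) :
    ‖lift (cellEmb h hh) (torusShift (toTorus (h • ζ)) * latRes d h s) -
      spaceShift ζ * contRes d s‖ ≤ 5 * h ^ 2 := by
  have h₁ : lift (cellEmb h hh) (torusShift (toTorus (h • ζ)) * latRes d h s) -
      spaceShift ζ * contRes d s =
      lift (cellEmb h hh) (torusShift (toTorus (h • ζ))) *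
        (lift (cellEmb h hh) (latRes d h s) - contRes d s) +
      (lift (cellEmb h hh) (torusShift (toTorus (h • ζ))) - spaceShift ζ) * contRes d s := by
    rw [lift_mul]
    noncomm_ring
  have h₂ : ‖lift (cellEmb (d := d) h hh) (torusShift (toTorus (h • ζ)))‖ ≤ 1 :=
    (norm_lift_le _ _).trans (norm_torusShift_le _)
  have h₃ := norm_lift_latRes_sub_contRes_le (d := d) hh hs
  rw [h₁]
  refine (norm_add_le _ _).trans ?_
  have h₄ := (norm_mul_le (lift (cellEmb (d := d) h hh) (torusShift (toTorus (h • ζ))))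
    (lift (cellEmb h hh) (latRes d h s) - contRes d s)).trans
    (mul_le_mul h₂ h₃ (norm_nonneg _) zero_le_one)
  linarith [norm_lift_torusShift_sub_mul_contRes_le hh hs hζ]

end Symbols

/-! ### A uniform L^q bound for the periodic symbol. -/

section Periodization

variable {d : ℕ} {h s : ℝ}

theorem lintegral_comp_smul_of_pos (hh : 0 < h) {f : Space d → ℝ≥0∞} (hf : Measurable f) :
    ∫⁻ ζ, f (h • ζ) = ENNReal.ofReal ((h ^ d)⁻¹) * ∫⁻ ω, f ω := by
  have h₁ := Measure.map_addHaar_smul (volume : Measure (Space d)) hh.ne'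
  rw [finrank_euclideanSpace_fin, abs_inv, abs_pow, abs_of_pos hh] at h₁
  rw [← smul_eq_mul, ← lintegral_smul_measure, ← h₁, lintegral_map hf (by fun_prop)]

theorem volume_unitCube : volume (unitCube d) = 1 := by
  have h₁ := lintegral_torus (d := d) (fun _ => 1)
  rw [lintegral_const, setLIntegral_const, one_mul, one_mul, measure_univ] at h₁
  exact h₁.symm

theorem norm_le_of_mem_unitCube {t : Space d} (ht : t ∈ unitCube d) : ‖t‖ ≤ d := by
  refine abs_le_of_sq_le_sq' ?_ (Nat.cast_nonneg d) |>.2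
  rw [EuclideanSpace.real_norm_sq_eq]
  have h₁ : ∑ j, t j ^ 2 ≤ ∑ _j : Fin d, (1 : ℝ) := by
    refine Finset.sum_le_sum fun j _ => ?_
    have := ht j
    nlinarith [this.1, this.2]
  refine h₁.trans ?_
  rw [Finset.sum_const, Finset.card_univ, Fintype.card_fin, nsmul_eq_mul, mul_one]
  exact_mod_cast Nat.le_self_pow two_ne_zero d

/-- A periodization without lattice sums: average over t in the unit cube, bound G(ω) by G'(ω − t),
and substitute ω ↦ ω + t. The integral in t then sweeps the torus exactly once. -/
theorem lintegral_mul_toTorus_le {G G' : Space d → ℝ≥0∞} (hG' : Measurable G')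
    {F : Torus d → ℝ≥0∞} (hF : Measurable F)
    (hGG' : ∀ ω, ∀ t ∈ unitCube d, G ω ≤ G' (ω - t)) (θ : Torus d) :
    ∫⁻ ω, G ω * F (θ + toTorus ω) ≤ (∫⁻ ω, G' ω) * ∫⁻ θ', F θ' ∂(torusMeasure d) := by
  calc ∫⁻ ω, G ω * F (θ + toTorus ω)
      = ∫⁻ _t in unitCube d, ∫⁻ ω, G ω * F (θ + toTorus ω) := by
        rw [setLIntegral_const, volume_unitCube, mul_one]
    _ ≤ ∫⁻ t in unitCube d, ∫⁻ ω, G' (ω - t) * F (θ + toTorus ω) := by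
        refine setLIntegral_mono' measurableSet_unitCube fun t ht => ?_
        exact lintegral_mono fun ω => mul_le_mul_left (hGG' ω t ht) _
    _ = ∫⁻ t in unitCube d, ∫⁻ ω, G' ω * F (θ + toTorus ω + toTorus t) := by
        refine lintegral_congr fun t => ?_
        rw [← lintegral_sub_right_eq_self
          (fun ω => G' ω * F (θ + toTorus ω + toTorus t)) t]
        refine lintegral_congr fun ω => ?_
        rw [add_assoc, ← toTorus_add, sub_add_cancel]
    _ = ∫⁻ ω, ∫⁻ t in unitCube d, G' ω * F (θ + toTorus ω + toTorus t) := by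
        refine lintegral_lintegral_swap ?_
        have m₁ : Measurable fun z : Space d × Space d => θ + toTorus z.2 + toTorus z.1 :=
          (measurable_const.add (measurable_toTorus.comp measurable_snd)).add
            (measurable_toTorus.comp measurable_fst)
        exact ((hG'.comp measurable_snd).mul (hF.comp m₁)).aemeasurable
    _ = ∫⁻ ω, G' ω * ∫⁻ θ', F θ' ∂(torusMeasure d) := by
        refine lintegral_congr fun ω => ?_
        have m₁ : Measurable fun t : Space d => F (θ + toTorus ω + toTorus t) :=
          hF.comp (measurable_const.add measurable_toTorus)
        rw [lintegral_const_mul _ m₁,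
          ← lintegral_torus (fun θ' => F (θ + toTorus ω + θ')), lintegral_add_left_eq_self]
    _ = (∫⁻ ω, G' ω) * ∫⁻ θ', F θ' ∂(torusMeasure d) := lintegral_mul_const _ hG'

theorem exists_norm_schwartz_le (ψ : 𝓢(Space d, ℂ)) :
    ∃ C : ℝ, 0 ≤ C ∧ ∀ ω, ‖ψ ω‖ ≤ C * (1 + ‖ω‖) ^ (-((d : ℝ) + 1)) := by
  refine ⟨2 ^ (d + 1) * ((Finset.Iic (d + 1, 0)).sup
    fun m => SchwartzMap.seminorm ℝ m.1 m.2) ψ, by positivity, fun ω => ?_⟩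
  have h₁ := SchwartzMap.one_add_le_sup_seminorm_apply (𝕜 := ℝ) (m := (d + 1, 0)) (k := d + 1)
    (n := 0) le_rfl le_rfl ψ ω
  rw [norm_iteratedFDeriv_zero] at h₁
  have h₂ : (0 : ℝ) < 1 + ‖ω‖ := by positivity
  have h₃ : (1 + ‖ω‖) ^ ((d : ℝ) + 1) = (1 + ‖ω‖) ^ (d + 1) := by
    exact_mod_cast Real.rpow_natCast (1 + ‖ω‖) (d + 1)
  rw [Real.rpow_neg h₂.le, h₃, ← div_eq_mul_inv, le_div_iff₀ (by positivity), mul_comm]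
  exact h₁

/-- The `L^q` bound for the symbol of the free lattice resolvent, uniform in the lattice. -/
theorem exists_lintegral_schwartz_mul_latSym_le (ψ : 𝓢(Space d, ℂ)) {q : ℝ} (hq1 : 1 ≤ q)
    (hq : (d : ℝ) < 2 * q) :
    ∃ S : ℝ≥0∞, S ≠ ⊤ ∧ ∀ h s : ℝ, 0 < h → 1 ≤ s → ∀ θ : Torus d,
      ∫⁻ ζ : Space d, (‖ψ (h • ζ)‖ₑ * ENNReal.ofReal (latSym h s (θ + toTorus (h • ζ)))) ^ q ≤
        S := by
  obtain ⟨C, hC, hψ⟩ := exists_norm_schwartz_le ψ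
  -- The q-th power of the Schwartz decay (1+|ω|)^{-(d+1)}; as q ≥ 1, it exceeds d and G' is
  -- integrable.
  set r : ℝ := (d + 1) * q with hr
  have hq0 : 0 ≤ q := by linarith
  have hrd : (d : ℝ) < r := by
    rw [hr]
    have := (Nat.cast_nonneg d : (0 : ℝ) ≤ d)
    nlinarith
  set G' : Space d → ℝ≥0∞ := fun ω =>
    ENNReal.ofReal (C ^ q * (1 + d) ^ r) * ENNReal.ofReal ((1 + ‖ω‖) ^ (-r)) with hG'
  have hG'm : Measurable G' := by
    refine Measurable.const_mul ?_ _
    exact ENNReal.measurable_ofReal.comp (by fun_prop)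
  have hGG' : ∀ ω, ∀ t ∈ unitCube d, ‖ψ ω‖ₑ ^ q ≤ G' (ω - t) := by
    intro ω t ht
    rw [← ofReal_norm, ENNReal.ofReal_rpow_of_nonneg (norm_nonneg _) hq0]
    simp only [hG']
    rw [← ENNReal.ofReal_mul (by positivity)]
    refine ENNReal.ofReal_le_ofReal ?_
    have h₀ : (0 : ℝ) < 1 + ‖ω‖ := by positivity
    have h₀' : (0 : ℝ) < 1 + ‖ω - t‖ := by positivity
    have h₁ : ‖ψ ω‖ ^ q ≤ C ^ q * (1 + ‖ω‖) ^ (-r) := by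
      refine (Real.rpow_le_rpow (norm_nonneg _) (hψ ω) hq0).trans (le_of_eq ?_)
      rw [Real.mul_rpow hC (by positivity), ← Real.rpow_mul h₀.le, hr, neg_mul]
    have h₂ : 1 + ‖ω - t‖ ≤ (1 + d) * (1 + ‖ω‖) := by
      have := norm_sub_le ω t
      have := norm_le_of_mem_unitCube ht
      nlinarith [norm_nonneg ω, (Nat.cast_nonneg d : (0 : ℝ) ≤ d)]
    have h₃ : (1 + ‖ω‖) ^ (-r) ≤ (1 + (d : ℝ)) ^ r * (1 + ‖ω - t‖) ^ (-r) := by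
      have e₁ : (1 + ‖ω - t‖) ^ r ≤ (1 + (d : ℝ)) ^ r * (1 + ‖ω‖) ^ r := by
        rw [← Real.mul_rpow (by positivity) h₀.le]
        exact Real.rpow_le_rpow h₀'.le h₂ (by positivity)
      rw [Real.rpow_neg h₀.le, Real.rpow_neg h₀'.le, ← div_eq_mul_inv, le_div_iff₀ (by positivity),
        inv_mul_le_iff₀ (by positivity), mul_comm]
      exact e₁
    refine h₁.trans ?_
    rw [mul_assoc]
    exact mul_le_mul_of_nonneg_left h₃ (by positivity)
  set L : ℝ≥0∞ := ∫⁻ ξ : Space d, ENNReal.ofReal ((1 + ‖ξ‖ ^ 2) ^ (-(2 * q) / 2)) with hL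
  refine ⟨(∫⁻ ω, G' ω) * L, ?_, ?_⟩
  · refine ENNReal.mul_ne_top ?_ ?_
    · rw [hG', lintegral_const_mul' _ _ ENNReal.ofReal_ne_top]
      refine ENNReal.mul_ne_top ENNReal.ofReal_ne_top ?_
      exact (finite_integral_one_add_norm (by rwa [finrank_euclideanSpace_fin])).ne
    · have h₁ : Integrable (fun ξ : Space d => (1 + ‖ξ‖ ^ 2) ^ (-(2 * q) / 2)) :=
        integrable_rpow_neg_one_add_norm_sq (by rwa [finrank_euclideanSpace_fin])
      exact ((hasFiniteIntegral_iff_ofReal (ae_of_all _ fun ξ => by positivity)).1 h₁.2).ne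
  · intro h s hh hs1 θ
    have hs : 0 < s := by linarith
    have hmF : Measurable fun θ' : Torus d => ENNReal.ofReal (latSym h s θ') ^ q :=
      (ENNReal.measurable_ofReal.comp (continuous_latSym hs).measurable).pow_const q
    have hmψ : Measurable fun ω : Space d => ‖ψ ω‖ₑ ^ q :=
      (ψ.continuous.measurable.enorm).pow_const q
    have h₁ : ∀ ζ : Space d,
        (‖ψ (h • ζ)‖ₑ * ENNReal.ofReal (latSym h s (θ + toTorus (h • ζ)))) ^ q =
        (fun ω => ‖ψ ω‖ₑ ^ q * ENNReal.ofReal (latSym h s (θ + toTorus ω)) ^ q) (h • ζ) :=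
      fun ζ => ENNReal.mul_rpow_of_nonneg _ _ hq0
    have hm₂ : Measurable fun ω : Space d => ENNReal.ofReal (latSym h s (θ + toTorus ω)) ^ q :=
      hmF.comp (measurable_const.add measurable_toTorus)
    have hm : Measurable fun ω : Space d =>
        ‖ψ ω‖ₑ ^ q * ENNReal.ofReal (latSym h s (θ + toTorus ω)) ^ q := hmψ.mul hm₂
    rw [lintegral_congr h₁, lintegral_comp_smul_of_pos hh hm]
    refine (mul_le_mul_right (lintegral_mul_toTorus_le hG'm hmF hGG' θ) _).trans ?_
    -- The factor h^{-d} from rescaling ω = hζ is exactly what converts the torus integral back into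
    -- one over the cell. There the symbol is at most (1+|ξ|²)⁻¹, uniformly in h and s ≥ 1.
    rw [mul_left_comm, ← setLIntegral_cell hh _ hmF]
    refine mul_le_mul_right ?_ _
    refine (setLIntegral_mono' measurableSet_cell fun ξ hξ => ?_).trans
      (setLIntegral_le_lintegral (cell d h) _)
    rw [ENNReal.ofReal_rpow_of_nonneg (latSym_nonneg hs _) hq0]
    refine ENNReal.ofReal_le_ofReal ?_
    have h₂ : latSym h s (latTorus h ξ) ≤ (1 + ‖ξ‖ ^ 2)⁻¹ := by
      refine inv_anti₀ (by positivity) ?_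
      nlinarith [le_latSymbol_latTorus hh hξ, sq_nonneg ‖ξ‖]
    refine (Real.rpow_le_rpow (latSym_nonneg hs _) h₂ hq0).trans (le_of_eq ?_)
    rw [Real.inv_rpow (by positivity), ← Real.rpow_neg (by positivity)]
    congr 1
    ring

end Periodization

/-! ### The lattice potential as an average of torus translations. -/

section LatticePotential

variable {d : ℕ} {h s : ℝ}

theorem sFinite_latMeasure : SFinite (latMeasure d h) := by
  unfold latMeasure
  infer_instance

/-- The function `n ↦ ∫ a(ζ) e^{2πi h n·ζ} dζ` on the lattice. -/
noncomputable def latFun (h : ℝ) (a : Space d → ℂ) (n : Fin d → ℤ) : ℂ :=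
  ∫ ζ, a ζ * UnitAddTorus.mFourier n (toTorus (h • ζ))

theorem measurable_latPhase : Measurable (Function.uncurry fun (ζ : Space d) (n : Fin d → ℤ) =>
    UnitAddTorus.mFourier n (toTorus (h • ζ))) := by
  refine measurable_from_prod_countable_left fun n => ?_
  exact (UnitAddTorus.mFourier n).continuous.measurable.comp
    (measurable_toTorus.comp (by fun_prop))

theorem memLp_top_latFun {a : Space d → ℂ} (ha : Integrable a) :
    MemLp (latFun h a) ⊤ (latMeasure d h) :=
  memLp_top_superposition ha measurable_latPhase fun _ _ => (norm_mFourier_apply _ _).le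

/-- The multiplication by `latFun h a`, on the torus side. -/
noncomputable def torusPot (h : ℝ) (hh : 0 < h) (a : Space d → ℂ) : TorusL2 d →L[ℂ] TorusL2 d :=
  (latToTorus d h hh).toLinearIsometry.toContinuousLinearMap ∘L
    mulCLM (latMeasure d h) (latFun h a) ∘L
      (latToTorus d h hh).symm.toLinearIsometry.toContinuousLinearMap

theorem torusPot_apply (hh : 0 < h) (a : Space d → ℂ) (F : TorusL2 d) :
    torusPot h hh a F = latToTorus d h hh
      (mulCLM (latMeasure d h) (latFun h a) ((latToTorus d h hh).symm F)) := rfl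

theorem inner_torusPot (hh : 0 < h) {a : Space d → ℂ} (ha : Integrable a) (K F : TorusL2 d) :
    Integrable (fun ζ => a ζ * inner ℂ K (torusShift (toTorus (h • ζ)) F)) ∧
    inner ℂ K (torusPot h hh a F) =
      ∫ ζ, a ζ * inner ℂ K (torusShift (toTorus (h • ζ)) F) := by
  have : SFinite (latMeasure d h) := sFinite_latMeasure
  have h₁ := inner_mulCLM_superposition (μ := latMeasure d h) ha (measurable_latPhase (h := h))
    (fun _ _ => (norm_mFourier_apply _ _).le) ((latToTorus d h hh).symm K)
    ((latToTorus d h hh).symm F)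
  have h₂ : ∀ ζ : Space d, inner ℂ ((latToTorus d h hh).symm K) (mulCLM (latMeasure d h)
      (fun n => UnitAddTorus.mFourier n (toTorus (h • ζ))) ((latToTorus d h hh).symm F)) =
      inner ℂ K (torusShift (toTorus (h • ζ)) F) := by
    intro ζ
    rw [← (latToTorus d h hh).inner_map_map, latToTorus_mulCLM,
      LinearIsometryEquiv.apply_symm_apply, LinearIsometryEquiv.apply_symm_apply]
  simp only [h₂] at h₁
  refine ⟨h₁.1, ?_⟩
  rw [← h₁.2, torusPot_apply, ← (latToTorus d h hh).inner_map_map ((latToTorus d h hh).symm K),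
    LinearIsometryEquiv.apply_symm_apply]
  rfl

theorem torusPot_add (hh : 0 < h) {a b : Space d → ℂ} (ha : Integrable a) (hb : Integrable b) :
    torusPot h hh (fun ζ => a ζ + b ζ) = torusPot h hh a + torusPot h hh b := by
  ext1 F
  refine ext_inner_left ℂ fun K => ?_
  rw [add_apply, inner_add_right, (inner_torusPot hh (a := fun ζ => a ζ + b ζ) (ha.add hb) K F).2,
    (inner_torusPot hh ha K F).2, (inner_torusPot hh hb K F).2,
    ← integral_add (inner_torusPot hh ha K F).1 (inner_torusPot hh hb K F).1]
  refine integral_congr_ae (ae_of_all _ fun ζ => ?_)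
  ring

theorem norm_torusPot_le (hh : 0 < h) {a : Space d → ℂ} (ha : Integrable a) :
    ‖torusPot h hh a‖ ≤ ∫ ζ, ‖a ζ‖ := by
  refine norm_le_of_norm_inner_le _ (integral_nonneg fun ζ => norm_nonneg _) fun K F => ?_
  rw [(inner_torusPot hh ha K F).2, mul_assoc, mul_comm]
  refine norm_integral_mul_le ha fun ζ => ?_
  refine (norm_inner_le_norm _ _).trans (mul_le_mul_of_nonneg_left ?_ (norm_nonneg _))
  exact ((torusShift (toTorus (h • ζ))).le_of_opNorm_le (norm_torusShift_le _) F).trans_eq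
    (one_mul _)

theorem lintegral_enorm_rpow_two {α : Type*} [MeasurableSpace α] {μ : Measure α}
    (f : Lp ℂ 2 μ) : (∫⁻ x, ‖f x‖ₑ ^ (2 : ℝ) ∂μ) ^ (1 / 2 : ℝ) = ‖f‖ₑ := by
  rw [Lp.enorm_def, eLpNorm_eq_lintegral_rpow_enorm_toReal (by norm_num) (by norm_num)]
  simp

theorem enorm_inner_le_lintegral {α : Type*} [MeasurableSpace α] {μ : Measure α}
    (f g : Lp ℂ 2 μ) : ‖(inner ℂ f g : ℂ)‖ₑ ≤ ∫⁻ x, ‖f x‖ₑ * ‖g x‖ₑ ∂μ := by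
  rw [L2.inner_def]
  refine (enorm_integral_le_lintegral_enorm _).trans (lintegral_mono fun x => ?_)
  rw [← ofReal_norm, ← ofReal_norm, ← ofReal_norm, ← ENNReal.ofReal_mul (norm_nonneg _)]
  exact ENNReal.ofReal_le_ofReal (norm_inner_le_norm _ _)

/-- A potential whose Fourier transform is in `L^p` is relatively bounded with respect to the
discrete Laplacian, uniformly in the lattice. -/
theorem exists_norm_torusPot_mul_latRes_le (ψ : 𝓢(Space d, ℂ)) {p q : ℝ}
    (hpq : p.HolderConjugate q) (hp2 : p ≤ 2) (hq : (d : ℝ) < 2 * q) :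
    ∃ C : ℝ, 0 ≤ C ∧ ∀ h s : ℝ, ∀ hh : 0 < h, 1 ≤ s → ∀ b : Space d → ℂ,
      MemLp b (ENNReal.ofReal p) → Integrable (fun ζ => b ζ * ψ (h • ζ)) →
        ‖torusPot h hh (fun ζ => b ζ * ψ (h • ζ)) * latRes d h s‖ ≤
          C * (eLpNorm b (ENNReal.ofReal p) volume).toReal := by
  obtain ⟨S, hS, hSb⟩ := exists_lintegral_schwartz_mul_latSym_le ψ hpq.symm.lt.le hq
  have hp0 : 0 < p := hpq.pos
  have hq0 : 0 < q := hpq.symm.pos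
  refine ⟨(S ^ (1 / q)).toReal, ENNReal.toReal_nonneg, fun h s hh hs1 b hb hint => ?_⟩
  have hs : 0 < s := by linarith
  refine norm_le_of_norm_inner_le _ (by positivity) fun K F => ?_
  set T : Space d → Torus d → Torus d := fun ζ θ => θ + toTorus (h • ζ) with hT
  have hTm : Measurable (Function.uncurry T) :=
    measurable_snd.add (measurable_toTorus.comp (measurable_fst.const_smul h))
  have hTp : ∀ ζ, MeasurePreserving (T ζ) (torusMeasure d) (torusMeasure d) := fun ζ =>
    measurePreserving_add_right (torusMeasure d) _
  have hwm : Measurable fun ζ : Space d => ‖ψ (h • ζ)‖ₑ :=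
    (ψ.continuous.measurable.comp (measurable_id.const_smul h)).enorm
  -- The amplitude b plays the role of g, the mollifier factor |ψ(hζ)| that of w, and the symbol of
  -- the lattice resolvent that of m.
  have key := lintegral_schur_le hTm hTp (ν := volume) hb.1.enorm hwm
    (ENNReal.measurable_ofReal.comp (continuous_latSym (h := h) hs).measurable)
    (Lp.stronglyMeasurable F).measurable.enorm (Lp.stronglyMeasurable K).measurable.enorm hpq hp2
    (fun θ => hSb h s hh hs1 θ)
  rw [lintegral_enorm_rpow_two, lintegral_enorm_rpow_two] at key
  have hbn : (∫⁻ ζ, ‖b ζ‖ₑ ^ p) ^ (1 / p) = eLpNorm b (ENNReal.ofReal p) volume := by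
    rw [eLpNorm_eq_lintegral_rpow_enorm_toReal (by simpa using hp0) ENNReal.ofReal_ne_top,
      ENNReal.toReal_ofReal hp0.le]
  rw [hbn] at key
  have hle : ‖(inner ℂ K ((torusPot h hh (fun ζ => b ζ * ψ (h • ζ)) * latRes d h s) F) : ℂ)‖ₑ ≤
      eLpNorm b (ENNReal.ofReal p) volume * S ^ (1 / q) * (‖F‖ₑ * ‖K‖ₑ) := by
    refine le_trans ?_ key
    rw [mul_apply_eq_comp, (inner_torusPot hh hint K _).2]
    refine (enorm_integral_le_lintegral_enorm _).trans (lintegral_mono fun ζ => ?_)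
    have h₁ : ‖(inner ℂ K (torusShift (toTorus (h • ζ)) (latRes d h s F)) : ℂ)‖ₑ ≤
        ∫⁻ θ, ‖K θ‖ₑ * (ENNReal.ofReal (latSym h s (T ζ θ)) * ‖F (T ζ θ)‖ₑ)
          ∂(torusMeasure d) := by
      refine (enorm_inner_le_lintegral _ _).trans (lintegral_mono_ae ?_)
      filter_upwards [coeFn_torusShift (toTorus (h • ζ)) (latRes d h s F),
        (hTp ζ).quasiMeasurePreserving.ae (coeFn_mulCLM (memLp_top_latSym (h := h) hs) F)]
        with θ e₁ e₂
      have e₃ : latRes d h s F (θ + toTorus (h • ζ)) = (latSym h s (T ζ θ) : ℂ) * F (T ζ θ) := e₂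
      rw [e₁, e₃, enorm_mul, ← ofReal_norm (latSym h s (T ζ θ) : ℂ), Complex.norm_real,
        Real.norm_of_nonneg (latSym_nonneg hs _)]
    simp only [enorm_mul]
    refine (mul_le_mul_right h₁ _).trans (le_of_eq ?_)
    refine (lintegral_const_mul' _ _ (ENNReal.mul_ne_top enorm_ne_top enorm_ne_top)).symm
  have hfin : eLpNorm b (ENNReal.ofReal p) volume * S ^ (1 / q) * (‖F‖ₑ * ‖K‖ₑ) ≠ ⊤ :=
    ENNReal.mul_ne_top (ENNReal.mul_ne_top hb.2.ne
      (ENNReal.rpow_ne_top_of_nonneg (by positivity) hS))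
      (ENNReal.mul_ne_top enorm_ne_top enorm_ne_top)
  have := ENNReal.toReal_mono hfin hle
  simp only [ENNReal.toReal_mul, toReal_enorm] at this
  refine this.trans (le_of_eq ?_)
  ring

end LatticePotential

/-! ### The continuum potential, and convergence for compactly supported amplitudes. -/

section SpacePotential

variable {d : ℕ} {h s : ℝ}

/-- The character `x ↦ e^{2πi x·ζ}`. -/
noncomputable def spacePhase (ζ x : Space d) : ℂ := (Real.fourierChar (inner ℝ ζ x) : ℂ)

theorem norm_spacePhase (ζ x : Space d) : ‖spacePhase ζ x‖ = 1 := Circle.norm_coe _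

theorem continuous_spacePhase : Continuous fun z : Space d × Space d => spacePhase z.1 z.2 := by
  have h₁ : Continuous fun z : Space d × Space d => Real.fourierChar (inner ℝ z.1 z.2) :=
    Real.continuous_fourierChar.comp (continuous_fst.inner continuous_snd)
  exact continuous_induced_dom.comp h₁

theorem measurable_spacePhase : Measurable (Function.uncurry (spacePhase (d := d))) :=
  continuous_spacePhase.measurable

theorem memLp_top_spacePhase (ζ : Space d) : MemLp (spacePhase ζ) ⊤ (volume : Measure (Space d)) :=
  memLp_top_of_bound
    (continuous_spacePhase.comp (Continuous.prodMk_right ζ)).aestronglyMeasurable 1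
    (ae_of_all _ fun x => (norm_spacePhase ζ x).le)

/-- The inverse Fourier transform on `L²(ℝ^d)`. -/
noncomputable def invF (d : ℕ) : L2 d ≃ₗᵢ[ℂ] L2 d := (Lp.fourierTransformₗᵢ (Space d) ℂ).symm

theorem invF_toLp (ψ : 𝓢(Space d, ℂ)) : invF d (ψ.toLp 2) = (𝓕⁻ ψ).toLp 2 :=
  SchwartzMap.toLp_fourierInv_eq ψ

theorem fourierInv_compSubConst (ψ : 𝓢(Space d, ℂ)) (ζ x : Space d) :
    𝓕⁻ (ψ.compSubConstCLM ℂ ζ) x = spacePhase ζ x * 𝓕⁻ ψ x := by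
  rw [SchwartzMap.fourierInv_coe, SchwartzMap.fourierInv_coe, Real.fourierInv_eq,
    Real.fourierInv_eq, ← integral_const_mul, ← integral_sub_right_eq_self
      (fun v => spacePhase ζ x * (Real.fourierChar (inner ℝ v x) • ψ v)) ζ]
  refine integral_congr_ae (ae_of_all _ fun v => ?_)
  simp only [SchwartzMap.compSubConstCLM_apply, spacePhase, Circle.smul_def, smul_eq_mul]
  rw [← mul_assoc, ← Circle.coe_mul, ← AddChar.map_add_eq_mul, ← inner_add_left,
    add_sub_cancel]

/-- Both sides are continuous in f, so Schwartz functions suffice, where it is the change of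
variables in the Fourier integral. It is the continuum counterpart of `latToTorus_mulCLM`. -/
theorem invF_spaceShift (ζ : Space d) (f : L2 d) :
    invF d (spaceShift ζ f) = mulCLM volume (spacePhase ζ) (invF d f) := by
  refine DenseRange.induction_on (p := fun f => invF d (spaceShift ζ f) =
    mulCLM volume (spacePhase ζ) (invF d f))
    (SchwartzMap.denseRange_toLpCLM (F := ℂ) (μ := (volume : Measure (Space d)))
      (p := 2) ENNReal.ofNat_ne_top) f ?_ ?_
  · exact isClosed_eq ((invF d).continuous.comp (spaceShift ζ).continuous)
      ((mulCLM volume (spacePhase ζ)).continuous.comp (invF d).continuous)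
  · intro ψ
    change invF d (spaceShift ζ (ψ.toLp 2)) = mulCLM volume (spacePhase ζ) (invF d (ψ.toLp 2))
    have h₁ : spaceShift ζ (ψ.toLp 2) = (ψ.compSubConstCLM ℂ ζ).toLp 2 := by
      refine Lp.ext ?_
      filter_upwards [coeFn_spaceShift ζ (ψ.toLp 2), (ψ.compSubConstCLM ℂ ζ).coeFn_toLp 2 volume,
        (measurePreserving_sub_right (volume : Measure (Space d)) ζ).quasiMeasurePreserving.ae
          (ψ.coeFn_toLp 2 volume)] with x e₁ e₂ e₃
      rw [e₁, e₂, e₃, SchwartzMap.compSubConstCLM_apply]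
    rw [h₁, invF_toLp, invF_toLp]
    symm
    refine mulCLM_eq_of_ae (memLp_top_spacePhase ζ) ?_
    filter_upwards [(𝓕⁻ (ψ.compSubConstCLM ℂ ζ)).coeFn_toLp 2 volume,
      (𝓕⁻ ψ).coeFn_toLp 2 volume] with x e₁ e₂
    rw [e₁, e₂, fourierInv_compSubConst]

/-- The function `x ↦ ∫ a(ζ) e^{2πi x·ζ} dζ`. -/
noncomputable def spaceFun (a : Space d → ℂ) (x : Space d) : ℂ := ∫ ζ, a ζ * spacePhase ζ x

theorem memLp_top_spaceFun {a : Space d → ℂ} (ha : Integrable a) :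
    MemLp (spaceFun a) ⊤ volume :=
  memLp_top_superposition ha measurable_spacePhase fun _ _ => (norm_spacePhase _ _).le

/-- The multiplication by `spaceFun a`, on the Fourier side. -/
noncomputable def freqPot (a : Space d → ℂ) : L2 d →L[ℂ] L2 d :=
  (invF d).symm.toLinearIsometry.toContinuousLinearMap ∘L mulCLM volume (spaceFun a) ∘L
    (invF d).toLinearIsometry.toContinuousLinearMap

theorem invF_freqPot (a : Space d → ℂ) (F : L2 d) :
    invF d (freqPot a F) = mulCLM volume (spaceFun a) (invF d F) :=
  (invF d).apply_symm_apply _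

theorem inner_freqPot {a : Space d → ℂ} (ha : Integrable a) (K F : L2 d) :
    Integrable (fun ζ => a ζ * inner ℂ K (spaceShift ζ F)) ∧
    inner ℂ K (freqPot a F) = ∫ ζ, a ζ * inner ℂ K (spaceShift ζ F) := by
  have h₁ := inner_mulCLM_superposition (μ := (volume : Measure (Space d))) ha
    (e := spacePhase) measurable_spacePhase (fun _ _ => (norm_spacePhase _ _).le) (invF d K) (invF d F)
  have h₂ : ∀ ζ : Space d, inner ℂ (invF d K) (mulCLM volume (fun x => spacePhase ζ x)
      (invF d F)) = inner ℂ K (spaceShift ζ F) := by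
    intro ζ
    rw [← (invF d).inner_map_map K, invF_spaceShift]
  simp only [h₂] at h₁
  refine ⟨h₁.1, ?_⟩
  rw [← h₁.2, ← (invF d).inner_map_map K, invF_freqPot]
  rfl

theorem inner_lift {X Y : Type*} [NormedAddCommGroup X] [InnerProductSpace ℂ X] [CompleteSpace X]
    [NormedAddCommGroup Y] [InnerProductSpace ℂ Y] [CompleteSpace Y] (I : Y →ₗᵢ[ℂ] X)
    (R : Y →L[ℂ] Y) (x x' : X) : inner ℂ x (lift I R x') =
      inner ℂ (ContinuousLinearMap.adjoint I.toContinuousLinearMap x)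
        (R (ContinuousLinearMap.adjoint I.toContinuousLinearMap x')) := by
  rw [ContinuousLinearMap.adjoint_inner_left]
  rfl

set_option maxHeartbeats 2000000 in
/-- Convergence of the lattice operators for a potential with compactly supported Fourier
transform. -/
theorem exists_norm_lift_torusPot_sub_lt {a : Space d → ℂ} (ha : Integrable a)
    (hac : HasCompactSupport a) {ψ : Space d → ℂ} (hψ : Continuous ψ) (hψ0 : ψ 0 = 1)
    (hψi : ∀ h : ℝ, Integrable fun ζ => a ζ * ψ (h • ζ)) (hs : 0 < s) {ε : ℝ} (hε : 0 < ε) :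
    ∃ h₀ > 0, ∀ h, ∀ hh : 0 < h, h < h₀ →
      ‖lift (cellEmb h hh) (torusPot h hh (fun ζ => a ζ * ψ (h • ζ)) * latRes d h s) -
        freqPot a * contRes d s‖ < ε := by
  obtain ⟨R, hR⟩ := hac.isCompact.isBounded.subset_closedBall 0
  set R' := max R 1 with hR'
  have hR0 : 0 < R' := lt_max_of_lt_right one_pos
  have hsupp : ∀ ζ, a ζ ≠ 0 → ‖ζ‖ ≤ R' := fun ζ hζ => by
    have := hR (subset_tsupport a hζ)
    rw [mem_closedBall_zero_iff] at this
    exact this.trans (le_max_left _ _)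
  set M := ∫ ζ, ‖a ζ‖ with hM
  have hM0 : 0 ≤ M := integral_nonneg fun ζ => norm_nonneg _
  -- Per frequency the error is at most 2·5h² + |ψ(hζ) − 1| s⁻¹ ≤ η(10 + s⁻¹). Integrating against
  -- |a| multiplies by M, and M + 1 avoids division by zero.
  set η := ε / ((M + 1) * (10 + s⁻¹)) with hη
  have hη0 : 0 < η := by positivity
  obtain ⟨δ, hδ, hδψ⟩ := Metric.continuousAt_iff.1 hψ.continuousAt (min η 1) (by positivity)
  -- On the support of a these bounds ensure, in turn, that ψ(hζ) is close to 1, that no coordinate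
  -- of hζ exceeds 1/4, and that h² ≤ η.
  refine ⟨min (δ / R') (min (1 / (4 * R')) (min η 1)), by positivity, fun h hh hlt => ?_⟩
  have hl₁ : h * R' < δ := (lt_div_iff₀ hR0).1 (hlt.trans_le (min_le_left _ _))
  have hl₂ : h * R' ≤ 1 / 4 := by
    have : h < 1 / (4 * R') := hlt.trans_le ((min_le_right _ _).trans (min_le_left _ _))
    rw [lt_div_iff₀ (by positivity)] at this
    linarith
  have hl₃ : h ^ 2 ≤ η := by
    have e₁ : h < η := hlt.trans_le
      ((min_le_right _ _).trans ((min_le_right _ _).trans (min_le_left _ _)))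
    have e₂ : h < 1 := hlt.trans_le
      ((min_le_right _ _).trans ((min_le_right _ _).trans (min_le_right _ _)))
    nlinarith
  set I := cellEmb (d := d) h hh with hI
  set Q : Space d → L2 d →L[ℂ] L2 d := fun ζ =>
    ψ (h • ζ) • lift I (torusShift (toTorus (h • ζ)) * latRes d h s) -
      spaceShift ζ * contRes d s with hQ
  have hQb : ∀ ζ, a ζ ≠ 0 → ‖Q ζ‖ ≤ η * (10 + s⁻¹) := by
    intro ζ hζ
    have hζR : h * ‖ζ‖ ≤ h * R' := mul_le_mul_of_nonneg_left (hsupp ζ hζ) hh.le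
    have h₁ := norm_lift_torusShift_mul_latRes_sub_le (d := d) hh hs (ζ := ζ) fun j => by
      rw [abs_mul, abs_of_pos hh]
      refine le_trans (mul_le_mul_of_nonneg_left ?_ hh.le) (hζR.trans hl₂)
      exact PiLp.norm_apply_le ζ j
    have h₂ : dist (ψ (h • ζ)) 1 < min η 1 := by
      rw [← hψ0]
      refine hδψ ?_
      rw [dist_zero_right, norm_smul, Real.norm_of_nonneg hh.le]
      exact hζR.trans_lt hl₁
    rw [dist_eq_norm] at h₂
    have h₃ : ‖ψ (h • ζ)‖ ≤ 2 := by
      have := norm_add_le (ψ (h • ζ) - 1) 1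
      rw [sub_add_cancel, norm_one] at this
      linarith [h₂.trans_le (min_le_right η 1)]
    have h₄ : Q ζ = ψ (h • ζ) • (lift I (torusShift (toTorus (h • ζ)) * latRes d h s) -
        spaceShift ζ * contRes d s) + (ψ (h • ζ) - 1) • (spaceShift ζ * contRes d s) := by
      rw [hQ]
      module
    have h₅ : ‖spaceShift ζ * contRes d s‖ ≤ s⁻¹ := by
      refine (norm_mul_le _ _).trans ((mul_le_mul (norm_spaceShift_le ζ) (norm_contRes_le hs)
        (norm_nonneg _) zero_le_one).trans_eq (one_mul _))
    rw [h₄]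
    refine (norm_add_le _ _).trans ?_
    rw [norm_smul, norm_smul]
    have h₆ := mul_le_mul h₃ h₁ (norm_nonneg _) zero_le_two
    have h₇ := mul_le_mul (h₂.le.trans (min_le_left η 1)) h₅ (norm_nonneg _) hη0.le
    rw [mul_add]
    linarith
  have hlt' : η * (10 + s⁻¹) * M < ε := by
    have : η * (10 + s⁻¹) * (M + 1) = ε := by
      rw [hη]
      field_simp
    have h₀ : 0 < η * (10 + s⁻¹) := by positivity
    linarith
  refine lt_of_le_of_lt (norm_le_of_norm_inner_le _ (by positivity) fun K F => ?_) hlt'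
  have e₁ := inner_torusPot hh (hψi h)
    (ContinuousLinearMap.adjoint I.toContinuousLinearMap K)
    (latRes d h s (ContinuousLinearMap.adjoint I.toContinuousLinearMap F))
  have e₂ := inner_freqPot ha K (contRes d s F)
  have e₃ : inner ℂ K ((lift I (torusPot h hh (fun ζ => a ζ * ψ (h • ζ)) * latRes d h s) -
        freqPot a * contRes d s) F) = ∫ ζ, a ζ * inner ℂ K (Q ζ F) := by
    rw [sub_apply, inner_sub_right, inner_lift, mul_apply_eq_comp, mul_apply_eq_comp, e₁.2, e₂.2,
      ← integral_sub e₁.1 e₂.1]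
    refine integral_congr_ae (ae_of_all _ fun ζ => ?_)
    simp only [hQ]
    rw [sub_apply, inner_sub_right, smul_apply, inner_smul_right, inner_lift, mul_apply_eq_comp,
      mul_apply_eq_comp]
    ring
  rw [e₃]
  have h₈ : ∀ ζ, ‖a ζ * inner ℂ K (Q ζ F)‖ ≤ (η * (10 + s⁻¹) * ‖K‖ * ‖F‖) * ‖a ζ‖ := by
    intro ζ
    by_cases hζ : a ζ = 0
    · rw [hζ]; simp
    · rw [norm_mul, mul_comm]
      refine mul_le_mul_of_nonneg_right ?_ (norm_nonneg _)
      refine (norm_inner_le_norm _ _).trans ?_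
      have := mul_le_mul_of_nonneg_left ((Q ζ).le_of_opNorm_le (hQb ζ hζ) F) (norm_nonneg K)
      linarith
  refine (norm_integral_le_of_norm_le (ha.norm.const_mul _) (ae_of_all _ h₈)).trans (le_of_eq ?_)
  rw [integral_const_mul]
  ring

end SpacePotential

/-! ### Relative bounds and the norm limit for general potentials. -/

section Limit

open Filter Topology

variable {d : ℕ} {h s : ℝ}

theorem exists_norm_schwartz_le_const (ψ : 𝓢(Space d, ℂ)) : ∃ C : ℝ, 0 ≤ C ∧ ∀ ω, ‖ψ ω‖ ≤ C := by
  obtain ⟨C, hC, hψ⟩ := exists_norm_schwartz_le ψ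
  refine ⟨C, hC, fun ω => (hψ ω).trans ?_⟩
  refine mul_le_of_le_one_right hC (Real.rpow_le_one_of_one_le_of_nonpos ?_ ?_)
  · linarith [norm_nonneg ω]
  · have := (Nat.cast_nonneg d : (0 : ℝ) ≤ d)
    linarith

theorem integrable_mul_schwartz_comp_smul {b : Space d → ℂ} (hb : MemLp b 1)
    (ψ : 𝓢(Space d, ℂ)) (h : ℝ) : Integrable fun ζ => b ζ * ψ (h • ζ) := by
  obtain ⟨C, -, hψ⟩ := exists_norm_schwartz_le_const ψ
  refine (memLp_one_iff_integrable.1 hb).mul_bdd (c := C) ?_ (ae_of_all _ fun ζ => hψ _)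
  exact (ψ.continuous.comp (continuous_const_smul h)).aestronglyMeasurable

/-- Hölder, with ζ ↦ ψ(hζ) in L^q. Positivity of h matters: at h = 0 the second factor is constant.
-/
theorem integrable_mul_schwartz_comp_smul_of_memLp {p q : ℝ} (hpq : p.HolderConjugate q)
    {b : Space d → ℂ} (hb : MemLp b (ENNReal.ofReal p)) (ψ : 𝓢(Space d, ℂ)) (hh : 0 < h) :
    Integrable fun ζ => b ζ * ψ (h • ζ) := by
  have h₁ := (SchwartzMap.compCLMOfContinuousLinearEquiv ℂ
    (ContinuousLinearEquiv.smulLeft (R₁ := ℝ) (M₁ := Space d) (Units.mk0 h hh.ne')) ψ).memLp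
      (ENNReal.ofReal q) (volume : Measure (Space d))
  have := hpq.ennrealOfReal
  exact hb.integrable_mul h₁

/-- Uniform bound for the relative norm of a potential with Fourier transform in `L¹ + L^p`. -/
theorem exists_norm_torusPot_add_mul_latRes_le (ψ : 𝓢(Space d, ℂ)) {p q : ℝ}
    (hpq : p.HolderConjugate q) (hp2 : p ≤ 2) (hq : (d : ℝ) < 2 * q) :
    ∃ C : ℝ, 0 ≤ C ∧ ∀ h s : ℝ, ∀ hh : 0 < h, 1 ≤ s → ∀ b₁ b₂ : Space d → ℂ,
      MemLp b₁ 1 → MemLp b₂ (ENNReal.ofReal p) →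
        ‖torusPot h hh (fun ζ => (b₁ ζ + b₂ ζ) * ψ (h • ζ)) * latRes d h s‖ ≤
          C * (s⁻¹ * (eLpNorm b₁ 1 volume).toReal +
            (eLpNorm b₂ (ENNReal.ofReal p) volume).toReal) := by
  obtain ⟨C₁, hC₁, hψ⟩ := exists_norm_schwartz_le_const ψ
  obtain ⟨C₂, hC₂, hb⟩ := exists_norm_torusPot_mul_latRes_le ψ hpq hp2 hq
  refine ⟨max C₁ C₂, le_max_of_le_left hC₁, fun h s hh hs1 b₁ b₂ hb₁ hb₂ => ?_⟩
  have hs : 0 < s := by linarith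
  have hi₁ := integrable_mul_schwartz_comp_smul hb₁ ψ h
  have hi₂ := integrable_mul_schwartz_comp_smul_of_memLp hpq hb₂ ψ hh
  have hsplit : (fun ζ => (b₁ ζ + b₂ ζ) * ψ (h • ζ)) =
      fun ζ => b₁ ζ * ψ (h • ζ) + b₂ ζ * ψ (h • ζ) := by
    funext ζ
    ring
  rw [hsplit, torusPot_add hh hi₁ hi₂, add_mul]
  have h₁ : ‖torusPot h hh (fun ζ => b₁ ζ * ψ (h • ζ)) * latRes d h s‖ ≤
      C₁ * (eLpNorm b₁ 1 volume).toReal * s⁻¹ := by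
    refine (norm_mul_le _ _).trans (mul_le_mul ?_ (norm_latRes_le hs) (norm_nonneg _)
      (by positivity))
    refine (norm_torusPot_le hh hi₁).trans ?_
    rw [eLpNorm_one_eq_lintegral_enorm, ← integral_norm_eq_lintegral_enorm hb₁.1,
      ← integral_const_mul]
    refine integral_mono hi₁.norm ((memLp_one_iff_integrable.1 hb₁).norm.const_mul _) fun ζ => ?_
    simp only [norm_mul]
    rw [mul_comm]
    exact mul_le_mul_of_nonneg_right (hψ _) (norm_nonneg _)
  refine (norm_add_le _ _).trans ((add_le_add h₁ (hb h s hh hs1 b₂ hb₂ hi₂)).trans ?_)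
  rw [mul_add, mul_right_comm, mul_assoc]
  refine add_le_add (mul_le_mul_of_nonneg_right (le_max_left _ _) (by positivity))
    (mul_le_mul_of_nonneg_right (le_max_right _ _) ENNReal.toReal_nonneg)

/-- If a family is approximated, up to small errors, by the terms of a sequence, then both have the
same limit. -/
theorem exists_limit_of_approx {E : Type*} [NormedAddCommGroup E] [CompleteSpace E]
    (L : ∀ h : ℝ, 0 < h → E) (T : ℕ → E) (δ : ℕ → ℝ) (hδ : Tendsto δ atTop (𝓝 0))
    (H : ∀ n, ∀ η > 0, ∃ h₀ > 0, ∀ h, ∀ hh : 0 < h, h < h₀ → ‖L h hh - T n‖ ≤ δ n + η) :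
    ∃ B, Tendsto T atTop (𝓝 B) ∧
      ∀ ε > 0, ∃ h₀ > 0, ∀ h, ∀ hh : 0 < h, h < h₀ → ‖L h hh - B‖ < ε := by
  have hTT : ∀ n m, ‖T n - T m‖ ≤ δ n + δ m := by
    intro n m
    refine le_of_forall_pos_le_add fun η hη => ?_
    obtain ⟨h₁, hh₁, H₁⟩ := H n (η / 2) (by positivity)
    obtain ⟨h₂, hh₂, H₂⟩ := H m (η / 2) (by positivity)
    have hm : 0 < min h₁ h₂ / 2 := by positivity
    have hlt : min h₁ h₂ / 2 < min h₁ h₂ := by linarith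
    have e₁ := H₁ _ hm (hlt.trans_le (min_le_left _ _))
    have e₂ := H₂ _ hm (hlt.trans_le (min_le_right _ _))
    have e₃ := norm_sub_le (L _ hm - T m) (L _ hm - T n)
    rw [sub_sub_sub_cancel_left] at e₃
    linarith
  have hcau : CauchySeq T := by
    refine Metric.cauchySeq_iff'.2 fun ε hε => ?_
    obtain ⟨N, hN⟩ := eventually_atTop.1 (hδ.eventually (gt_mem_nhds (half_pos hε)))
    refine ⟨N, fun n hn => ?_⟩
    rw [dist_eq_norm]
    linarith [hTT n N, hN n hn, hN N le_rfl]
  obtain ⟨B, hB⟩ := cauchySeq_tendsto_of_complete hcau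
  refine ⟨B, hB, fun ε hε => ?_⟩
  obtain ⟨N, hN⟩ := eventually_atTop.1 (hδ.eventually (gt_mem_nhds (show 0 < ε / 4 by positivity)))
  have hB' : ∀ᶠ n in atTop, ‖T n - B‖ < ε / 4 := by
    have := Metric.tendsto_nhds.1 hB (ε / 4) (by positivity)
    simpa only [dist_eq_norm] using this
  obtain ⟨N', hN'⟩ := eventually_atTop.1 hB'
  obtain ⟨h₀, hh₀, H₀⟩ := H (max N N') (ε / 4) (by positivity)
  refine ⟨h₀, hh₀, fun h hh hlt => ?_⟩
  have e₁ := H₀ h hh hlt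
  have e₂ := hN _ (le_max_left N N')
  have e₃ := hN' _ (le_max_right N N')
  have e₄ := norm_add_le (L h hh - T (max N N')) (T (max N N') - B)
  rw [sub_add_sub_cancel] at e₄
  linarith

theorem exists_continuous_hasCompactSupport_approx {p : ℝ≥0∞} (hp : p ≠ ⊤) {g : Space d → ℂ}
    (hg : MemLp g p) {ε : ℝ} (hε : 0 < ε) : ∃ a : Space d → ℂ, HasCompactSupport a ∧
      Continuous a ∧ MemLp a p ∧ (eLpNorm (g - a) p volume).toReal ≤ ε := by
  obtain ⟨a, h₁, h₂, h₃, h₄⟩ := hg.exists_hasCompactSupport_eLpNorm_sub_le hp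
    (ε := ENNReal.ofReal ε) (by simpa using hε)
  exact ⟨a, h₁, h₃, h₄, ENNReal.toReal_le_of_le_ofReal hε.le h₂⟩

set_option maxHeartbeats 1000000 in
/-- For a potential with Fourier transform in `L¹ + L^p`, the operators `V_h (s + T_h)⁻¹` converge
in norm, and are small for large `s`. -/
theorem exists_limit_torusPot_mul_latRes (ψ : 𝓢(Space d, ℂ)) (hψ0 : ψ 0 = 1) {p q : ℝ}
    (hpq : p.HolderConjugate q) (hp2 : p ≤ 2) (hq : (d : ℝ) < 2 * q) {g₁ g₂ : Space d → ℂ}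
    (hg₁ : MemLp g₁ 1) (hg₂ : MemLp g₂ (ENNReal.ofReal p)) :
    ∃ s₀ : ℝ, 1 ≤ s₀ ∧ ∀ s, s₀ ≤ s →
      (∀ h, ∀ hh : 0 < h,
        ‖torusPot h hh (fun ζ => (g₁ ζ + g₂ ζ) * ψ (h • ζ)) * latRes d h s‖ ≤ 1 / 2) ∧
      ∃ B : L2 d →L[ℂ] L2 d, ‖B‖ ≤ 1 / 2 ∧
        (∀ ε > 0, ∃ h₀ > 0, ∀ h, ∀ hh : 0 < h, h < h₀ →
          ‖lift (cellEmb h hh) (torusPot h hh (fun ζ => (g₁ ζ + g₂ ζ) * ψ (h • ζ)) *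
            latRes d h s) - B‖ < ε) ∧
        ∃ a b : ℕ → Space d → ℂ, (∀ n, MemLp (a n) 1) ∧ (∀ n, MemLp (b n) 1) ∧
          (∀ n, MemLp (b n) (ENNReal.ofReal p)) ∧
          Tendsto (fun n => (eLpNorm (g₁ - a n) 1 volume).toReal) atTop (𝓝 0) ∧
          Tendsto (fun n => (eLpNorm (g₂ - b n) (ENNReal.ofReal p) volume).toReal) atTop (𝓝 0) ∧
          Tendsto (fun n => freqPot (fun ζ => a n ζ + b n ζ) * contRes d s) atTop (𝓝 B) := by
  obtain ⟨C, hC, hCb⟩ := exists_norm_torusPot_add_mul_latRes_le ψ hpq hp2 hq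
  have hpt : ENNReal.ofReal p ≠ ⊤ := ENNReal.ofReal_ne_top
  have hcs : ∀ {a : Space d → ℂ}, HasCompactSupport a → Continuous a → MemLp a 1 :=
    fun hac ha => memLp_one_iff_integrable.2 (ha.integrable_of_hasCompactSupport hac)
  -- Regroup g₁ + g₂ as (g₁ + b₀) + (g₂ − b₀): the L^p part contributes at most C/(4(C+1)) ≤ 1/4,
  -- and b₀, being continuous with compact support, moves into the L¹ part, whose bound carries the
  -- factor s⁻¹.
  obtain ⟨b₀, hb₀c, hb₀, hb₀p, hb₀ε⟩ := exists_continuous_hasCompactSupport_approx hpt hg₂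
    (ε := 1 / (4 * (C + 1))) (by positivity)
  set M := (eLpNorm (g₁ + b₀) 1 volume).toReal with hM
  have hM0 : 0 ≤ M := ENNReal.toReal_nonneg
  -- Chosen so that C s⁻¹ M ≤ 1/4 for the L¹ part; the total is then at most 1/2, uniformly in h.
  refine ⟨1 + 4 * C * M, by nlinarith [mul_nonneg hC hM0], fun s hs => ?_⟩
  have hCM := mul_nonneg hC hM0
  have hs1 : 1 ≤ s := by nlinarith
  have hs0 : 0 < s := by linarith
  have hsinv : s⁻¹ ≤ 1 := inv_le_one_of_one_le₀ hs1
  have hbound : ∀ h, ∀ hh : 0 < h,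
      ‖torusPot h hh (fun ζ => (g₁ ζ + g₂ ζ) * ψ (h • ζ)) * latRes d h s‖ ≤ 1 / 2 := by
    intro h hh
    have h₁ := hCb h s hh hs1 (g₁ + b₀) (g₂ - b₀) (hg₁.add (hcs hb₀c hb₀)) (hg₂.sub hb₀p)
    have h₂ : (fun ζ => ((g₁ + b₀) ζ + (g₂ - b₀) ζ) * ψ (h • ζ)) =
        fun ζ => (g₁ ζ + g₂ ζ) * ψ (h • ζ) := by
      funext ζ
      simp only [Pi.add_apply, Pi.sub_apply]
      ring
    rw [h₂] at h₁
    refine h₁.trans ?_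
    have h₃ : C * (1 / (4 * (C + 1))) ≤ 1 / 4 := by
      rw [mul_one_div, div_le_div_iff₀ (by positivity) (by norm_num)]
      linarith
    have h₄ : C * (s⁻¹ * M) ≤ 1 / 4 := by
      rw [mul_left_comm, inv_mul_le_iff₀ hs0]
      linarith
    have h₅ := mul_le_mul_of_nonneg_left hb₀ε hC
    rw [mul_add]
    linarith
  refine ⟨hbound, ?_⟩
  choose a hac ha haL haε using fun n : ℕ =>
    exists_continuous_hasCompactSupport_approx ENNReal.one_ne_top hg₁
      (ε := 1 / ((n : ℝ) + 1)) (by positivity)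
  choose b hbc hb hbL hbε using fun n : ℕ =>
    exists_continuous_hasCompactSupport_approx hpt hg₂ (ε := 1 / ((n : ℝ) + 1)) (by positivity)
  have hbL1 : ∀ n, MemLp (b n) 1 := fun n => hcs (hbc n) (hb n)
  obtain ⟨B, hTB, hLB⟩ := exists_limit_of_approx
    (fun h hh => lift (cellEmb h hh) (torusPot h hh (fun ζ => (g₁ ζ + g₂ ζ) * ψ (h • ζ)) *
      latRes d h s)) (fun n => freqPot (fun ζ => a n ζ + b n ζ) * contRes d s)
    (fun n => C * 2 * (1 / ((n : ℝ) + 1)))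
    (by simpa using tendsto_one_div_add_atTop_nhds_zero_nat.const_mul (C * 2)) (by
      intro n η hη
      have hint : Integrable fun ζ => a n ζ + b n ζ :=
        (memLp_one_iff_integrable.1 (haL n)).add (memLp_one_iff_integrable.1 (hbL1 n))
      have hψi : ∀ h : ℝ, Integrable fun ζ => (a n ζ + b n ζ) * ψ (h • ζ) := fun h =>
        integrable_mul_schwartz_comp_smul (memLp_one_iff_integrable.2 hint) ψ h
      obtain ⟨h₀, hh₀, H₀⟩ := exists_norm_lift_torusPot_sub_lt hint ((hac n).add (hbc n))
        ψ.continuous hψ0 hψi hs0 hη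
      refine ⟨h₀, hh₀, fun h hh hlt => ?_⟩
      -- The uniform relative bound controls the discarded remainder for every h at once, which lets
      -- the limits n → ∞ and h → 0 be interchanged.
      have h₁ := hCb h s hh hs1 (g₁ - a n) (g₂ - b n) (hg₁.sub (haL n)) (hg₂.sub (hbL n))
      have hi₁ : Integrable fun ζ => ((g₁ - a n) ζ + (g₂ - b n) ζ) * ψ (h • ζ) := by
        refine ((integrable_mul_schwartz_comp_smul (hg₁.sub (haL n)) ψ h).add
          (integrable_mul_schwartz_comp_smul_of_memLp hpq (hg₂.sub (hbL n)) ψ hh)).congr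
          (ae_of_all _ fun ζ => ?_)
        simp only [Pi.add_apply]
        ring
      have h₂ : (fun ζ => (g₁ ζ + g₂ ζ) * ψ (h • ζ)) = fun ζ =>
          ((g₁ - a n) ζ + (g₂ - b n) ζ) * ψ (h • ζ) + (a n ζ + b n ζ) * ψ (h • ζ) := by
        funext ζ
        simp only [Pi.sub_apply]
        ring
      rw [h₂, torusPot_add hh hi₁ (hψi h), add_mul, lift_add, add_sub_assoc]
      refine (norm_add_le _ _).trans (add_le_add ?_ (H₀ h hh hlt).le)
      refine (norm_lift_le _ _).trans (h₁.trans ?_)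
      rw [mul_assoc]
      refine mul_le_mul_of_nonneg_left ?_ hC
      have h₃ := mul_le_mul hsinv (haε n) ENNReal.toReal_nonneg zero_le_one
      linarith [hbε n])
  have hlim : Tendsto (fun n : ℕ => 1 / ((n : ℝ) + 1)) atTop (𝓝 0) :=
    tendsto_one_div_add_atTop_nhds_zero_nat
  refine ⟨B, ?_, hLB, a, b, haL, hbL1, hbL, ?_, ?_, hTB⟩
  · refine le_of_forall_pos_le_add fun ε hε => ?_
    obtain ⟨h₀, hh₀, H₀⟩ := hLB ε hε
    have hh : 0 < h₀ / 2 := by positivity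
    have e₁ := H₀ _ hh (by linarith)
    have e₂ := (norm_lift_le (cellEmb _ hh) (torusPot _ hh
      (fun ζ => (g₁ ζ + g₂ ζ) * ψ ((h₀ / 2) • ζ)) * latRes d (h₀ / 2) s)).trans (hbound _ hh)
    have e₃ := norm_sub_norm_le B (lift (cellEmb _ hh) (torusPot _ hh
      (fun ζ => (g₁ ζ + g₂ ζ) * ψ ((h₀ / 2) • ζ)) * latRes d (h₀ / 2) s))
    rw [norm_sub_rev] at e₃
    linarith
  · exact squeeze_zero (fun n => ENNReal.toReal_nonneg) haε hlim
  · exact squeeze_zero (fun n => ENNReal.toReal_nonneg) hbε hlim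

end Limit

/-! ### The discretized potential in terms of the Fourier transform of V. -/

section LatticePotentialFourier

variable {d : ℕ} {h s : ℝ}

/-- A real Schwartz function as a complex one. -/
noncomputable def complexify (φ : 𝓢(Space d, ℝ)) : 𝓢(Space d, ℂ) :=
  φ.postcompCLM Complex.ofRealCLM

theorem complexify_apply (φ : 𝓢(Space d, ℝ)) (x : Space d) : complexify φ x = (φ x : ℂ) := rfl

/-- The normalization of φ enters only here: it makes the mollifier factor φ̂(hζ) tend to 1. -/
theorem fourier_complexify_zero {φ : 𝓢(Space d, ℝ)} (hφ : ∫ x, φ x = 1) :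
    𝓕 (complexify φ) 0 = 1 := by
  rw [SchwartzMap.fourier_coe, Real.fourier_eq]
  simp only [inner_zero_right, neg_zero, AddChar.map_zero_eq_one, one_smul, complexify_apply]
  rw [integral_complex_ofReal, hφ, Complex.ofReal_one]

theorem spacePhase_latPoint (n : Fin d → ℤ) (ζ : Space d) :
    spacePhase (latPoint h n) ζ = UnitAddTorus.mFourier n (toTorus (h • ζ)) := by
  rw [spacePhase, Real.fourierChar_apply, UnitAddTorus.mFourier, ContinuousMap.coe_mk]
  simp only [toTorus, fourier_coe_apply, ← Complex.exp_sum]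
  congr 1
  rw [PiLp.inner_apply]
  push_cast
  rw [Finset.mul_sum, Finset.sum_mul]
  refine Finset.sum_congr rfl fun j _ => ?_
  simp only [latPoint, PiLp.smul_apply, smul_eq_mul, RCLike.inner_apply, conj_trivial]
  push_cast
  ring

theorem fourierInv_comp_smul (φ : 𝓢(Space d, ℂ)) (hh : 0 < h) (ζ : Space d) :
    𝓕⁻ (SchwartzMap.compCLMOfContinuousLinearEquiv ℂ (ContinuousLinearEquiv.smulLeft
      (R₁ := ℝ) (M₁ := Space d) (Units.mk0 (-h⁻¹) (neg_ne_zero.2 (inv_ne_zero hh.ne')))) φ) ζ =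
      ((h ^ d : ℝ) : ℂ) * 𝓕 φ (h • ζ) := by
  rw [SchwartzMap.fourierInv_coe, SchwartzMap.fourier_coe, Real.fourierInv_eq, Real.fourier_eq]
  have h₁ := Measure.integral_comp_smul (volume : Measure (Space d))
    (fun w : Space d => Real.fourierChar (-inner ℝ w (h • ζ)) • φ w) (-h⁻¹)
  have h₂ : |((-h⁻¹) ^ Module.finrank ℝ (Space d))⁻¹| = h ^ d := by
    rw [finrank_euclideanSpace_fin, abs_inv, abs_pow, abs_neg, abs_inv, abs_of_pos hh, inv_pow,
      inv_inv]
  rw [h₂, Complex.real_smul] at h₁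
  rw [← h₁]
  refine integral_congr_ae (ae_of_all _ fun v => ?_)
  have h₃ : -inner ℝ ((-h⁻¹) • v) (h • ζ) = inner ℝ v ζ := by
    rw [inner_smul_left, inner_smul_right]
    simp [hh.ne']
  simp only [h₃]
  rfl

/-- Apply the definition of the Fourier transform of V to the inverse transform of y ↦ φ_h(hn − y).
The translation to hn yields the character, the dilation yields φ̂(hζ), and the powers of h cancel.
-/
theorem latPotential_eq_latFun {φ : 𝓢(Space d, ℝ)} {V : Space d → ℝ} {g : Space d → ℂ}
    (hV : ∀ ψ : 𝓢(Space d, ℂ), ∫ x, (V x : ℂ) * (𝓕 ψ) x = ∫ ξ, g ξ * ψ ξ) (hh : 0 < h)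
    (n : Fin d → ℤ) :
    (latPotential φ V h n : ℂ) = latFun h (fun ζ => g ζ * 𝓕 (complexify φ) (h • ζ)) n := by
  set η : 𝓢(Space d, ℂ) := ((((h ^ d)⁻¹ : ℝ) : ℂ)) • SchwartzMap.compSubConstCLM ℂ (latPoint h n)
    (SchwartzMap.compCLMOfContinuousLinearEquiv ℂ (ContinuousLinearEquiv.smulLeft
      (R₁ := ℝ) (M₁ := Space d) (Units.mk0 (-h⁻¹) (neg_ne_zero.2 (inv_ne_zero hh.ne'))))
        (complexify φ)) with hη
  have h₁ : ∀ y, η y = (scaled φ h (latPoint h n - y) : ℂ) := by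
    intro y
    have : (-h⁻¹) • (y - latPoint h n) = h⁻¹ • (latPoint h n - y) := by module
    rw [scaled, ← this, Complex.ofReal_mul]
    rfl
  have h₂ := hV (𝓕⁻ η)
  rw [FourierTransform.fourier_fourierInv_eq] at h₂
  have h₃ : ∀ ζ, 𝓕⁻ η ζ = UnitAddTorus.mFourier n (toTorus (h • ζ)) *
      𝓕 (complexify φ) (h • ζ) := by
    intro ζ
    rw [hη, FourierTransform.fourierInv_smul, smul_apply, fourierInv_compSubConst,
      fourierInv_comp_smul _ hh, spacePhase_latPoint, smul_eq_mul, Complex.ofReal_inv]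
    have : ((h ^ d : ℝ) : ℂ) ≠ 0 := Complex.ofReal_ne_zero.2 (pow_pos hh d).ne'
    field_simp
  rw [latPotential, ← integral_complex_ofReal, latFun]
  have h₄ : ∀ y, ((scaled φ h (latPoint h n - y) * V y : ℝ) : ℂ) = (V y : ℂ) * η y := by
    intro y
    rw [h₁, Complex.ofReal_mul, mul_comm]
  simp only [h₄]
  rw [h₂]
  refine integral_congr_ae (ae_of_all _ fun ζ => ?_)
  simp only [h₃]
  ring

end LatticePotentialFourier

/-! ### The resolvent of the discrete Schrödinger operator. -/

section LatticeResolvent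

variable {d : ℕ} {h s : ℝ}

theorem lift_lift {X Y Z : Type*} [NormedAddCommGroup X] [InnerProductSpace ℂ X] [CompleteSpace X]
    [NormedAddCommGroup Y] [InnerProductSpace ℂ Y] [CompleteSpace Y]
    [NormedAddCommGroup Z] [InnerProductSpace ℂ Z] [CompleteSpace Z]
    (I : Y →ₗᵢ[ℂ] X) (I' : Z →ₗᵢ[ℂ] Y) (R : Z →L[ℂ] Z) :
    lift I (lift I' R) = lift (I.comp I') R := by
  have h₁ : (I.comp I').toContinuousLinearMap =
      I.toContinuousLinearMap ∘L I'.toContinuousLinearMap := rfl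
  rw [lift, lift, lift, h₁, ContinuousLinearMap.adjoint_comp]
  rfl

theorem adjoint_linearIsometryEquiv {X Y : Type*} [NormedAddCommGroup X] [InnerProductSpace ℂ X]
    [CompleteSpace X] [NormedAddCommGroup Y] [InnerProductSpace ℂ Y] [CompleteSpace Y]
    (e : Y ≃ₗᵢ[ℂ] X) (x : X) :
    ContinuousLinearMap.adjoint e.toLinearIsometry.toContinuousLinearMap x = e.symm x := by
  refine ext_inner_right ℂ fun y => ?_
  rw [ContinuousLinearMap.adjoint_inner_left, ← e.inner_map_map (e.symm x), e.apply_symm_apply]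
  rfl

theorem lift_linearIsometryEquiv_apply {X Y : Type*} [NormedAddCommGroup X]
    [InnerProductSpace ℂ X] [CompleteSpace X] [NormedAddCommGroup Y] [InnerProductSpace ℂ Y]
    [CompleteSpace Y] (e : Y ≃ₗᵢ[ℂ] X) (R : Y →L[ℂ] Y) (x : X) :
    lift e.toLinearIsometry R x = e (R (e.symm x)) := by
  rw [lift_apply, adjoint_linearIsometryEquiv]
  rfl

theorem exists_inverse_of_norm_le_half {X : Type*} [NormedAddCommGroup X] [NormedSpace ℂ X]
    [CompleteSpace X] {A : X →L[ℂ] X} (hA : ‖A‖ ≤ 1 / 2) :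
    ∃ S : X →L[ℂ] X, (1 + A) * S = 1 ∧ S * (1 + A) = 1 ∧ ‖S‖ ≤ 2 := by
  have h₁ : ‖-A‖ < 1 := by
    rw [norm_neg]
    linarith
  set u := Units.oneSub (-A) h₁ with hu
  have h₂ : (u : X →L[ℂ] X) = 1 + A := by
    rw [hu, Units.val_oneSub, sub_neg_eq_add]
  refine ⟨((u⁻¹ : (X →L[ℂ] X)ˣ) : X →L[ℂ] X), by rw [← h₂, Units.mul_inv],
    by rw [← h₂, Units.inv_mul], ?_⟩
  set S := ((u⁻¹ : (X →L[ℂ] X)ˣ) : X →L[ℂ] X) with hS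
  have h₃ : S = 1 - A * S := by
    have : (1 + A) * S = 1 := by rw [← h₂, Units.mul_inv]
    rw [eq_sub_iff_add_eq, ← this]
    noncomm_ring
  have h₄ : ‖S‖ ≤ 1 + 1 / 2 * ‖S‖ := by
    calc ‖S‖ = ‖1 - A * S‖ := by rw [← h₃]
      _ ≤ ‖(1 : X →L[ℂ] X)‖ + ‖A * S‖ := norm_sub_le _ _
      _ ≤ 1 + 1 / 2 * ‖S‖ := add_le_add ContinuousLinearMap.norm_id_le
        ((norm_mul_le _ _).trans (mul_le_mul_of_nonneg_right hA (norm_nonneg _)))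
  linarith

theorem coeFn_mulOp {α : Type*} [MeasurableSpace α] {μ : Measure α} {W : α → ℝ}
    (u : (mulOp μ W).domain) : mulOp μ W u =ᵐ[μ] fun x => (W x : ℂ) * (u : Lp ℂ 2 μ) x :=
  MemLp.coeFn_toLp u.2

/-- The symbol of `T_h`, as an operator on `L²` of the torus. -/
noncomputable def latKin (d : ℕ) (h : ℝ) : TorusL2 d →L[ℂ] TorusL2 d :=
  mulCLM (torusMeasure d) fun θ => (((h ^ 2)⁻¹ * latSymbol θ : ℝ) : ℂ)

theorem memLp_top_latKin :
    MemLp (fun θ : Torus d => (((h ^ 2)⁻¹ * latSymbol θ : ℝ) : ℂ)) ⊤ (torusMeasure d) :=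
  memLp_top_latSymbol (fun t => (h ^ 2)⁻¹ * t) (by fun_prop)

theorem latKin_add_mul_latRes (hs : 0 < s) :
    (latKin d h + (s : ℂ) • 1) * latRes d h s = 1 := by
  have h₁ : MemLp (fun _ : Torus d => (1 : ℂ)) ⊤ (torusMeasure d) := memLp_top_const 1
  have h₂ : MemLp (fun θ : Torus d => (((h ^ 2)⁻¹ * latSymbol θ : ℝ) : ℂ) + (s : ℂ) * 1) ⊤
      (torusMeasure d) := memLp_top_latKin.add (h₁.const_mul (s : ℂ))
  rw [latKin, ← mulCLM_const_one, ← mulCLM_smul h₁,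
    ← mulCLM_add memLp_top_latKin (h₁.const_mul (s : ℂ)), latRes,
    mulCLM_mul h₂ (memLp_top_latSym hs)]
  congr 1
  funext θ
  rw [latSym, mul_one, ← Complex.ofReal_add, ← Complex.ofReal_mul, add_comm,
    mul_inv_cancel₀ (latSym_denom_pos hs θ).ne', Complex.ofReal_one]

theorem latRes_mul_latKin_add (hs : 0 < s) :
    latRes d h s * (latKin d h + (s : ℂ) • 1) = 1 := by
  have h₁ : MemLp (fun _ : Torus d => (1 : ℂ)) ⊤ (torusMeasure d) := memLp_top_const 1
  have h₂ : MemLp (fun θ : Torus d => (((h ^ 2)⁻¹ * latSymbol θ : ℝ) : ℂ) + (s : ℂ) * 1) ⊤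
      (torusMeasure d) := memLp_top_latKin.add (h₁.const_mul (s : ℂ))
  rw [latKin, ← mulCLM_const_one, ← mulCLM_smul h₁,
    ← mulCLM_add memLp_top_latKin (h₁.const_mul (s : ℂ)), latRes,
    mulCLM_mul (memLp_top_latSym hs) h₂]
  congr 1
  funext θ
  rw [latSym, mul_one, ← Complex.ofReal_add, ← Complex.ofReal_mul,
    add_comm ((h ^ 2)⁻¹ * latSymbol θ) s, inv_mul_cancel₀ (latSym_denom_pos hs θ).ne', Complex.ofReal_one]

/-- The isometric embedding `ℓ²(hℤ^d) → L²(ℝ^d)` by band-limited interpolation. -/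
noncomputable def latEmb (d : ℕ) (h : ℝ) (hh : 0 < h) : LatL2 d h →ₗᵢ[ℂ] L2 d :=
  (invF d).toLinearIsometry.comp ((cellEmb h hh).comp (latToTorus d h hh).toLinearIsometry)

theorem lift_latEmb_lift (hh : 0 < h) (R : TorusL2 d →L[ℂ] TorusL2 d) :
    lift (latEmb d h hh) (lift (latToTorus d h hh).symm.toLinearIsometry R) =
      lift (invF d).toLinearIsometry (lift (cellEmb h hh) R) := by
  rw [lift_lift, lift_lift]
  congr 1
  ext1 F
  simp [latEmb]

theorem torusPot_eq_lift (hh : 0 < h) (a : Space d → ℂ) : torusPot h hh a =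
    lift (latToTorus d h hh).toLinearIsometry (mulCLM (latMeasure d h) (latFun h a)) := by
  ext1 F
  rw [lift_linearIsometryEquiv_apply, torusPot_apply]

/-- V_h is the transform of an integrable function, hence bounded, and the maximal domain is the
whole space. -/
theorem mem_domain_latOp {φ : 𝓢(Space d, ℝ)} {V : Space d → ℝ} {f : Space d → ℂ}
    (hf : Integrable f) (hfV : ∀ n, (latPotential φ V h n : ℂ) = latFun h f n) (u : LatL2 d h) :
    u ∈ (latOp φ V h).domain := by
  refine ⟨Submodule.mem_top, ?_⟩
  refine MemLp.ae_eq ?_ (memLp_mul_of_top (memLp_top_latFun (h := h) hf) u)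
  exact ae_of_all _ fun n => by simp only [hfV]

theorem mulOp_latPotential {φ : 𝓢(Space d, ℝ)} {V : Space d → ℝ} {f : Space d → ℂ}
    (hf : Integrable f) (hfV : ∀ n, (latPotential φ V h n : ℂ) = latFun h f n)
    (u : (mulOp (latMeasure d h) (latPotential φ V h)).domain) :
    mulOp (latMeasure d h) (latPotential φ V h) u =
      mulCLM (latMeasure d h) (latFun h f) (u : LatL2 d h) := by
  symm
  refine mulCLM_eq_of_ae (memLp_top_latFun hf) ?_
  filter_upwards [coeFn_mulOp u] with n hn
  rw [hn, hfV]

theorem latToTorus_latOp {φ : 𝓢(Space d, ℝ)} {V : Space d → ℝ} (hh : 0 < h) {f : Space d → ℂ}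
    (hf : Integrable f) (hfV : ∀ n, (latPotential φ V h n : ℂ) = latFun h f n)
    (u : (latOp φ V h).domain) :
    latToTorus d h hh (latOp φ V h u) =
      (latKin d h + torusPot h hh f) (latToTorus d h hh u) := by
  have h₁ : latOp φ V h u = latFreeOp d h u +
      mulOp (latMeasure d h) (latPotential φ V h) ⟨u, u.2.2⟩ := LinearPMap.add_apply _ _ _
  rw [h₁, map_add, latToTorus_latFreeOp, add_apply, torusPot_apply,
    LinearIsometryEquiv.symm_apply_apply, mulOp_latPotential hf hfV]
  rfl

set_option maxHeartbeats 1000000 in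
/-- The resolvent of the discrete Schrödinger operator. -/
theorem exists_latOp_resolvent {φ : 𝓢(Space d, ℝ)} {V : Space d → ℝ} (hh : 0 < h) (hs : 0 < s)
    {f : Space d → ℂ} (hf : Integrable f)
    (hfV : ∀ n, (latPotential φ V h n : ℂ) = latFun h f n) {S : L2 d →L[ℂ] L2 d}
    (hS₁ : (1 + lift (cellEmb h hh) (torusPot h hh f * latRes d h s)) * S = 1)
    (hS₂ : S * (1 + lift (cellEmb h hh) (torusPot h hh f * latRes d h s)) = 1) :
    ∃ R, IsResolventAt (latOp φ V h) (-(s : ℂ)) R ∧ IsSelfAdjoint R ∧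
      lift (latEmb d h hh) R =
        lift (invF d).toLinearIsometry (lift (cellEmb h hh) (latRes d h s) * S) := by
  set J := latToTorus d h hh with hJ
  set W := torusPot h hh f with hW
  set D := latRes d h s with hD
  set K := latKin d h with hK
  have hVf : MemLp (latFun h f) ⊤ (latMeasure d h) := memLp_top_latFun hf
  obtain ⟨S', hS'₁, hS'₂, hS'⟩ : ∃ S' : TorusL2 d →L[ℂ] TorusL2 d, (1 + W * D) * S' = 1 ∧
      S' * (1 + W * D) = 1 ∧ ∀ T, lift (cellEmb h hh) (T * S') = lift (cellEmb h hh) T * S := by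
    have e : lift (cellEmb h hh) (-(W * D)) = -lift (cellEmb h hh) (W * D) := by
      rw [← neg_one_smul ℂ, lift_smul, neg_one_smul]
    have := exists_inverse_of_lift (cellEmb h hh) (R := -(W * D)) (S := S)
      (by rw [e, sub_neg_eq_add]; exact hS₁) (by rw [e, sub_neg_eq_add]; exact hS₂)
    simpa only [sub_neg_eq_add] using this
  set A := K + W + (s : ℂ) • 1 with hA
  have hAR : A * (D * S') = 1 := by
    calc A * (D * S') = ((K + (s : ℂ) • 1) * D + W * D) * S' := by rw [hA]; noncomm_ring
      _ = 1 := by rw [hK, hD, latKin_add_mul_latRes hs, ← hD, hS'₁]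
  have hRA : (D * S') * A = 1 := by
    -- The factorization T_h + V_h + s = (1 + V_h (s+T_h)⁻¹)(s + T_h), whose inverse is D S'.
    have h₁ : A = (1 + W * D) * (K + (s : ℂ) • 1) := by
      rw [add_mul, one_mul, mul_assoc, hK, hD, latRes_mul_latKin_add hs, mul_one, hA]
      abel
    rw [h₁, mul_assoc, ← mul_assoc S', hS'₂, one_mul, hK, hD, latRes_mul_latKin_add hs]
  have hop : ∀ u : (latOp φ V h).domain, J (latOp φ V h u) = (K + W) (J u) :=
    latToTorus_latOp hh hf hfV
  have hdom : ∀ u, u ∈ (latOp φ V h).domain := mem_domain_latOp hf hfV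
  have hsaK : IsSelfAdjoint K := isSelfAdjoint_mulCLM memLp_top_latKin
  have hsaW : IsSelfAdjoint W := by
    rw [hW, torusPot_eq_lift]
    refine isSelfAdjoint_lift _ ?_
    have h₁ : latFun h f = fun n => (latPotential φ V h n : ℂ) := funext fun n => (hfV n).symm
    rw [h₁] at hVf ⊢
    exact isSelfAdjoint_mulCLM hVf
  have hsaA : IsSelfAdjoint A := by
    refine (hsaK.add hsaW).add ?_
    rw [IsSelfAdjoint, star_smul, star_one, Complex.star_def, Complex.conj_ofReal]
  -- The adjoint of a right inverse of the self-adjoint A is a left inverse, and the two must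
  -- coincide.
  have hsaR : IsSelfAdjoint (D * S') := by
    refine left_inv_eq_right_inv (a := A) ?_ hAR
    have := congrArg star hAR
    rwa [star_mul, hsaA.star_eq, star_one] at this
  refine ⟨lift J.symm.toLinearIsometry (D * S'), ⟨fun y => ⟨hdom _, ?_⟩, fun u => ?_⟩,
    isSelfAdjoint_lift _ hsaR, by rw [hJ, lift_latEmb_lift, hS']⟩
  · apply J.injective
    have h₁ := DFunLike.congr_fun hAR (J y)
    rw [map_sub, hop, map_smul]
    simp only [lift_linearIsometryEquiv_apply, LinearIsometryEquiv.apply_symm_apply,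
      LinearIsometryEquiv.symm_symm]
    rw [neg_smul, sub_neg_eq_add]
    exact h₁
  · apply J.injective
    have h₁ := DFunLike.congr_fun hRA (J u)
    rw [lift_linearIsometryEquiv_apply, LinearIsometryEquiv.apply_symm_apply,
      LinearIsometryEquiv.symm_symm, map_sub, hop, map_smul, neg_smul, sub_neg_eq_add]
    exact h₁

end LatticeResolvent

/-! ### The free resolvent on H² through tempered distributions. -/

section FreeResolvent

variable {d : ℕ} {s : ℝ}

theorem smulLeftCLM_toDist {g : Space d → ℂ} (hg : g.HasTemperateGrowth) (hg' : MemLp g ⊤ volume)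
    (f : L2 d) : TemperedDistribution.smulLeftCLM ℂ g (toDist d f) =
      toDist d (mulCLM volume g f) := by
  ext u
  rw [TemperedDistribution.smulLeftCLM_apply_apply]
  simp only [toDist, Lp.toTemperedDistributionCLM_apply, Lp.toTemperedDistribution_apply]
  refine integral_congr_ae ?_
  filter_upwards [coeFn_mulCLM hg' f] with x hx
  rw [hx, SchwartzMap.smulLeftCLM_apply_apply hg]
  simp only [smul_eq_mul]
  ring

theorem hasTemperateGrowth_contSym (hs : 0 < s) :
    (fun ξ : Space d => (contSym s ξ : ℂ)).HasTemperateGrowth := by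
  have h₁ : (fun ξ : Space d => (2 * Real.pi / Real.sqrt s) • ξ).HasTemperateGrowth :=
    ((2 * Real.pi / Real.sqrt s) • ContinuousLinearMap.id ℝ (Space d)).hasTemperateGrowth
  have h₂ := (Function.hasTemperateGrowth_one_add_norm_sq_rpow (Space d) (-1)).comp h₁
  have h₃ : contSym (d := d) s = fun ξ => s⁻¹ * ((fun x : Space d => (1 + ‖x‖ ^ 2) ^ (-1 : ℝ)) ∘
      fun ξ : Space d => (2 * Real.pi / Real.sqrt s) • ξ) ξ := by
    funext ξ
    simp only [Function.comp_apply]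
    rw [Real.rpow_neg_one, contSym, ← mul_inv, norm_smul, mul_pow, Real.norm_eq_abs, sq_abs,
      div_pow, Real.sq_sqrt hs.le]
    congr 1
    field_simp
    ring
  have h₄ : (contSym (d := d) s).HasTemperateGrowth := by
    rw [h₃]
    exact (Function.HasTemperateGrowth.const s⁻¹).mul h₂
  exact Complex.ofRealCLM.hasTemperateGrowth.comp h₄

theorem hasTemperateGrowth_contSym_denom (s : ℝ) :
    (fun ξ : Space d => ((s + 4 * Real.pi ^ 2 * ‖ξ‖ ^ 2 : ℝ) : ℂ)).HasTemperateGrowth := by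
  have h₁ : (fun ξ : Space d => ‖ξ‖ ^ 2).HasTemperateGrowth := by fun_prop
  have h₂ : (fun ξ : Space d => s + 4 * Real.pi ^ 2 * ‖ξ‖ ^ 2).HasTemperateGrowth :=
    (Function.HasTemperateGrowth.const s).add
      ((Function.HasTemperateGrowth.const (4 * Real.pi ^ 2)).mul h₁)
  exact Complex.ofRealCLM.hasTemperateGrowth.comp h₂

theorem toDist_invF (f : L2 d) : toDist d (invF d f) = 𝓕⁻ (toDist d f) :=
  (Lp.fourierInv_toTemperedDistribution_eq f).symm

theorem neg_laplacian_add_eq (s : ℝ) (T : 𝓢'(Space d, ℂ)) :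
    -Δ T + (s : ℂ) • T = 𝓕⁻ (TemperedDistribution.smulLeftCLM ℂ
      (fun ξ : Space d => ((s + 4 * Real.pi ^ 2 * ‖ξ‖ ^ 2 : ℝ) : ℂ)) (𝓕 T)) := by
  have h₁ : (fun ξ : Space d => ((s + 4 * Real.pi ^ 2 * ‖ξ‖ ^ 2 : ℝ) : ℂ)) =
      (fun _ => (s : ℂ)) + (((2 * Real.pi) ^ 2 : ℝ) : ℂ) •
        fun ξ : Space d => Complex.ofReal (‖ξ‖ ^ 2) := by
    funext ξ
    simp only [Pi.add_apply, Pi.smul_apply, smul_eq_mul]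
    push_cast
    ring
  have h₂ : (fun ξ : Space d => Complex.ofReal (‖ξ‖ ^ 2)).HasTemperateGrowth := by fun_prop
  have h₃ : ((((2 * Real.pi) ^ 2 : ℝ) : ℂ) •
      fun ξ : Space d => Complex.ofReal (‖ξ‖ ^ 2)).HasTemperateGrowth :=
    (Function.HasTemperateGrowth.const (((2 * Real.pi) ^ 2 : ℝ) : ℂ)).smul h₂
  rw [h₁, TemperedDistribution.smulLeftCLM_add (Function.HasTemperateGrowth.const _) h₃,
    TemperedDistribution.smulLeftCLM_smul h₂, add_apply, smul_apply,
    TemperedDistribution.smulLeftCLM_const, FourierTransform.fourierInv_add,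
    FourierTransform.fourierInv_smul, FourierTransform.fourierInv_smul,
    FourierTransform.fourierInv_fourier_eq, TemperedDistribution.laplacian_eq_fourierMultiplierCLM,
    TemperedDistribution.fourierMultiplierCLM_apply, add_comm, neg_smul, neg_neg,
    ← Complex.coe_smul]

theorem smulLeftCLM_denom_contSym (hs : 0 < s) (T : 𝓢'(Space d, ℂ)) :
    TemperedDistribution.smulLeftCLM ℂ
      (fun ξ : Space d => ((s + 4 * Real.pi ^ 2 * ‖ξ‖ ^ 2 : ℝ) : ℂ))
      (TemperedDistribution.smulLeftCLM ℂ (fun ξ : Space d => (contSym s ξ : ℂ)) T) = T := by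
  rw [TemperedDistribution.smulLeftCLM_smulLeftCLM_apply (hasTemperateGrowth_contSym hs)
    (hasTemperateGrowth_contSym_denom s)]
  convert (TemperedDistribution.smulLeftCLM_const 1 T).trans (one_smul ℂ T) using 2
  congr 1
  funext ξ
  rw [Pi.mul_apply, contSym, ← Complex.ofReal_mul, inv_mul_cancel₀ (contSym_denom_pos hs ξ).ne',
    Complex.ofReal_one]

theorem smulLeftCLM_contSym_denom (hs : 0 < s) (T : 𝓢'(Space d, ℂ)) :
    TemperedDistribution.smulLeftCLM ℂ (fun ξ : Space d => (contSym s ξ : ℂ))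
      (TemperedDistribution.smulLeftCLM ℂ
        (fun ξ : Space d => ((s + 4 * Real.pi ^ 2 * ‖ξ‖ ^ 2 : ℝ) : ℂ)) T) = T := by
  rw [TemperedDistribution.smulLeftCLM_smulLeftCLM_apply (hasTemperateGrowth_contSym_denom s)
    (hasTemperateGrowth_contSym hs)]
  convert (TemperedDistribution.smulLeftCLM_const 1 T).trans (one_smul ℂ T) using 2
  congr 1
  funext ξ
  rw [Pi.mul_apply, contSym, ← Complex.ofReal_mul, mul_inv_cancel₀ (contSym_denom_pos hs ξ).ne',
    Complex.ofReal_one]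

theorem fourier_toDist_invF_contRes (hs : 0 < s) (f : L2 d) :
    𝓕 (toDist d (invF d (contRes d s f))) =
      TemperedDistribution.smulLeftCLM ℂ (fun ξ : Space d => (contSym s ξ : ℂ)) (toDist d f) := by
  rw [toDist_invF, FourierTransform.fourier_fourierInv_eq, contRes,
    smulLeftCLM_toDist (hasTemperateGrowth_contSym hs) (memLp_top_contSym hs)]

theorem memSobolev_invF_contRes (hs : 1 ≤ s) (f : L2 d) :
    TemperedDistribution.MemSobolev 2 2 (toDist d (invF d (contRes d s f))) := by
  have hs0 : 0 < s := by linarith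
  have h₁ : (fun ξ : Space d => (((1 + ‖ξ‖ ^ 2) ^ ((2 : ℝ) / 2) : ℝ) : ℂ)).HasTemperateGrowth := by
    fun_prop
  have h₂ := (hasTemperateGrowth_contSym (d := d) hs0).mul h₁
  rw [TemperedDistribution.memSobolev_iff_exists_smulLeftCLM_fourier,
    fourier_toDist_invF_contRes hs0,
    TemperedDistribution.smulLeftCLM_smulLeftCLM_apply (hasTemperateGrowth_contSym hs0) h₁]
  refine ⟨mulCLM volume _ f, smulLeftCLM_toDist h₂ ?_ f⟩
  refine memLp_top_of_bound h₂.1.continuous.aestronglyMeasurable 1 (ae_of_all _ fun ξ => ?_)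
  rw [Pi.mul_apply, div_self two_ne_zero, Real.rpow_one, norm_mul, Complex.norm_real,
    Complex.norm_real, Real.norm_of_nonneg (contSym_nonneg hs0 ξ),
    Real.norm_of_nonneg (by positivity), contSym, inv_mul_eq_div,
    div_le_one (contSym_denom_pos hs0 ξ)]
  have h₃ : (9 : ℝ) ≤ Real.pi ^ 2 := by nlinarith [Real.pi_gt_three]
  nlinarith [sq_nonneg ‖ξ‖]

theorem negLaplacian_invF_contRes (hs : 0 < s) (f : L2 d)
    (hf : TemperedDistribution.MemSobolev 2 2 (toDist d (invF d (contRes d s f)))) :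
    negLaplacian (invF d (contRes d s f)) hf + (s : ℂ) • invF d (contRes d s f) = invF d f := by
  apply toDist_injective
  rw [map_add, map_smul, toDist_negLaplacian, neg_laplacian_add_eq,
    fourier_toDist_invF_contRes hs, smulLeftCLM_denom_contSym hs, toDist_invF]

/-- H² is contained in the range of the free resolvent: on the Fourier side −Δ + s is multiplication
by the reciprocal of the resolvent symbol. With `memSobolev_invF_contRes`, the range is exactly the
domain of −Δ when s ≥ 1. -/
theorem eq_invF_contRes (hs : 0 < s) (u : L2 d)
    (hu : TemperedDistribution.MemSobolev 2 2 (toDist d u)) :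
    u = invF d (contRes d s ((invF d).symm (negLaplacian u hu + (s : ℂ) • u))) := by
  apply toDist_injective
  have h₁ : toDist d (negLaplacian u hu + (s : ℂ) • u) = -Δ (toDist d u) + (s : ℂ) • toDist d u := by
    rw [map_add, map_smul, toDist_negLaplacian]
  rw [neg_laplacian_add_eq] at h₁
  set v := (invF d).symm (negLaplacian u hu + (s : ℂ) • u) with hv
  have h₂ : negLaplacian u hu + (s : ℂ) • u = invF d v := by
    rw [hv, LinearIsometryEquiv.apply_symm_apply]
  rw [h₂, toDist_invF] at h₁
  have h₃ := congrArg 𝓕 h₁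
  rw [FourierTransform.fourier_fourierInv_eq, FourierTransform.fourier_fourierInv_eq] at h₃
  have h₄ : 𝓕 (toDist d u) = 𝓕 (toDist d (invF d (contRes d s v))) := by
    rw [fourier_toDist_invF_contRes hs, h₃, smulLeftCLM_contSym_denom hs]
  have h₅ := congrArg 𝓕⁻ h₄
  rwa [FourierTransform.fourierInv_fourier_eq, FourierTransform.fourierInv_fourier_eq] at h₅

end FreeResolvent

/-! ### Identification of the limit operator with multiplication by V. -/

section Potential

open Filter Topology

variable {d : ℕ} {s : ℝ}

theorem tendsto_integral_mul_of_eLpNorm {α : Type*} [MeasurableSpace α] {μ : Measure α}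
    {p q : ℝ≥0∞} [p.HolderConjugate q] {G : ℕ → α → ℂ} {g χ : α → ℂ} (hG : ∀ n, MemLp (G n) p μ)
    (hg : MemLp g p μ) (hχ : MemLp χ q μ)
    (hlim : Tendsto (fun n => (eLpNorm (g - G n) p μ).toReal) atTop (𝓝 0)) :
    Tendsto (fun n => ∫ x, G n x * χ x ∂μ) atTop (𝓝 (∫ x, g x * χ x ∂μ)) := by
  rw [tendsto_iff_norm_sub_tendsto_zero]
  have hlim' := hlim.mul_const (eLpNorm χ q μ).toReal
  rw [zero_mul] at hlim'
  refine squeeze_zero (fun n => norm_nonneg _) (fun n => ?_) hlim'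
  have h₁ : Integrable (fun x => G n x * χ x) μ := (hG n).integrable_mul hχ
  have h₂ : Integrable (fun x => g x * χ x) μ := hg.integrable_mul hχ
  have h₃ : Integrable ((g - G n) • χ) μ := (hg.sub (hG n)).integrable_mul hχ
  rw [norm_sub_rev, ← integral_sub h₂ h₁]
  have h₄ : ∀ x, g x * χ x - G n x * χ x = ((g - G n) • χ) x := fun x => by
    simp only [Pi.smul_apply', Pi.sub_apply, smul_eq_mul]
    ring
  simp only [h₄]
  refine (norm_integral_le_integral_norm _).trans ?_
  rw [integral_norm_eq_lintegral_enorm h₃.1, ← eLpNorm_one_eq_lintegral_enorm,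
    ← ENNReal.toReal_mul]
  refine ENNReal.toReal_mono (ENNReal.mul_ne_top (hg.sub (hG n)).2.ne hχ.2.ne) ?_
  exact eLpNorm_smul_le_mul_eLpNorm hχ.1 (hg.sub (hG n)).1

theorem integral_spaceFun_mul {c : Space d → ℂ} (hc : Integrable c) (θ : 𝓢(Space d, ℂ)) :
    ∫ x, spaceFun c x * θ x = ∫ ζ, c ζ * 𝓕⁻ θ ζ := by
  have h₁ : Integrable (Function.uncurry fun x ζ : Space d => c ζ * spacePhase ζ x * θ x)
      ((volume : Measure (Space d)).prod volume) := by
    have e₁ : Integrable (fun z : Space d × Space d => θ z.1 * c z.2)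
        ((volume : Measure (Space d)).prod volume) := θ.integrable.mul_prod hc
    have e₂ := e₁.mul_bdd (c := 1)
      (continuous_spacePhase.comp continuous_swap).aestronglyMeasurable
      (ae_of_all _ fun z => (norm_spacePhase z.2 z.1).le)
    refine e₂.congr (ae_of_all _ fun z => ?_)
    simp only [Function.comp_apply, Function.uncurry, Prod.fst_swap, Prod.snd_swap]
    ring
  have h₂ : ∀ x, spaceFun c x * θ x = ∫ ζ, c ζ * spacePhase ζ x * θ x := fun x => by
    rw [spaceFun, integral_mul_const]
  simp only [h₂]
  rw [integral_integral_swap h₁]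
  refine integral_congr_ae (ae_of_all _ fun ζ => ?_)
  simp only
  rw [SchwartzMap.fourierInv_coe, Real.fourierInv_eq, ← integral_const_mul]
  refine integral_congr_ae (ae_of_all _ fun x => ?_)
  simp only [spacePhase, Circle.smul_def, smul_eq_mul, real_inner_comm ζ x]
  ring

theorem eLpNorm_sub_toReal_eq {α : Type*} [MeasurableSpace α] {μ : Measure α} (f g : Lp ℂ 2 μ) :
    (eLpNorm (f - g : α → ℂ) 2 μ).toReal = ‖f - g‖ := by
  rw [Lp.norm_def, eLpNorm_congr_ae (Lp.coeFn_sub f g)]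

theorem exists_subseq_ae_tendsto {α : Type*} [MeasurableSpace α] {μ : Measure α}
    {F : ℕ → Lp ℂ 2 μ} {f : Lp ℂ 2 μ} (h : Tendsto F atTop (𝓝 f)) :
    ∃ ns : ℕ → ℕ, StrictMono ns ∧ ∀ᵐ x ∂μ, Tendsto (fun k => F (ns k) x) atTop (𝓝 (f x)) :=
  (tendstoInMeasure_of_tendsto_Lp h).exists_seq_tendsto_ae

theorem invF_contRes_toLp (hs : 0 < s) (χ : 𝓢(Space d, ℂ)) :
    invF d (contRes d s (χ.toLp 2)) =
      (𝓕⁻ (SchwartzMap.smulLeftCLM ℂ (fun ξ : Space d => (contSym s ξ : ℂ)) χ)).toLp 2 := by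
  rw [← invF_toLp]
  congr 1
  refine mulCLM_eq_of_ae (memLp_top_contSym hs) ?_
  filter_upwards [(SchwartzMap.smulLeftCLM ℂ (fun ξ : Space d => (contSym s ξ : ℂ))
    χ).coeFn_toLp 2 volume, χ.coeFn_toLp 2 volume] with x e₁ e₂
  rw [e₁, e₂, SchwartzMap.smulLeftCLM_apply_apply (hasTemperateGrowth_contSym hs), smul_eq_mul]

theorem tendsto_integral_mul_schwartz {F : ℕ → L2 d} {f : L2 d} (hF : Tendsto F atTop (𝓝 f))
    (N : 𝓢(Space d, ℂ)) : Tendsto (fun n => ∫ x, F n x * N x) atTop (𝓝 (∫ x, f x * N x)) := by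
  refine tendsto_integral_mul_of_eLpNorm (p := 2) (q := 2) (fun n => Lp.memLp _) (Lp.memLp _)
    (N.memLp 2) ?_
  simp only [eLpNorm_sub_toReal_eq]
  have := tendsto_iff_norm_sub_tendsto_zero.1 hF
  simpa only [norm_sub_rev] using this

theorem integral_mulCLM_spaceFun_mul {c : Space d → ℂ} (hc : Integrable c)
    {u N θ : 𝓢(Space d, ℂ)} (hθ : ∀ x, θ x = N x * u x) :
    ∫ x, mulCLM volume (spaceFun c) (u.toLp 2) x * N x = ∫ ζ, c ζ * 𝓕⁻ θ ζ := by
  rw [← integral_spaceFun_mul hc]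
  refine integral_congr_ae ?_
  filter_upwards [coeFn_mulCLM (memLp_top_spaceFun hc) (u.toLp 2), u.coeFn_toLp 2 volume]
    with x e₁ e₂
  rw [e₁, e₂, hθ]
  ring

/-- The limit of regular potentials whose Fourier transforms converge in `L¹ + L^p`. -/
theorem limit_mulCLM_spaceFun_ae_eq {V : Space d → ℝ} {p q : ℝ} (hpq : p.HolderConjugate q)
    {g₁ g₂ : Space d → ℂ} (hg₁ : MemLp g₁ 1) (hg₂ : MemLp g₂ (ENNReal.ofReal p))
    (hVi : ∀ ψ : 𝓢(Space d, ℂ), Integrable fun x => (V x : ℂ) * ψ x)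
    (hV : ∀ ψ : 𝓢(Space d, ℂ), ∫ x, (V x : ℂ) * (𝓕 ψ) x = ∫ ξ, (g₁ ξ + g₂ ξ) * ψ ξ)
    {a b : ℕ → Space d → ℂ} (ha : ∀ n, MemLp (a n) 1)
    (hb : ∀ n, MemLp (b n) 1) (hbp : ∀ n, MemLp (b n) (ENNReal.ofReal p))
    (hag : Tendsto (fun n => (eLpNorm (g₁ - a n) 1 volume).toReal) atTop (𝓝 0))
    (hbg : Tendsto (fun n => (eLpNorm (g₂ - b n) (ENNReal.ofReal p) volume).toReal) atTop (𝓝 0))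
    (u : 𝓢(Space d, ℂ)) {w : L2 d}
    (hw : Tendsto (fun n => mulCLM volume (spaceFun fun ζ => a n ζ + b n ζ) (u.toLp 2)) atTop
      (𝓝 w)) : ∀ᵐ x, w x = (V x : ℂ) * u x := by
  have := hpq.ennrealOfReal
  refine ae_eq_of_integral_contDiff_smul_eq ((Lp.memLp w).locallyIntegrable one_le_two)
    (hVi u).locallyIntegrable fun η hη hηc => ?_
  have hηc' : HasCompactSupport fun x => (η x : ℂ) := hηc.comp_left Complex.ofReal_zero
  have hηs : ContDiff ℝ _ fun x => (η x : ℂ) := Complex.ofRealCLM.contDiff.comp hη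
  obtain ⟨N, hN⟩ : ∃ N : 𝓢(Space d, ℂ), ∀ x, N x = (η x : ℂ) :=
    ⟨hηc'.toSchwartzMap hηs, fun x => rfl⟩
  obtain ⟨θ, hθ⟩ : ∃ θ : 𝓢(Space d, ℂ), ∀ x, θ x = N x * u x := by
    refine ⟨SchwartzMap.smulLeftCLM ℂ (fun x => (η x : ℂ)) u, fun x => ?_⟩
    rw [SchwartzMap.smulLeftCLM_apply_apply (hηc'.hasTemperateGrowth hηs), smul_eq_mul, hN]
  -- Both sides are tested against a smooth compactly supported η. Since θ = ηu is Schwartz, the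
  -- pairing of V with it is that of g₁ + g₂ with 𝓕⁻θ, and the approximants converge to the same
  -- pairing by Hölder.
  have hr : ∫ x, η x • ((V x : ℂ) * u x) = ∫ ξ, (g₁ ξ + g₂ ξ) * 𝓕⁻ θ ξ := by
    rw [← hV, FourierTransform.fourier_fourierInv_eq]
    refine integral_congr_ae (ae_of_all _ fun x => ?_)
    simp only [hθ, hN, Complex.real_smul]
    ring
  have hl : ∫ x, η x • w x = ∫ x, w x * N x := by
    refine integral_congr_ae (ae_of_all _ fun x => ?_)
    simp only [hN, Complex.real_smul]
    ring
  rw [hr, hl]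
  have hlim := tendsto_integral_mul_schwartz hw N
  have hn : ∀ n, ∫ x, mulCLM volume (spaceFun fun ζ => a n ζ + b n ζ) (u.toLp 2) x * N x =
      (∫ ζ, a n ζ * 𝓕⁻ θ ζ) + ∫ ζ, b n ζ * 𝓕⁻ θ ζ := by
    intro n
    have i₁ : Integrable fun ζ => a n ζ * 𝓕⁻ θ ζ := (ha n).integrable_mul ((𝓕⁻ θ).memLp ⊤)
    have i₂ : Integrable fun ζ => b n ζ * 𝓕⁻ θ ζ := (hb n).integrable_mul ((𝓕⁻ θ).memLp ⊤)
    rw [← integral_add i₁ i₂, integral_mulCLM_spaceFun_mul (c := fun ζ => a n ζ + b n ζ)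
      ((memLp_one_iff_integrable.1 (ha n)).add (memLp_one_iff_integrable.1 (hb n))) hθ]
    refine integral_congr_ae (ae_of_all _ fun ζ => ?_)
    simp only
    ring
  simp only [hn] at hlim
  have h₁ := tendsto_integral_mul_of_eLpNorm ha hg₁ ((𝓕⁻ θ).memLp ⊤) hag
  have h₂ := tendsto_integral_mul_of_eLpNorm hbp hg₂ ((𝓕⁻ θ).memLp (ENNReal.ofReal q)) hbg
  rw [tendsto_nhds_unique hlim (h₁.add h₂)]
  have j₁ : Integrable fun ζ => g₁ ζ * 𝓕⁻ θ ζ := hg₁.integrable_mul ((𝓕⁻ θ).memLp ⊤)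
  have j₂ : Integrable fun ζ => g₂ ζ * 𝓕⁻ θ ζ :=
    hg₂.integrable_mul ((𝓕⁻ θ).memLp (ENNReal.ofReal q))
  rw [← integral_add j₁ j₂]
  refine integral_congr_ae (ae_of_all _ fun ζ => ?_)
  simp only
  ring

theorem tendsto_invF_comp {T : ℕ → L2 d →L[ℂ] L2 d} {B : L2 d →L[ℂ] L2 d}
    (hT : Tendsto T atTop (𝓝 B)) (f : L2 d) :
    Tendsto (fun n => invF d (T n f)) atTop (𝓝 (invF d (B f))) :=
  ((invF d).continuous.tendsto _).comp
    (((ContinuousLinearMap.apply ℂ (L2 d) f).continuous.tendsto B).comp hT)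

theorem invF_freqPot_mul_contRes_toLp (hs : 0 < s) (a : Space d → ℂ) (χ : 𝓢(Space d, ℂ)) :
    invF d ((freqPot a * contRes d s) (χ.toLp 2)) = mulCLM volume (spaceFun a)
      ((𝓕⁻ (SchwartzMap.smulLeftCLM ℂ (fun ξ : Space d => (contSym s ξ : ℂ)) χ)).toLp 2) := by
  rw [mul_apply_eq_comp, invF_freqPot, invF_contRes_toLp hs]

/-- The norm limit of the operators with regular potentials acts as the multiplication by `V`, on
functions with a Schwartz preimage under the free resolvent. -/
theorem invF_limit_toLp {V : Space d → ℝ} {p q : ℝ} (hpq : p.HolderConjugate q)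
    {g₁ g₂ : Space d → ℂ} (hg₁ : MemLp g₁ 1) (hg₂ : MemLp g₂ (ENNReal.ofReal p))
    (hVi : ∀ ψ : 𝓢(Space d, ℂ), Integrable fun x => (V x : ℂ) * ψ x)
    (hV : ∀ ψ : 𝓢(Space d, ℂ), ∫ x, (V x : ℂ) * (𝓕 ψ) x = ∫ ξ, (g₁ ξ + g₂ ξ) * ψ ξ)
    (hs : 0 < s) {B : L2 d →L[ℂ] L2 d} {a b : ℕ → Space d → ℂ} (ha : ∀ n, MemLp (a n) 1)
    (hb : ∀ n, MemLp (b n) 1) (hbp : ∀ n, MemLp (b n) (ENNReal.ofReal p))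
    (hag : Tendsto (fun n => (eLpNorm (g₁ - a n) 1 volume).toReal) atTop (𝓝 0))
    (hbg : Tendsto (fun n => (eLpNorm (g₂ - b n) (ENNReal.ofReal p) volume).toReal) atTop (𝓝 0))
    (hB : Tendsto (fun n => freqPot (fun ζ => a n ζ + b n ζ) * contRes d s) atTop (𝓝 B))
    (χ : 𝓢(Space d, ℂ)) :
    invF d (B (χ.toLp 2)) =ᵐ[volume]
      fun x => (V x : ℂ) * invF d (contRes d s (χ.toLp 2)) x := by
  have hw := tendsto_invF_comp hB (χ.toLp 2)
  rw [funext fun n => invF_freqPot_mul_contRes_toLp hs _ χ] at hw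
  have h₁ := limit_mulCLM_spaceFun_ae_eq hpq hg₁ hg₂ hVi hV ha hb hbp hag hbg _ hw
  have h₂ := (𝓕⁻ (SchwartzMap.smulLeftCLM ℂ (fun ξ : Space d => (contSym s ξ : ℂ))
    χ)).coeFn_toLp 2 volume
  rw [invF_contRes_toLp hs]
  filter_upwards [h₁, h₂] with x e₁ e₂
  rw [e₁, e₂]

/-- If the image under `B` corresponds to the multiplication by `V` on a dense set, then it does
so everywhere. -/
theorem invF_eq_mul_of_dense {V : Space d → ℝ} {A B : L2 d →L[ℂ] L2 d}
    (h : ∀ χ : 𝓢(Space d, ℂ), invF d (B (χ.toLp 2)) =ᵐ[volume]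
      fun x => (V x : ℂ) * invF d (A (χ.toLp 2)) x) (f : L2 d) :
    invF d (B f) =ᵐ[volume] fun x => (V x : ℂ) * invF d (A f) x := by
  have hd := SchwartzMap.denseRange_toLpCLM (F := ℂ) (μ := (volume : Measure (Space d)))
    (p := 2) ENNReal.ofNat_ne_top
  obtain ⟨F, hF, hFf⟩ := mem_closure_iff_seq_limit.1 (hd f)
  choose χ hχ using hF
  have hχ' : ∀ n, (χ n).toLp 2 = F n := hχ
  have h₁ : Tendsto (fun n => invF d (A (F n))) atTop (𝓝 (invF d (A f))) :=
    (((invF d).continuous.comp A.continuous).tendsto f).comp hFf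
  have h₂ : Tendsto (fun n => invF d (B (F n))) atTop (𝓝 (invF d (B f))) :=
    (((invF d).continuous.comp B.continuous).tendsto f).comp hFf
  obtain ⟨ns, hns, h₃⟩ := exists_subseq_ae_tendsto h₁
  -- Extracted from the first subsequence, so that both sides of the identity converge almost
  -- everywhere along the same indices.
  obtain ⟨ms, hms, h₄⟩ := exists_subseq_ae_tendsto (h₂.comp hns.tendsto_atTop)
  have h₅ : ∀ᵐ x, ∀ n, invF d (B (F n)) x = (V x : ℂ) * invF d (A (F n)) x := by
    rw [ae_all_iff]
    intro n
    rw [← hχ' n]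
    exact h (χ n)
  filter_upwards [h₃, h₄, h₅] with x e₃ e₄ e₅
  refine tendsto_nhds_unique e₄ ?_
  simp only [Function.comp_apply, e₅]
  exact (e₃.comp hms.tendsto_atTop).const_mul _

end Potential

/-! ### The resolvent of the continuum Schrödinger operator. -/

section ContinuumResolvent

variable {d : ℕ} {s : ℝ}

theorem mem_domain_mulOp {α : Type*} [MeasurableSpace α] {μ : Measure α} {W : α → ℝ}
    {u w : Lp ℂ 2 μ} (h : w =ᵐ[μ] fun x => (W x : ℂ) * u x) : u ∈ (mulOp μ W).domain :=
  MemLp.ae_eq h (Lp.memLp w)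

theorem mulOp_eq {α : Type*} [MeasurableSpace α] {μ : Measure α} {W : α → ℝ}
    {u : (mulOp μ W).domain} {w : Lp ℂ 2 μ} (h : w =ᵐ[μ] fun x => (W x : ℂ) * (u : Lp ℂ 2 μ) x) :
    mulOp μ W u = w :=
  Lp.ext ((coeFn_mulOp u).trans h.symm)

theorem contOp_eq {V : Space d → ℝ} {u : L2 d}
    (hu : TemperedDistribution.MemSobolev 2 2 (toDist d u)) {w : L2 d}
    (hw : w =ᵐ[volume] fun x => (V x : ℂ) * u x) (hd : u ∈ (contOp V).domain) :
    contOp V ⟨u, hd⟩ = negLaplacian u hu + w := by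
  have h₁ : contOp V ⟨u, hd⟩ = freeOp d ⟨u, hd.1⟩ + mulOp volume V ⟨u, hd.2⟩ :=
    LinearPMap.add_apply _ _ _
  have h₂ : mulOp volume V ⟨u, hd.2⟩ = w := mulOp_eq hw
  rw [h₁, h₂]
  rfl

/-- The resolvent of the continuum Schrödinger operator. -/
theorem isResolventAt_contOp {V : Space d → ℝ} (hs : 1 ≤ s) {B S : L2 d →L[ℂ] L2 d}
    (hVB : ∀ f, invF d (B f) =ᵐ[volume] fun x => (V x : ℂ) * invF d (contRes d s f) x)
    (hS₁ : (1 + B) * S = 1) (hS₂ : S * (1 + B) = 1) :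
    IsResolventAt (contOp V) (-(s : ℂ)) (lift (invF d).toLinearIsometry (contRes d s * S)) := by
  have hs0 : 0 < s := by linarith
  -- (H + s)(s − Δ)⁻¹ = 1 + B, with B standing for V(s − Δ)⁻¹. That B takes values in L² also shows
  -- that V u is in L² for every u in the range of the free resolvent.
  have key : ∀ f (hd : invF d (contRes d s f) ∈ (contOp V).domain),
      contOp V ⟨invF d (contRes d s f), hd⟩ - (-(s : ℂ)) • invF d (contRes d s f) =
        invF d ((1 + B) f) := by
    intro f hd
    rw [contOp_eq (memSobolev_invF_contRes hs f) (hVB f) hd, add_apply, one_apply_eq_self, map_add,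
      ← negLaplacian_invF_contRes hs0 f (memSobolev_invF_contRes hs f), neg_smul, sub_neg_eq_add]
    abel
  constructor
  · intro y
    rw [lift_linearIsometryEquiv_apply, mul_apply_eq_comp]
    have hd : invF d (contRes d s (S ((invF d).symm y))) ∈ (contOp V).domain :=
      ⟨memSobolev_invF_contRes hs _, mem_domain_mulOp (hVB _)⟩
    refine ⟨hd, ?_⟩
    rw [key, ← mul_apply_eq_comp, hS₁, one_apply_eq_self, LinearIsometryEquiv.apply_symm_apply]
  · rintro ⟨x, hd⟩
    have h₁ := eq_invF_contRes hs0 x hd.1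
    generalize (invF d).symm (negLaplacian x hd.1 + (s : ℂ) • x) = f at h₁
    subst h₁
    rw [key, lift_linearIsometryEquiv_apply, LinearIsometryEquiv.symm_apply_apply,
      mul_apply_eq_comp, ← mul_apply_eq_comp S, hS₂, one_apply_eq_self]

end ContinuumResolvent

/-! ### Norm resolvent convergence at −s. -/

section NormLimit

/-- Self-adjointness of the continuum resolvent is inherited from the lattice resolvents through the
norm limit, so no separate argument for H is required. -/
theorem isSelfAdjoint_of_forall_exists {X : Type*} [NormedAddCommGroup X] [InnerProductSpace ℂ X]
    [CompleteSpace X] {R : X →L[ℂ] X}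
    (h : ∀ ε > 0, ∃ T : X →L[ℂ] X, IsSelfAdjoint T ∧ ‖T - R‖ < ε) : IsSelfAdjoint R := by
  refine eq_of_forall_dist_le fun ε hε => ?_
  obtain ⟨T, hT, hTR⟩ := h (ε / 2) (by positivity)
  have e : star R - R = (T - R) - star (T - R) := by
    rw [star_sub, hT.star_eq]
    abel
  rw [dist_eq_norm, e]
  refine (norm_sub_le _ _).trans ?_
  rw [norm_star]
  linarith

/-- With T − S = S(A − B)T one has DS − ET = (D − E)S − E·S(A − B)T, and the bounds 2 on S and T
give the constants. -/
theorem norm_mul_inverse_sub_le {X : Type*} [NormedAddCommGroup X] [NormedSpace ℂ X]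
    {A B S T D E : X →L[ℂ] X} {c : ℝ} (hS : S * (1 + A) = 1) (hT : (1 + B) * T = 1)
    (hS2 : ‖S‖ ≤ 2) (hT2 : ‖T‖ ≤ 2) (hE : ‖E‖ ≤ c) :
    ‖D * S - E * T‖ ≤ 2 * ‖D - E‖ + 4 * c * ‖A - B‖ := by
  have e : D * S - E * T = (D - E) * S - E * (S * (A - B) * T) := by
    have h₁ : S * (A - B) * T = T - S := by
      calc S * (A - B) * T = S * (1 + A) * T - S * ((1 + B) * T) := by noncomm_ring
        _ = T - S := by rw [hS, hT, one_mul, mul_one]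
    rw [h₁]
    noncomm_ring
  have hc : 0 ≤ c := (norm_nonneg E).trans hE
  have h₂ : ‖(D - E) * S‖ ≤ ‖D - E‖ * 2 :=
    (norm_mul_le _ _).trans (mul_le_mul_of_nonneg_left hS2 (norm_nonneg _))
  have h₃ : ‖S * (A - B) * T‖ ≤ 2 * ‖A - B‖ * 2 := by
    refine (norm_mul_le _ _).trans ?_
    refine mul_le_mul ((norm_mul_le _ _).trans ?_) hT2 (norm_nonneg _) (by positivity)
    exact mul_le_mul_of_nonneg_right hS2 (norm_nonneg _)
  have h₄ : ‖E * (S * (A - B) * T)‖ ≤ c * (2 * ‖A - B‖ * 2) :=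
    (norm_mul_le _ _).trans (mul_le_mul hE h₃ (norm_nonneg _) hc)
  rw [e]
  refine (norm_sub_le _ _).trans ?_
  linarith

variable {d : ℕ} {V : Space d → ℝ} {φ : 𝓢(Space d, ℝ)}

/-- Norm resolvent convergence far to the left of the spectrum. -/
theorem exists_resolvent_tendsto {p q : ℝ} (hpq : p.HolderConjugate q) (hp2 : p ≤ 2)
    (hq : (d : ℝ) < 2 * q) (hV : FourierMemL1AddLp V p) (hφ : ∫ x, φ x = 1) :
    ∃ s₀ : ℝ, 1 ≤ s₀ ∧ ∀ s ≥ s₀, ∃ R, IsResolventAt (contOp V) (-(s : ℂ)) R ∧ IsSelfAdjoint R ∧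
      ∀ ε > 0, ∃ h₀ > 0, ∀ (h : ℝ) (hh : 0 < h), h < h₀ →
        ∃ R', IsResolventAt (latOp φ V h) (-(s : ℂ)) R' ∧ IsSelfAdjoint R' ∧
          ‖lift (latEmb d h hh) R' - R‖ < ε := by
  obtain ⟨hVi, g₁, g₂, hg₁, hg₂, hVg⟩ := hV
  obtain ⟨s₀, hs₀, H⟩ := exists_limit_torusPot_mul_latRes (𝓕 (complexify φ))
    (fourier_complexify_zero hφ) hpq hp2 hq hg₁ hg₂
  refine ⟨s₀, hs₀, fun s hs => ?_⟩
  obtain ⟨hA, B, hB, hAB, a, b, ha, hb, hbp, hag, hbg, hlim⟩ := H s hs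
  have hs1 : 1 ≤ s := hs₀.trans hs
  have hs0 : 0 < s := by linarith
  obtain ⟨T, hT₁, hT₂, hT⟩ := exists_inverse_of_norm_le_half hB
  have hVB := invF_eq_mul_of_dense (invF_limit_toLp hpq hg₁ hg₂ hVi hVg hs0 ha hb hbp hag hbg hlim)
  have hR := isResolventAt_contOp hs1 hVB hT₁ hT₂
  have conv : ∀ ε > 0, ∃ h₀ > 0, ∀ (h : ℝ) (hh : 0 < h), h < h₀ →
        ∃ R', IsResolventAt (latOp φ V h) (-(s : ℂ)) R' ∧ IsSelfAdjoint R' ∧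
          ‖lift (latEmb d h hh) R' - lift (invF d).toLinearIsometry (contRes d s * T)‖ < ε := by
    intro ε hε
    obtain ⟨h₁, hh₁, hconv⟩ := hAB (ε / 8) (by positivity)
    -- The free part contributes 2·3h² < ε/2 because h < 1 and h < ε/12; the potential part
    -- contributes at most 4s⁻¹·ε/8 ≤ ε/2.
    refine ⟨min (min 1 h₁) (ε / 12), by positivity, fun h hh hlt => ?_⟩
    rw [lt_min_iff, lt_min_iff] at hlt
    have hf : Integrable fun ζ => (g₁ ζ + g₂ ζ) * (𝓕 (complexify φ)) (h • ζ) := by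
      refine ((integrable_mul_schwartz_comp_smul hg₁ (𝓕 (complexify φ)) h).add
        (integrable_mul_schwartz_comp_smul_of_memLp hpq hg₂ (𝓕 (complexify φ)) hh)).congr
        (ae_of_all _ fun ζ => ?_)
      simp only [Pi.add_apply]
      ring
    obtain ⟨S, hS₁, hS₂, hS⟩ := exists_inverse_of_norm_le_half
      ((norm_lift_le (I := cellEmb h hh) _).trans (hA h hh))
    obtain ⟨R', hR', hsa, hlift⟩ := exists_latOp_resolvent hh hs0 hf
      (latPotential_eq_latFun (φ := φ) hVg hh) hS₁ hS₂
    refine ⟨R', hR', hsa, ?_⟩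
    rw [hlift, ← lift_sub]
    refine (norm_lift_le _ _).trans_lt ?_
    refine (norm_mul_inverse_sub_le hS₂ hT₁ hS hT (norm_contRes_le hs0)).trans_lt ?_
    have e₁ := norm_lift_latRes_sub_contRes_le (d := d) hh hs0
    have e₂ := hconv h hh hlt.1.2
    have e₃ : s⁻¹ ≤ 1 := inv_le_one_of_one_le₀ hs1
    have e₄ : 4 * s⁻¹ * ‖lift (cellEmb h hh) (torusPot h hh
        (fun ζ => (g₁ ζ + g₂ ζ) * (𝓕 (complexify φ)) (h • ζ)) * latRes d h s) - B‖ ≤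
        4 * 1 * (ε / 8) := by
      gcongr
    have e₅ : h ^ 2 < ε / 12 := by nlinarith [hlt.1.1, hlt.2]
    linarith
  refine ⟨_, hR, isSelfAdjoint_of_forall_exists fun ε hε => ?_, conv⟩
  obtain ⟨h₀, hh₀, hc⟩ := conv ε hε
  obtain ⟨R', -, hsa, hlt⟩ := hc (h₀ / 2) (by positivity) (by linarith)
  exact ⟨_, isSelfAdjoint_lift _ hsa, hlt⟩

end NormLimit

/-! ### Points outside the essential spectrum, and the exponents. -/

section Isolation

variable {X : Type*} [NormedAddCommGroup X] [NormedSpace ℂ X]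

theorem eigenspace_eq_bot_of_mem_rho {A : X →ₗ.[ℂ] X} {z : ℂ} (hz : z ∈ rho A) :
    eigenspace A z = ⊥ := by
  obtain ⟨R, hR⟩ := hz
  refine (Submodule.eq_bot_iff _).2 ?_
  rintro x ⟨hx, hx'⟩
  have := hR.2 ⟨x, hx⟩
  rw [hx', sub_self, map_zero] at this
  exact this.symm

theorem isOpen_rho [CompleteSpace X] (A : X →ₗ.[ℂ] X) : IsOpen (rho A) := by
  rw [Metric.isOpen_iff]
  rintro z ⟨R, hR⟩
  have h₁ : ∀ᶠ w in nhds z, IsUnit (1 - (w - z) • R) := by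
    have hc : Continuous fun w : ℂ => 1 - (w - z) • R := by fun_prop
    refine hc.continuousAt.eventually_mem (Units.isOpen.mem_nhds ?_)
    simp
  obtain ⟨ε, hε, h₂⟩ := Metric.eventually_nhds_iff.1 h₁
  exact ⟨ε, hε, fun w hw => (hR.mem_rho_iff).2 (h₂ hw)⟩

/-- Points of the resolvent set are treated together with isolated eigenvalues, as eigenvalues of
multiplicity 0; openness of the resolvent set provides their isolation radius. -/
theorem exists_isolation [CompleteSpace X] {A : X →ₗ.[ℂ] X} {z : ℂ} (hz : z ∉ sigmaEss A) :
    FiniteDimensional ℂ (eigenspace A z) ∧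
      ∃ γ > 0, ∀ w ∈ sigma A, dist w z < γ → w = z := by
  by_cases hzr : z ∈ rho A
  · refine ⟨?_, ?_⟩
    · rw [eigenspace_eq_bot_of_mem_rho hzr]
      infer_instance
    · obtain ⟨ε, hε, h⟩ := Metric.isOpen_iff.1 (isOpen_rho A) z hzr
      exact ⟨ε, hε, fun w hw hwz => absurd (h hwz) hw⟩
  · have hd : z ∈ sigmaDisc A := by
      by_contra hd
      exact hz ⟨hzr, hd⟩
    exact ⟨hd.2.2.2, hd.2.1⟩

end Isolation

/-- For d ≤ 3, p = q = 2 works because d < 4. For d ≥ 4 the bound p < d/(d−2) is equivalent to q >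
d/2, and d/(d−2) ≤ 2 gives p ≤ 2. -/
theorem exists_holderConjugate {d : ℕ} {p : ℝ}
    (hp : (1 ≤ d ∧ d ≤ 3 ∧ p = 2) ∨ (4 ≤ d ∧ 1 < p ∧ p < (d : ℝ) / ((d : ℝ) - 2))) :
    p ≤ 2 ∧ ∃ q : ℝ, p.HolderConjugate q ∧ (d : ℝ) < 2 * q := by
  rcases hp with ⟨-, h3, rfl⟩ | ⟨h4, h1, h2⟩
  · refine ⟨le_rfl, 2, (Real.holderConjugate_iff).2 ⟨by norm_num, by norm_num⟩, ?_⟩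
    have : (d : ℝ) ≤ 3 := by exact_mod_cast h3
    linarith
  · have h4' : (4 : ℝ) ≤ d := by exact_mod_cast h4
    have h5 : p * (d - 2) < d := (lt_div_iff₀ (by linarith)).1 h2
    refine ⟨by nlinarith, p.conjExponent, Real.HolderConjugate.conjExponent h1, ?_⟩
    rw [Real.conjExponent, mul_div_assoc', lt_div_iff₀ (by linarith)]
    linarith

/-! ### From resolvent convergence at one point to the two assertions. -/

section Transfer

variable {X : Type*} [NormedAddCommGroup X] [InnerProductSpace ℂ X] [CompleteSpace X]
  {Y : ℝ → Type} [∀ h, NormedAddCommGroup (Y h)] [∀ h, InnerProductSpace ℂ (Y h)]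
  [∀ h, CompleteSpace (Y h)] {A : X →ₗ.[ℂ] X} {A' : ∀ h, Y h →ₗ.[ℂ] Y h}
  {I : ∀ h, 0 < h → Y h →ₗᵢ[ℂ] X}

/-- Norm convergence of self-adjoint resolvents at `z₀`, along the embeddings `I h`, as `h → 0`. -/
def NormResolventLimit (A : X →ₗ.[ℂ] X) (A' : ∀ h, Y h →ₗ.[ℂ] Y h)
    (I : ∀ h, 0 < h → Y h →ₗᵢ[ℂ] X) (z₀ : ℂ) : Prop :=
  ∃ R, IsResolventAt A z₀ R ∧ IsSelfAdjoint R ∧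
    ∀ ε > 0, ∃ h₀ > 0, ∀ (h : ℝ) (hh : 0 < h), h < h₀ →
      ∃ R', IsResolventAt (A' h) z₀ R' ∧ IsSelfAdjoint R' ∧ ‖lift (I h hh) R' - R‖ < ε

theorem NormResolventLimit.exists_norm_sub_lt {z₀ : ℂ} (H : NormResolventLimit A A' I z₀) {z : ℂ}
    (hz : z ∉ sigma A) {ε : ℝ} (hε : 0 < ε) :
    ∃ h₀ > 0, ∀ (h : ℝ) (hh : 0 < h), h < h₀ → z ∉ sigma (A' h) ∧
      ‖(I h hh).toContinuousLinearMap ∘L res (A' h) z ∘L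
        ContinuousLinearMap.adjoint (I h hh).toContinuousLinearMap - res A z‖ < ε := by
  obtain ⟨R, hR, -, hconv⟩ := H
  have hzr : z ∈ rho A := by
    by_contra hzr
    exact hz hzr
  obtain ⟨δ, hδ, hstab⟩ := hR.exists_norm_lift_res_sub_lt hzr hε
  obtain ⟨h₀, hh₀, hlim⟩ := hconv δ hδ
  refine ⟨h₀, hh₀, fun h hh hlt => ?_⟩
  obtain ⟨R', hR', -, hRR'⟩ := hlim h hh hlt
  obtain ⟨hzr', hres⟩ := hstab (I h hh) _ R' hR' hRR'
  exact ⟨fun hzs => hzs hzr', hres⟩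

theorem NormResolventLimit.exists_sigmaDisc_stable {z₀ : ℂ} (H : NormResolventLimit A A' I z₀)
    {z : ℂ} (hz : z ∉ sigmaEss A) (hzz : z ≠ z₀) :
    ∃ γ₀ > 0, ∀ γ : ℝ, 0 < γ → γ < γ₀ → ∃ h₀ > 0, ∀ h : ℝ, 0 < h → h < h₀ →
      sigma (A' h) ∩ Metric.ball z γ ⊆ sigmaDisc (A' h) ∧
      (sigmaDisc (A' h) ∩ Metric.ball z γ).Finite ∧
      ∑ᶠ w ∈ sigmaDisc (A' h) ∩ Metric.ball z γ, mult (A' h) w = mult A z := by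
  obtain ⟨R, hR, hsa, hconv⟩ := H
  obtain ⟨hfin, γ₀, hγ₀, hiso⟩ := exists_isolation hz
  refine ⟨γ₀, hγ₀, fun γ hγ hlt => ?_⟩
  obtain ⟨δ, hδ, hstab⟩ := hR.exists_sigmaDisc_stable hsa hzz hiso hγ hlt
  obtain ⟨h₀, hh₀, hlim⟩ := hconv δ hδ
  refine ⟨h₀, hh₀, fun h hh hhlt => ?_⟩
  obtain ⟨R', hR', hsa', hRR'⟩ := hlim h hh hhlt
  exact hstab (I h hh) _ R' hR' hsa' hRR'

end Transfer

theorem normResolventLimit_latOp {d : ℕ} {p q : ℝ} (hpq : p.HolderConjugate q) (hp2 : p ≤ 2)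
    (hq : (d : ℝ) < 2 * q) {V : Space d → ℝ} (hV : FourierMemL1AddLp V p) {φ : 𝓢(Space d, ℝ)}
    (hφ : ∫ x, φ x = 1) : ∃ s₀ : ℝ, ∀ s ≥ s₀,
      NormResolventLimit (contOp V) (latOp φ V) (latEmb d) (-(s : ℂ)) := by
  obtain ⟨s₀, -, H⟩ := exists_resolvent_tendsto hpq hp2 hq hV hφ
  exact ⟨s₀, H⟩

end ContinuumLimit

open ContinuumLimit

theorem theorem3 (d : ℕ) (p : ℝ)
    (hp : (1 ≤ d ∧ d ≤ 3 ∧ p = 2) ∨ (4 ≤ d ∧ 1 < p ∧ p < (d : ℝ) / ((d : ℝ) - 2)))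
    (V : Space d → ℝ) (hV : FourierMemL1AddLp V p)
    (φ : SchwartzMap (Space d) ℝ) (hφ : ∫ x, φ x = 1) :
    -- norm resolvent convergence
    (∃ I : (h : Set.Ioo (0 : ℝ) 1) → (LatL2 d h →ₗᵢ[ℂ] L2 d),
      ∀ z : ℂ, z ∉ sigma (contOp V) → ∀ ε > 0, ∃ h₀ > 0, ∀ h : Set.Ioo (0 : ℝ) 1, (h : ℝ) < h₀ →
        z ∉ sigma (latOp φ V h) ∧
        ‖(I h).toContinuousLinearMap ∘L res (latOp φ V h) z ∘L
            ContinuousLinearMap.adjoint (I h).toContinuousLinearMap - res (contOp V) z‖ < ε) ∧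
    -- convergence of the discrete spectrum in `ℂ \ σ_ess(H)`, with multiplicities
    (∀ z : ℂ, z ∉ sigmaEss (contOp V) → ∃ γ₀ > 0, ∀ γ : ℝ, 0 < γ → γ < γ₀ →
      ∃ h₀ > 0, ∀ h : ℝ, 0 < h → h < h₀ →
        sigma (latOp φ V h) ∩ Metric.ball z γ ⊆ sigmaDisc (latOp φ V h) ∧
        (sigmaDisc (latOp φ V h) ∩ Metric.ball z γ).Finite ∧
        ∑ᶠ w ∈ sigmaDisc (latOp φ V h) ∩ Metric.ball z γ, mult (latOp φ V h) w =
          mult (contOp V) z) := by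
  obtain ⟨hp2, q, hpq, hq⟩ := exists_holderConjugate hp
  obtain ⟨s₀, H⟩ := normResolventLimit_latOp hpq hp2 hq hV hφ
  refine ⟨⟨fun h => latEmb d h h.2.1, fun z hz ε hε => ?_⟩, fun z hz => ?_⟩
  · obtain ⟨h₀, hh₀, hlim⟩ := (H s₀ le_rfl).exists_norm_sub_lt hz hε
    exact ⟨h₀, hh₀, fun h hlt => hlim h h.2.1 hlt⟩
  -- The counting argument uses (z − z₀)⁻¹, so the base point −s must differ from z; one of s₀ and
  -- s₀ + 1 always does.
  · obtain ⟨s, hs, hsz⟩ : ∃ s ≥ s₀, z ≠ -(s : ℂ) := by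
      by_cases hsz : z = -(s₀ : ℂ)
      · refine ⟨s₀ + 1, by linarith, fun h => ?_⟩
        have := congrArg Complex.re (hsz.symm.trans h)
        simp at this
      · exact ⟨s₀, le_rfl, hsz⟩
    exact (H s hs).exists_sigmaDisc_stable hz hsz
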